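/- All graphs are finite, simple, undirected and non-empty. For a graph $G$ with vertex set $V$, $N(v)$ is the open neighbourhood of $v$ and $\mathrm{Ball}^r_G(v)$ is the set of vertices at distance at most $r$ from $v$ in $G$. For a partition $\mathcal P$ of $V$ and $B\subseteq V$, $B/\mathcal P$ is the set of parts of $\mathcal P$ that intersect $B$; $\mathcal P\preceq\mathcal Q$ means that every part of $\mathcal P$ is contained in a part of $\mathcal Q$. For $A,B\subseteq V$, $AB$ is the set of unordered pairs $ab$ with $a\in A$, $b\in B$, $a\ne b$. *VC-dimension and neighbourhood complexity.* The VC-dimension of $G$ is the maximum size of a set $A\subseteq V$ with $\{N(v)\cap A: v\in V\}=2^A$, and $\pi_G(m)$ is the maximum of $|\{N(v)\cap A: v\in V\}|$ over $A\subseteq V$ with $|A|\le m$. *Flips.* A $\mathcal P$-flip of $G$ is a graph $G'$ on $V$ such that for all parts $X,Y\in\mathcal P$ (possibly $X=Y$), $XY\cap E(G')$ is $XY\cap E(G)$ or $XY\setminus E(G)$. For $S\subseteq V$, $\mathcal N_S$ is the partition of $V$ in which the elements of $S$ form singleton parts and $u,v\notin S$ are in the same part iff $N(u)\cap S=N(v)\cap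 S$. An $S$-flip is an $\mathcal N_S$-flip. Let $\mathrm{Ball}^r_{\mathcal P}(v)$ be the intersection of $\mathrm{Ball}^r_{G'}(v)$ over all $\mathcal P$-flips $G'$ of $G$. *Merge-width.* A merge sequence of $G$ is a sequence $(\mathcal P_1,R_1),\dots,(\mathcal P_m,R_m)$, $m\ge1$, where $\mathcal P_1\preceq\dots\preceq\mathcal P_m$ are partitions of $V$, $\mathcal P_1$ is the partition into singletons, $\mathcal P_m=\{V\}$, $R_1\subseteq\dots\subseteq R_m$ are sets of pairs of distinct vertices, and for each $t$, for all parts $X,Y\in\mathcal P_t$ (possibly $X=Y$), the pairs in $XY\setminus R_t$ are all edges or all non-edges of $G$. Its radius-$r$ width is $\max_{1\le t<m}\max_{v\in V}|\mathrm{Ball}^r_{(V,R_{t+1})}(v)/\mathcal P_t|$ (and $0$ if $m=1$), and $\mathrm{mw}_r(G)$ is the minimum radius-$r$ width of a merge sequence of $G$. *Definable merge-width.* $\mathrm{dmw}_r(G)$ is the minimum, over all total orders $v_1<\dots<v_n$ of $V$, of $\max_{1\le i\le n}\max_{v\in V}|\mathrm{Ball}^r_{\mathcal N_{S_i}}(v)/\mathcal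 N_{S_i}|$, where $S_i=\{v_1,\dots,v_{n-i}\}$. **Theorem.** There is an absolute constant $C\in\mathbb N$ such that the following holds for every $r\in\mathbb N$ and every graph $G$ of VC-dimension $d$. 1. For every integer $k\ge1$ with $\mathrm{mw}_{17r+3}(G)\le k$ there are an integer $0\le M\le C\,d\,k^3$ and a total order on $V$ such that, for every prefix $S$ of this order and every $v\in V$, some $S$-flip $G'$ of $G$ satisfies $$|\mathrm{Ball}^r_{G'}(v)/\mathcal N_S|\le M+k\cdot\pi_G(M);$$ moreover $M+k\cdot\pi_G(M)\le (dk)^{C d}$ provided $dk\ge2$. 2. $\mathrm{dmw}_r(G)\le d^{\,C d}\cdot \mathrm{mw}_{17r+3}(G)^{\,C d}$, where $0^0=1$. -/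

import Mathlib

namespace MergeWidth

/-! ### Balls, partitions and atomic types

Graphs are `SimpleGraph V` with `V` finite and non-empty. A partition of `V` is a `Setoid V` (its
parts are the equivalence classes); `P ≤ Q` says that `P` refines `Q`, `⊥` is the partition into
singletons and `⊤` the partition with one part. -/

/-- The ball `Ball^r_G(v)`: all vertices at distance at most `r` from `v` in `G`. -/
def ball {V : Type*} (G : SimpleGraph V) (r : ℕ) (v : V) : Set V :=
  {w | G.edist v w ≤ (r : ℕ∞)}

/-- The quotient set `B / P`: the parts of `P` that intersect `B`. -/
def quotientSet {V : Type*} (B : Set V) (P : Setoid V) : Set (Set V) :=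
  {X | X ∈ P.classes ∧ (X ∩ B).Nonempty}

/-- The partition `N_S` of the vertices of `G` into atomic types over `S`: elements of `S` are
singleton parts, and two vertices outside `S` are in the same part iff they have the same
neighbours in `S`. -/
def atomicTypes {V : Type*} (G : SimpleGraph V) (S : Set V) : Setoid V where
  r u v := u = v ∨ (u ∉ S ∧ v ∉ S ∧ G.neighborSet u ∩ S = G.neighborSet v ∩ S)
  iseqv :=
    { refl := fun _ => Or.inl rfl
      symm := by
        rintro u v (h | ⟨hu, hv, h⟩)
        · exact Or.inl h.symm
        · exact Or.inr ⟨hv, hu, h.symm⟩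
      trans := by
        rintro u v w (rfl | ⟨hu, hv, h⟩) (rfl | ⟨hv', hw, h'⟩)
        · exact Or.inl rfl
        · exact Or.inr ⟨hv', hw, h'⟩
        · exact Or.inr ⟨hu, hv, h⟩
        · exact Or.inr ⟨hu, hw, h.trans h'⟩ }

/-! ### VC-dimension and neighbourhood complexity -/

open Classical in
/-- The open neighbourhood `N(v)`, as a finite set. -/
noncomputable def nbhd {V : Type*} [Fintype V] (G : SimpleGraph V) (v : V) : Finset V :=
  {w | G.Adj v w}

open Classical in
/-- The VC-dimension of `G`: the maximum size of a set of vertices `A` such that the sets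
`N(v) ∩ A`, for `v` a vertex, are all the subsets of `A`. -/
noncomputable def vcDim {V : Type*} [Fintype V] (G : SimpleGraph V) : ℕ :=
  (Finset.univ.image (nbhd G)).vcDim

open Classical in
/-- The neighbourhood complexity `π_G(m)`: the maximum, over sets `A` of at most `m` vertices, of
the number of distinct sets `N(v) ∩ A`, for `v` a vertex. -/
noncomputable def nbhdComplexity {V : Type*} [Fintype V] (G : SimpleGraph V) (m : ℕ) : ℕ :=
  (Finset.univ.filter fun A : Finset V => A.card ≤ m).sup
    fun A => (Finset.univ.image fun v => nbhd G v ∩ A).card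

/-! ### Flips and the flip metric -/

/-- `G'` is a `P`-flip of `G`: for any two (possibly equal) parts `X`, `Y` of `P`, the pairs between
`X` and `Y` have in `G'` either all the same adjacency as in `G`, or all the opposite one. -/
def IsFlip {V : Type*} (G : SimpleGraph V) (P : Setoid V) (G' : SimpleGraph V) : Prop :=
  ∀ X ∈ P.classes, ∀ Y ∈ P.classes,
    (∀ x ∈ X, ∀ y ∈ Y, x ≠ y → (G'.Adj x y ↔ G.Adj x y)) ∨
    (∀ x ∈ X, ∀ y ∈ Y, x ≠ y → (G'.Adj x y ↔ ¬ G.Adj x y))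

/-- The flip metric of `P`: the maximum distance over all `P`-flips of `G`. -/
noncomputable def flipDist {V : Type*} (G : SimpleGraph V) (P : Setoid V) (x y : V) : ℕ∞ :=
  ⨆ (G' : SimpleGraph V) (_ : IsFlip G P G'), G'.edist x y

/-- The ball `Ball^r_P(v)` of the flip metric. -/
def flipBall {V : Type*} (G : SimpleGraph V) (P : Setoid V) (r : ℕ) (v : V) : Set V :=
  {x | flipDist G P x v ≤ (r : ℕ∞)}

/-! ### Merge-width -/

/-- `P` is homogeneous modulo the set `R` of resolved pairs (the edges of the graph `R`). -/
def IsHomogeneousModulo {V : Type*} (G : SimpleGraph V) (P : Setoid V) (R : SimpleGraph V) :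
    Prop :=
  ∀ X ∈ P.classes, ∀ Y ∈ P.classes,
    ∀ x ∈ X, ∀ y ∈ Y, ∀ x' ∈ X, ∀ y' ∈ Y, x ≠ y → x' ≠ y' →
      ¬ R.Adj x y → ¬ R.Adj x' y' → (G.Adj x y ↔ G.Adj x' y')

/-- A merge sequence `(P_1, R_1), …, (P_m, R_m)` of `G`, where `m = len + 1` and the indices are
shifted to `0, …, len`. The set of pairs `R_t` is given as the edge set of a graph on `V`. -/
structure MergeSequence {V : Type*} (G : SimpleGraph V) where
  len : ℕ
  part : Fin (len + 1) → Setoid V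
  resolved : Fin (len + 1) → SimpleGraph V
  part_mono : Monotone part
  part_first : part 0 = ⊥
  part_last : part (Fin.last len) = ⊤
  resolved_mono : Monotone resolved
  homogeneous : ∀ t, IsHomogeneousModulo G (part t) (resolved t)

/-- The radius-`r` width of a merge sequence: the maximum over consecutive indices `t`, `t + 1` and
vertices `v` of `|Ball^r_{R_{t+1}}(v) / P_t|`. -/
noncomputable def MergeSequence.width {V : Type*} [Fintype V] {G : SimpleGraph V}
    (s : MergeSequence G) (r : ℕ) : ℕ :=
  Finset.univ.sup fun t : Fin s.len => Finset.univ.sup fun v : V =>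
    (quotientSet (ball (s.resolved t.succ) r v) (s.part t.castSucc)).ncard

/-- The radius-`r` merge-width `mw_r(G)`: the minimum radius-`r` width of a merge sequence. -/
noncomputable def mw {V : Type*} [Fintype V] (r : ℕ) (G : SimpleGraph V) : ℕ :=
  sInf (Set.range fun s : MergeSequence G => s.width r)

/-! ### Definable merge-width -/

/-- The radius-`r` definable merge-width of `(G, <)`. If `v_1 < … < v_n` are the vertices, then the
sets `{v_1, …, v_{n-i}}` for `1 ≤ i ≤ n` are exactly the sets `Set.Iio u` for `u` a vertex. -/
noncomputable def dmwOrder {V : Type*} [Fintype V] (r : ℕ) (G : SimpleGraph V)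
    (o : LinearOrder V) : ℕ :=
  Finset.univ.sup fun u : V => Finset.univ.sup fun v : V =>
    (quotientSet (flipBall G (atomicTypes G {w | o.lt w u}) r v)
      (atomicTypes G {w | o.lt w u})).ncard

/-- The radius-`r` definable merge-width `dmw_r(G)`: the minimum over all total orders. -/
noncomputable def dmw {V : Type*} [Fintype V] (r : ℕ) (G : SimpleGraph V) : ℕ :=
  sInf (Set.range fun o : LinearOrder V => dmwOrder r G o)

end MergeWidth

namespace MergeWidth

/-! ### Distances -/

/-! Fix a merge sequence of width at most `k` at radius `17 * r + 3`, with terms `P i`, `R i`. The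
proof builds a chain of sets from `S 0 = V` down to a set `S L` of at most three vertices. Over `S
i` some flip has only edges between vertices at `R i`-distance at most 17, while the balls of `R (i
+ 1)` in question contain only O(d k³) elements of `S i`. The order lists the small sets of the
chain before the large ones. For a prefix between `S (i + 1)` and `S i`, an `r`-ball of the flip
lies in a `17r`-ball of `R (i + 1)`, which meets at most `k` parts of `P i`. Prefix vertices outside
the ball of radius `17r + 1` are homogeneous to what the small ball contains of each part. Hence
within a part the atomic type is decided by the trace on at most `M` vertices, which gives `M + k *
π(M)` (`ncard_ball_le`); Sauer–Shelah bounds this by a power of `dk`.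

A flip with short edges exists once adjacency between far vertices depends only on atomic types
(`FarDetermined`). Nets of at most three scattered representatives per part achieve this for far
pairs that share a vertex (`IsNet.adj_iff`); this suffices for `r ≤ 1`. For larger `r` four-vertex
conflicts remain, and each forces a part to be covered by two small balls (`Conflict.covered_or`).
Cutting parts along covers with distant centres yields units, at most two per part (`units_or`), and
every conflict can be arranged so that a late unit and an earlier one lie close to its vertices
(`Conflict.exists_located`). The duality theorem for bounded VC-dimension (`exists_dominating_or`:
minimax plus double sampling) gives the late unit a reservoir of O(dk) vertices per early unit, from
which every such conflict can be destroyed by adding one token to `S`.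

Tokens are charged to the late unit. Only O(k) early units ever concern a given label, so its
reservoir has O(d k²) vertices. When `i` decreases, a unit passes its label to its heaviest subunit;
every other subunit carries at most half of the mass and starts with an empty reservoir, so masses
stay bounded. Tokens far from the vertex they are charged to number at most two per part
(`three_tokens`).

The second part follows because a flip-metric ball lies in the ball of every flip. For `d = 0` the
graph has no edges. If `d * mw = 1` the bound to prove is exactly 1: the graph is complete
multipartite or a disjoint union of complete bipartite graphs, and two flips confine the balls to
single types (`dmw_le_one`). -/

/-- `u` and `v` are at distance at most `n` in `H`. -/
def Near {V : Type*} (H : SimpleGraph V) (n : ℕ) (u v : V) : Prop :=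
  H.edist u v ≤ (n : ℕ∞)

section Near

variable {V : Type*} {H H' : SimpleGraph V} {m n l : ℕ} {u v w : V}

theorem Near.refl (H : SimpleGraph V) (n : ℕ) (u : V) : Near H n u u := by
  simp [Near]

theorem Near.symm (h : Near H n u v) : Near H n v u := by
  unfold Near at *; rwa [SimpleGraph.edist_comm]

theorem Near.mono_right (h : Near H m u v) (hmn : m ≤ n) : Near H n u v :=
  le_trans h (by exact_mod_cast hmn)

theorem Near.trans (h : Near H m u v) (h' : Near H n v w) : Near H (m + n) u w := by
  unfold Near at *
  push_cast
  exact SimpleGraph.edist_triangle.trans (add_le_add h h')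

theorem Near.trans_le (h : Near H m u v) (h' : Near H n v w) (hl : m + n ≤ l) : Near H l u w :=
  (h.trans h').mono_right hl

theorem Near.mono (hH : H ≤ H') (h : Near H n u v) : Near H' n u v :=
  le_trans (SimpleGraph.edist_anti hH) h

theorem not_near_one (h : ¬ Near H 1 u v) : ¬ H.Adj u v ∧ u ≠ v := by
  unfold Near at h
  push_cast at h
  rw [SimpleGraph.edist_le_one_iff_adj_or_eq] at h
  tauto

theorem near_zero (h : Near H 0 u v) : u = v := by
  unfold Near at h
  simpa using h

/-- The last step of a path realising a distance. -/
theorem Near.succ_cases (h : Near H (n + 1) u v) :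
    u = v ∨ ∃ w, Near H n u w ∧ H.Adj w v := by
  unfold Near at h
  obtain ⟨p, hp⟩ := SimpleGraph.exists_walk_of_edist_ne_top
    (ne_top_of_le_ne_top (by simp) h : H.edist u v ≠ ⊤)
  rw [← hp] at h
  have h1 : p.length ≤ n + 1 := by exact_mod_cast h
  clear hp h
  induction p using SimpleGraph.Walk.concatRec with
  | Hnil => exact Or.inl rfl
  | Hconcat q e _ =>
    right
    refine ⟨_, ?_, e⟩
    rw [SimpleGraph.Walk.length_concat] at h1
    exact le_trans (SimpleGraph.Walk.edist_le q) (by exact_mod_cast (by omega : q.length ≤ n))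

/-- If all edges of `H'` join vertices at `H`-distance at most `m`, then `H'`-balls of radius `n`
are contained in `H`-balls of radius `m * n`. -/
theorem Near.of_adj_near (hadj : ∀ u v, H'.Adj u v → Near H m u v) (h : Near H' n u v) :
    Near H (m * n) u v := by
  induction n generalizing v with
  | zero => rw [near_zero h]; exact Near.refl _ _ _
  | succ n ih =>
    obtain rfl | ⟨w, h1, h2⟩ := h.succ_cases
    · exact Near.refl _ _ _
    · exact (ih h1).trans_le (hadj _ _ h2) (by rw [mul_add, mul_one])

end Near

/-! ### Atomic types -/

section Types

variable {V : Type*} {G : SimpleGraph V} {S S' : Set V} {u v : V}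

theorem atomicTypes_iff : atomicTypes G S u v ↔
    u = v ∨ (u ∉ S ∧ v ∉ S ∧ ∀ s ∈ S, (G.Adj s u ↔ G.Adj s v)) := by
  change (u = v ∨ (u ∉ S ∧ v ∉ S ∧ G.neighborSet u ∩ S = G.neighborSet v ∩ S)) ↔ _
  refine or_congr Iff.rfl (and_congr Iff.rfl (and_congr Iff.rfl ?_))
  constructor
  · intro h s hs
    have := Set.ext_iff.1 h s
    simp only [Set.mem_inter_iff, SimpleGraph.mem_neighborSet, hs, and_true] at this
    rw [G.adj_comm s, G.adj_comm s]; exact this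
  · intro h
    ext s
    simp only [Set.mem_inter_iff, SimpleGraph.mem_neighborSet]
    constructor
    · rintro ⟨h1, h2⟩; exact ⟨((h s h2).1 h1.symm).symm, h2⟩
    · rintro ⟨h1, h2⟩; exact ⟨((h s h2).2 h1.symm).symm, h2⟩

theorem atomicTypes_adj (h : atomicTypes G S u v) {s : V} (hs : s ∈ S) :
    G.Adj s u ↔ G.Adj s v := by
  obtain rfl | ⟨_, _, h⟩ := atomicTypes_iff.1 h
  · rfl
  · exact h s hs

theorem atomicTypes_notMem (h : atomicTypes G S u v) (huv : u ≠ v) : u ∉ S ∧ v ∉ S := by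
  obtain rfl | ⟨h1, h2, _⟩ := atomicTypes_iff.1 h
  · exact absurd rfl huv
  · exact ⟨h1, h2⟩

theorem atomicTypes_anti (hS : S ⊆ S') (h : atomicTypes G S' u v) : atomicTypes G S u v := by
  obtain rfl | ⟨h1, h2, h3⟩ := atomicTypes_iff.1 h
  · exact (atomicTypes G S).refl' _
  · exact atomicTypes_iff.2 (Or.inr ⟨fun h => h1 (hS h), fun h => h2 (hS h),
      fun s hs => h3 s (hS hs)⟩)

theorem atomicTypes_symm (h : atomicTypes G S u v) : atomicTypes G S v u :=
  (atomicTypes G S).symm' h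

end Types

/-! ### Decomposition data -/

/-- A merge sequence of width at most `k` at radius `ρ`, indexed by the natural numbers. -/
structure Decomposition {V : Type*} (G : SimpleGraph V) (k ρ : ℕ) where
  L : ℕ
  P : ℕ → Setoid V
  R : ℕ → SimpleGraph V
  P_mono : Monotone P
  R_mono : Monotone R
  P_zero : ∀ u v, P 0 u v → u = v
  P_last : ∀ u v, P L u v
  homog : ∀ i x x' y y', P i x x' → P i y y' → ¬ Near (R i) 1 x y → ¬ Near (R i) 1 x' y' →
    (G.Adj x y ↔ G.Adj x' y')
  width : ∀ i < L, ∀ v, ∃ T : Finset V, T.card ≤ k ∧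
    ∀ x, Near (R (i + 1)) ρ v x → ∃ t ∈ T, P i t x

/-- If every `T`-class contains at most `c` elements of `A`, and `T` has `k` elements covering
`A`, then `A` has at most `k * c` elements. -/
theorem card_le_of_cover {V : Type*} {A T : Finset V} {Q : V → V → Prop} {k c : ℕ} (hT : T.card ≤ k)
    (hcov : ∀ x ∈ A, ∃ t ∈ T, Q t x)
    (hc : ∀ t ∈ T, ∀ A' ⊆ A, (∀ x ∈ A', Q t x) → A'.card ≤ c) : A.card ≤ k * c := by
  classical
  have h : A ⊆ T.biUnion fun t => A.filter fun x => Q t x := by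
    intro x hx
    obtain ⟨t, ht, h⟩ := hcov x hx
    exact Finset.mem_biUnion.2 ⟨t, ht, Finset.mem_filter.2 ⟨hx, h⟩⟩
  refine (Finset.card_le_card h).trans ((Finset.card_biUnion_le_card_mul _ _ c ?_).trans
    (Nat.mul_le_mul_right _ hT))
  intro t ht
  exact hc t ht _ (Finset.filter_subset _ _) fun x hx => (Finset.mem_filter.1 hx).2

section OfSequence

variable {V : Type*} [Fintype V] {G : SimpleGraph V}

theorem exists_mergeSequence_width (G : SimpleGraph V) (ρ : ℕ) :
    ∃ s : MergeSequence G, s.width ρ = mw ρ G := by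
  have : (Set.range fun s : MergeSequence G => s.width ρ).Nonempty := by
    refine ⟨_, ⟨1, fun t => if t = 0 then ⊥ else ⊤, fun t => if t = 0 then ⊥ else ⊤, ?_, by simp,
      by simp, ?_, ?_⟩, rfl⟩
    · intro a b hab
      dsimp only
      split_ifs with h1 h2 h2
      · exact le_rfl
      · exact bot_le
      · subst h2; exact absurd (Fin.le_zero_iff.1 hab) h1
      · exact le_rfl
    · intro a b hab
      dsimp only
      split_ifs with h1 h2 h2
      · exact le_rfl
      · exact bot_le
      · subst h2; exact absurd (Fin.le_zero_iff.1 hab) h1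
      · exact le_rfl
    · intro t X hX Y hY x hx y hy x' hx' y' hy' hxy hxy' hn hn'
      split_ifs at * with h1
      · obtain ⟨a, rfl⟩ := hX
        obtain ⟨b, rfl⟩ := hY
        have e1 : x = a := hx
        have e2 : x' = a := hx'
        have e3 : y = b := hy
        have e4 : y' = b := hy'
        subst e1 e3
        rw [e2, e4]
      · exact absurd hxy hn
  obtain ⟨s, hs⟩ := Nat.sInf_mem this
  exact ⟨s, hs⟩

theorem exists_cover_of_ncard {B : Set V} {Q : Setoid V} {k : ℕ}
    (h : (quotientSet B Q).ncard ≤ k) :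
    ∃ T : Finset V, T.card ≤ k ∧ ∀ x ∈ B, ∃ t ∈ T, Q t x := by
  classical
  have hfin : (quotientSet B Q).Finite := Set.toFinite _
  choose f hf using fun X : quotientSet B Q => X.2.2
  have : Fintype (quotientSet B Q) := hfin.fintype
  refine ⟨Finset.univ.image f, ?_, ?_⟩
  · refine Finset.card_image_le.trans ?_
    rw [Finset.card_univ, ← Nat.card_eq_fintype_card]
    exact h
  · intro x hx
    have hX : {y | Q y x} ∈ quotientSet B Q := ⟨Setoid.mem_classes Q x, x, Q.refl' x, hx⟩
    exact ⟨f ⟨_, hX⟩, Finset.mem_image_of_mem _ (Finset.mem_univ _), (hf ⟨_, hX⟩).1⟩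

theorem nonempty_decomposition (G : SimpleGraph V) {k ρ : ℕ} (hk : mw ρ G ≤ k) :
    Nonempty (Decomposition G k ρ) := by
  obtain ⟨s, hs⟩ := exists_mergeSequence_width G ρ
  -- Indices beyond the end are clamped to the last term, which keeps the sequence monotone on all
  -- of `ℕ`.
  let c : ℕ → Fin (s.len + 1) := fun i => ⟨min i s.len, by omega⟩
  have hc : Monotone c := fun i j h => by
    simp only [c, Fin.mk_le_mk]; omega
  refine ⟨⟨s.len, fun i => s.part (c i), fun i => s.resolved (c i), s.part_mono.comp hc,
    s.resolved_mono.comp hc, ?_, ?_, ?_, ?_⟩⟩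
  · intro u v h
    have : c 0 = 0 := by ext; simp [c]
    rw [this, s.part_first] at h
    exact h
  · intro u v
    have : c s.len = Fin.last _ := by ext; simp [c]
    rw [this, s.part_last]
    trivial
  · intro i x x' y y' hx hy hn hn'
    exact s.homogeneous (c i) _ (Setoid.mem_classes _ x) _ (Setoid.mem_classes _ y) x
      (Setoid.refl' _ x) y (Setoid.refl' _ y) x' (Setoid.symm' _ hx) y' (Setoid.symm' _ hy)
      (not_near_one hn).2 (not_near_one hn').2 (not_near_one hn).1 (not_near_one hn').1
  · intro i hi v
    have h1 : c i = (⟨i, hi⟩ : Fin s.len).castSucc := by ext; simp [c]; omega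
    have h2 : c (i + 1) = (⟨i, hi⟩ : Fin s.len).succ := by ext; simp [c]; omega
    rw [h1, h2]
    refine exists_cover_of_ncard (le_trans ?_ (hs.le.trans hk))
    refine le_trans (Finset.le_sup (f := fun v : V => (quotientSet
      (ball (s.resolved (⟨i, hi⟩ : Fin s.len).succ) ρ v)
      (s.part (⟨i, hi⟩ : Fin s.len).castSucc)).ncard) (Finset.mem_univ v)) ?_
    exact Finset.le_sup (f := fun t : Fin s.len => Finset.univ.sup fun v : V =>
      (quotientSet (ball (s.resolved t.succ) ρ v) (s.part t.castSucc)).ncard)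
      (Finset.mem_univ (⟨i, hi⟩ : Fin s.len))

end OfSequence

/-! ### Neighbourhood complexity and VC-dimension -/

section VC

variable {V : Type*} [Fintype V] {G : SimpleGraph V}

open Classical in
theorem mem_nbhd {v w : V} : w ∈ nbhd G v ↔ G.Adj v w := by
  simp [nbhd]

open Classical in
/-- The Sauer–Shelah lemma for neighbourhoods. -/
theorem card_traces_le (G : SimpleGraph V) (A : Finset V) :
    (Finset.univ.image fun v => nbhd G v ∩ A).card ≤
      ∑ j ∈ Finset.range (vcDim G + 1), A.card.choose j := by
  set T := Finset.univ.image fun v => nbhd G v ∩ A with hT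
  refine (Finset.card_le_card_shatterer T).trans ?_
  have hsub : T.shatterer ⊆ (Finset.range (vcDim G + 1)).biUnion fun j => A.powersetCard j := by
    intro s hs
    rw [Finset.mem_shatterer] at hs
    have hsA : s ⊆ A := by
      obtain ⟨u, hu, hsu⟩ := hs (Finset.Subset.refl s)
      obtain ⟨v, _, rfl⟩ := Finset.mem_image.1 hu
      intro x hx
      have : x ∈ s ∩ (nbhd G v ∩ A) := by rw [hsu]; exact hx
      exact (Finset.mem_inter.1 (Finset.mem_inter.1 this).2).2
    have hsh : (Finset.univ.image (nbhd G)).Shatters s := by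
      intro t ht
      obtain ⟨u, hu, hsu⟩ := hs ht
      obtain ⟨v, _, rfl⟩ := Finset.mem_image.1 hu
      refine ⟨nbhd G v, Finset.mem_image_of_mem _ (Finset.mem_univ v), ?_⟩
      rw [← hsu]
      ext x
      simp only [Finset.mem_inter]
      constructor
      · rintro ⟨h1, h2⟩; exact ⟨h1, h2, hsA h1⟩
      · rintro ⟨h1, h2, _⟩; exact ⟨h1, h2⟩
    refine Finset.mem_biUnion.2 ⟨s.card, ?_, Finset.mem_powersetCard.2 ⟨hsA, rfl⟩⟩
    rw [Finset.mem_range, Nat.lt_succ_iff]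
    exact hsh.card_le_vcDim
  refine (Finset.card_le_card hsub).trans (Finset.card_biUnion_le.trans ?_)
  exact Finset.sum_le_sum fun j _ => by rw [Finset.card_powersetCard]

open Classical in
theorem card_traces_le_nbhdComplexity (G : SimpleGraph V) {A : Finset V} {m : ℕ}
    (hA : A.card ≤ m) :
    (Finset.univ.image fun v => nbhd G v ∩ A).card ≤ nbhdComplexity G m := by
  unfold nbhdComplexity
  exact Finset.le_sup (f := fun A : Finset V => (Finset.univ.image fun v => nbhd G v ∩ A).card)
    (Finset.mem_filter.2 ⟨Finset.mem_univ A, hA⟩)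

theorem sum_choose_mono {a b d : ℕ} (h : a ≤ b) :
    ∑ j ∈ Finset.range (d + 1), a.choose j ≤ ∑ j ∈ Finset.range (d + 1), b.choose j :=
  Finset.sum_le_sum fun _ _ => Nat.choose_le_choose _ h

theorem sum_choose_le_pow (n d : ℕ) :
    ∑ j ∈ Finset.range (d + 1), n.choose j ≤ (n + 1) ^ d := by
  rw [add_pow]
  refine Finset.sum_le_sum fun j hj => ?_
  have hj : j ≤ d := Nat.lt_succ_iff.1 (Finset.mem_range.1 hj)
  calc n.choose j ≤ n ^ j := Nat.choose_le_pow n j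
    _ ≤ n ^ j * 1 ^ (d - j) * d.choose j := by
      rw [one_pow, mul_one]
      exact Nat.le_mul_of_pos_right _ (Nat.choose_pos hj)

theorem nbhdComplexity_le_pow (G : SimpleGraph V) (m : ℕ) :
    nbhdComplexity G m ≤ (m + 1) ^ vcDim G := by
  classical
  unfold nbhdComplexity
  refine Finset.sup_le fun A hA => ?_
  convert ((card_traces_le G A).trans (sum_choose_mono (Finset.mem_filter.1 hA).2)).trans
    (sum_choose_le_pow _ _)

theorem one_le_nbhdComplexity [Nonempty V] (G : SimpleGraph V) (m : ℕ) :
    1 ≤ nbhdComplexity G m := by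
  classical
  refine le_trans ?_ (card_traces_le_nbhdComplexity G (A := ∅) (m := m) (by simp))
  rw [Nat.one_le_iff_ne_zero, Finset.card_ne_zero, Finset.image_nonempty]
  exact Finset.univ_nonempty

/-- Since `x ≤ 1`, `x ^ d ≤ x ^ j` for `j ≤ d`, so the left side is dominated by a part of the
binomial expansion of `(1 + x) ^ n`. -/
theorem sum_choose_mul_pow_le (n d : ℕ) {x : ℝ} (hx : 0 ≤ x) (hx1 : x ≤ 1) :
    (∑ j ∈ Finset.range (d + 1), n.choose j : ℕ) * x ^ d ≤ (1 + x) ^ n := by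
  have h1 : ∀ j ∈ Finset.range (d + 1), (n.choose j : ℝ) * x ^ d ≤ (n.choose j : ℝ) * x ^ j :=
    fun j hj => mul_le_mul_of_nonneg_left
      (pow_le_pow_of_le_one hx hx1 (Nat.lt_succ_iff.1 (Finset.mem_range.1 hj))) (Nat.cast_nonneg _)
  rw [Nat.cast_sum, Finset.sum_mul]
  refine (Finset.sum_le_sum h1).trans ?_
  have h2 : (1 + x) ^ n = ∑ j ∈ Finset.range (n + 1), (n.choose j : ℝ) * x ^ j := by
    rw [add_comm, add_pow]
    exact Finset.sum_congr rfl fun j _ => by rw [one_pow, mul_one, mul_comm]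
  rw [h2]
  rcases le_total (d + 1) (n + 1) with h | h
  · exact Finset.sum_le_sum_of_subset_of_nonneg (Finset.range_subset_range.2 h)
      fun j _ _ => by positivity
  · refine (Finset.sum_subset (Finset.range_subset_range.2 h) fun j _ hj => ?_).ge
    rw [Finset.mem_range, not_lt] at hj
    rw [Nat.choose_eq_zero_of_lt (by omega)]; simp

theorem four_mul_sum_choose_lt {d : ℕ} (hd : 1 ≤ d) :
    4 * ∑ j ∈ Finset.range (d + 1), (80 * d).choose j < 2 ^ (10 * d) := by
  -- With `x = 1/50`, the sum is at most `(50 * 1.02 ^ 80) ^ d ≤ 244.5 ^ d`, and `4 * 244.5 = 978 <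
  -- 1024 = 2 ^ 10`.
  have h := sum_choose_mul_pow_le (80 * d) d (x := 1 / 50) (by norm_num) (by norm_num)
  rw [pow_mul (1 + 1 / 50 : ℝ)] at h
  have h0 : (1 + 1 / 50 : ℝ) ^ 80 ≤ 4.89 := by norm_num
  have h1 : ((1 + 1 / 50 : ℝ) ^ 80) ^ d ≤ 4.89 ^ d := pow_le_pow_left₀ (by positivity) h0 d
  have h2 : ((∑ j ∈ Finset.range (d + 1), (80 * d).choose j : ℕ) : ℝ) ≤ 244.5 ^ d := by
    have h3 : ((∑ j ∈ Finset.range (d + 1), (80 * d).choose j : ℕ) : ℝ) * (1 / 50) ^ d * 50 ^ d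
        ≤ 4.89 ^ d * 50 ^ d := mul_le_mul_of_nonneg_right (h.trans h1) (by positivity)
    rw [mul_assoc, ← mul_pow, ← mul_pow] at h3
    norm_num at h3 ⊢
    exact h3
  have h4 : (4 : ℝ) * 244.5 ^ d < 1024 ^ d := by
    obtain ⟨e, rfl⟩ := Nat.exists_eq_add_of_le' hd
    rw [pow_succ, pow_succ]
    have h5 : (244.5 : ℝ) ^ e ≤ 1024 ^ e := pow_le_pow_left₀ (by norm_num) (by norm_num) e
    have h6 : (0 : ℝ) < 1024 ^ e := by positivity
    nlinarith
  have h7 : (2 : ℝ) ^ (10 * d) = 1024 ^ d := by rw [pow_mul]; norm_num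
  have : ((4 * ∑ j ∈ Finset.range (d + 1), (80 * d).choose j : ℕ) : ℝ) < (2 ^ (10 * d) : ℕ) := by
    push_cast at h2 ⊢
    rw [h7]
    linarith
  exact_mod_cast this

end VC

/-! ### A minimax theorem -/

section Minimax

variable {ι κ : Type*} [Fintype ι] [Fintype κ]

/-- A version of the minimax theorem for matrix games. -/
theorem exists_weights_or [Nonempty ι] (A : ι → κ → ℝ) (c : ℝ) :
    (∃ ν : ι → ℝ, (∀ x, 0 ≤ ν x) ∧ ∑ x, ν x = 1 ∧ ∀ y, c ≤ ∑ x, ν x * A x y) ∨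
    (∃ μ : κ → ℝ, (∀ y, 0 ≤ μ y) ∧ ∑ y, μ y = 1 ∧ ∀ x, ∑ y, μ y * A x y ≤ c) := by
  classical
  by_contra! hcon
  obtain ⟨hν, hμ⟩ := hcon
  let F : (ι → ℝ) →ₗ[ℝ] (κ → ℝ) := Matrix.mulVecLin (Matrix.of fun y x => A x y)
  have hF : ∀ ν y, F ν y = ∑ x, ν x * A x y := fun ν y => by
    simp only [F, Matrix.mulVecLin_apply, Matrix.mulVec, dotProduct, Matrix.of_apply]
    exact Finset.sum_congr rfl fun x _ => mul_comm _ _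
  let s : Set (κ → ℝ) := F '' stdSimplex ℝ ι
  let t : Set (κ → ℝ) := {z | ∀ y, c ≤ z y}
  have hs1 : Convex ℝ s := (convex_stdSimplex ℝ ι).linear_image F
  have hs2 : IsCompact s := (isCompact_stdSimplex ℝ ι).image F.continuous_of_finiteDimensional
  have ht1 : Convex ℝ t := by
    intro z hz z' hz' a b ha hb hab y
    have h1 := mul_le_mul_of_nonneg_left (hz y) ha
    have h2 := mul_le_mul_of_nonneg_left (hz' y) hb
    have h3 : c = a * c + b * c := by rw [← add_mul, hab, one_mul]
    simp only [Pi.add_apply, Pi.smul_apply, smul_eq_mul]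
    linarith
  have ht2 : IsClosed t := by
    have : t = ⋂ y, {z | c ≤ z y} := by ext; simp [t]
    rw [this]
    exact isClosed_iInter fun y => isClosed_le continuous_const (continuous_apply y)
  have hd : Disjoint s t := by
    rw [Set.disjoint_left]
    rintro _ ⟨ν, ⟨h1, h2⟩, rfl⟩ h3
    obtain ⟨y, hy⟩ := hν ν h1 h2
    exact absurd (h3 y) (by rw [hF]; exact not_le.2 hy)
  -- The payoff vectors of mixed strategies form a compact convex set, disjoint from the closed
  -- orthant above `c`. The normalised coefficients of a separating functional are the other
  -- player's strategy.
  obtain ⟨f, u, v, hfs, huv, hft⟩ := geometric_hahn_banach_compact_closed hs1 hs2 ht1 ht2 hd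
  have hf : ∀ z, f z = ∑ y, z y * f (Pi.single y 1) := fun z => by
    conv_lhs => rw [← Finset.univ_sum_single z]
    rw [map_sum]
    refine Finset.sum_congr rfl fun y _ => ?_
    have : (Pi.single y (z y) : κ → ℝ) = z y • Pi.single y 1 := by
      rw [← Pi.single_smul]; simp
    rw [this, map_smul, smul_eq_mul]
  set w : κ → ℝ := fun y => f (Pi.single y 1) with hw
  have hw0 : ∀ y, 0 ≤ w y := by
    intro y
    by_contra! h
    -- A negative coefficient would let a large step in direction `y`, which stays in the orthant,
    -- push `f` below `v`.
    have hz : (fun _ => c) + ((|v - f fun _ => c| + 1) / (-w y)) • (Pi.single y 1 : κ → ℝ) ∈ t := by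
      intro y'
      have : 0 ≤ (|v - f fun _ => c| + 1) / (-w y) := div_nonneg (by positivity) (by linarith)
      simp only [Pi.add_apply, Pi.smul_apply, smul_eq_mul]
      by_cases hy : y' = y
      · subst hy; simp; exact this
      · simp [Pi.single_eq_of_ne hy]
    have h1 := hft _ hz
    rw [map_add, map_smul, smul_eq_mul] at h1
    have h2 : (|v - f fun _ => c| + 1) / (-w y) * w y = -(|v - f fun _ => c| + 1) := by
      rw [div_mul_eq_mul_div, div_eq_iff (by linarith)]; ring
    change v < f (fun _ => c) + (|v - f fun _ => c| + 1) / (-w y) * w y at h1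
    rw [h2] at h1
    linarith [neg_abs_le (v - f fun _ => c)]
  have hx : ∀ x, ∑ y, w y * A x y < c * ∑ y, w y := by
    intro x
    have h1 := hfs (F (Pi.single x 1)) ⟨_, ⟨fun y => by
      by_cases hy : y = x
      · subst hy; simp
      · simp [Pi.single_eq_of_ne hy], by simp⟩, rfl⟩
    have h2 := hft (fun _ => c) fun y => le_rfl
    rw [hf] at h1 h2
    rw [← Finset.mul_sum] at h2
    have h3 : ∑ y, F (Pi.single x 1) y * w y = ∑ y, w y * A x y := by
      refine Finset.sum_congr rfl fun y _ => ?_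
      rw [hF, mul_comm]
      congr 1
      rw [Finset.sum_eq_single x]
      · simp
      · intro b _ hb; simp [Pi.single_eq_of_ne hb]
      · simp
    rw [h3] at h1
    linarith
  have hW : 0 < ∑ y, w y := by
    refine lt_of_le_of_ne (Finset.sum_nonneg fun y _ => hw0 y) fun h => ?_
    have h0 : ∀ y, w y = 0 := fun y =>
      (Finset.sum_eq_zero_iff_of_nonneg fun y _ => hw0 y).1 h.symm y (Finset.mem_univ y)
    have := hx (Classical.arbitrary ι)
    simp [h0] at this
  obtain ⟨x, h⟩ := hμ (fun y => w y / ∑ y, w y) (fun y => div_nonneg (hw0 y) hW.le)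
    (by rw [← Finset.sum_div, div_self hW.ne'])
  have h1 := hx x
  have h2 : ∑ y, w y / (∑ y, w y) * A x y = (∑ y, w y * A x y) / ∑ y, w y := by
    rw [Finset.sum_div]
    exact Finset.sum_congr rfl fun y _ => by ring
  rw [h2, lt_div_iff₀ hW] at h
  linarith

end Minimax

/-! ### Hitting sets of bounded size -/

section Separating

variable {ι κ : Type*} {m : ℕ}

/-- Exchange the two entries of each pair selected by `σ`. -/
def swapAt (σ : Fin m → Bool) (p : Fin m → ι × ι) (i : Fin m) : ι × ι :=
  if σ i then (p i).swap else p i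

theorem swapAt_swapAt (σ : Fin m → Bool) (p : Fin m → ι × ι) : swapAt σ (swapAt σ p) = p := by
  funext i
  unfold swapAt
  split_ifs <;> simp

/-- `y` is missed by all first entries and hit by many second entries. -/
def Separating (A : ι → κ → Prop) (q : ℕ) (p : Fin m → ι × ι) (y : κ) : Prop :=
  (∀ i, ¬ A (p i).1 y) ∧ q ≤ {i | A (p i).2 y}.ncard

/-- Fix one good `σ₀`. At each of the at least `q` indices whose second entry is hit, the opposite
choice would make the first entry hit; so every good `σ` agrees with `σ₀` there. -/
theorem card_separating_le (A : ι → κ → Prop) (q : ℕ) (p : Fin m → ι × ι) (y : κ) :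
    {σ : Fin m → Bool | Separating A q (swapAt σ p) y}.ncard ≤ 2 ^ (m - q) := by
  classical
  by_cases hne : ∃ σ₀ : Fin m → Bool, Separating A q (swapAt σ₀ p) y
  swap
  · push Not at hne
    simp [hne]
  obtain ⟨σ₀, h0⟩ := hne
  set J : Finset (Fin m) := Finset.univ.filter fun i => A (swapAt σ₀ p i).2 y with hJ
  have hJq : q ≤ J.card := by
    have := h0.2
    rwa [show {i | A (swapAt σ₀ p i).2 y} = (J : Set (Fin m)) by ext; simp [hJ],
      Set.ncard_coe_finset] at this
  have hsub : {σ : Fin m → Bool | Separating A q (swapAt σ p) y} ⊆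
      (Fintype.piFinset fun i => if i ∈ J then {σ₀ i} else (Finset.univ : Finset Bool) :
        Finset (Fin m → Bool)) := by
    intro σ hσ
    rw [Finset.mem_coe, Fintype.mem_piFinset]
    intro i
    split_ifs with hi
    · rw [Finset.mem_singleton]
      by_contra hne
      have h1 := hσ.1 i
      have h2 : A (swapAt σ₀ p i).2 y := (Finset.mem_filter.1 hi).2
      unfold swapAt at h1 h2
      cases hs : σ i <;> cases hs' : σ₀ i <;> simp_all
    · exact Finset.mem_univ _
  refine (Set.ncard_le_ncard hsub (Finset.finite_toSet _)).trans ?_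
  rw [Set.ncard_coe_finset, Fintype.card_piFinset]
  calc ∏ i, (if i ∈ J then {σ₀ i} else (Finset.univ : Finset Bool)).card
      = ∏ i, if i ∈ J then 1 else 2 := by
        refine Finset.prod_congr rfl fun i _ => ?_
        split_ifs <;> simp
    _ = 2 ^ (Finset.univ.filter fun i => i ∉ J).card := by
        rw [Finset.prod_ite]; simp
    _ ≤ 2 ^ (m - q) := by
        refine Nat.pow_le_pow_right (by norm_num) ?_
        have h1 : (Finset.univ.filter fun i => i ∉ J) = Jᶜ := by ext; simp
        rw [h1, Finset.card_compl, Fintype.card_fin]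
        omega

/-- A union bound: being separated depends on `y` only through its trace on the entries of `p`,
which swapping does not change as a set. -/
theorem card_exists_separating_le (A : ι → κ → Prop) (q N : ℕ) (p : Fin m → ι × ι)
    (htr : ∃ Y : Finset κ, Y.card ≤ N ∧ ∀ y, ∃ y' ∈ Y, ∀ i,
      (A (p i).1 y ↔ A (p i).1 y') ∧ (A (p i).2 y ↔ A (p i).2 y')) :
    {σ : Fin m → Bool | ∃ y, Separating A q (swapAt σ p) y}.ncard ≤ N * 2 ^ (m - q) := by
  classical
  obtain ⟨Y, hY, htr⟩ := htr
  have hsub : {σ : Fin m → Bool | ∃ y, Separating A q (swapAt σ p) y} ⊆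
      ⋃ y ∈ Y, {σ : Fin m → Bool | Separating A q (swapAt σ p) y} := by
    rintro σ ⟨y, hy⟩
    obtain ⟨y', hy', h⟩ := htr y
    refine Set.mem_biUnion hy' ?_
    have h1 : ∀ i, (A (swapAt σ p i).1 y ↔ A (swapAt σ p i).1 y') ∧
        (A (swapAt σ p i).2 y ↔ A (swapAt σ p i).2 y') := fun i => by
      unfold swapAt
      split_ifs
      · exact (h i).symm
      · exact h i
    refine ⟨fun i hi => hy.1 i ((h1 i).1.2 hi), ?_⟩
    have : {i | A (swapAt σ p i).2 y'} = {i | A (swapAt σ p i).2 y} := by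
      ext i; exact (h1 i).2.symm
    rw [this]; exact hy.2
  refine (Set.ncard_le_ncard hsub (Set.toFinite _)).trans ?_
  refine (Finset.set_ncard_biUnion_le Y _).trans ?_
  exact (Finset.sum_le_card_nsmul _ _ _ fun y _ => card_separating_le A q p y).trans
    (Nat.mul_le_mul_right _ hY)

end Separating

/-! ### Double sampling -/

section Hitting

variable {ι κ : Type*} [Fintype ι] {m : ℕ}

theorem sum_prod_fin (F : Fin m → ι → ℝ) :
    ∑ f : Fin m → ι, ∏ i, F i (f i) = ∏ i, ∑ x, F i x := by
  classical
  rw [Finset.prod_univ_sum, Fintype.piFinset_univ]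

theorem sum_prod_weights {ν : ι → ℝ} (hν : ∑ x, ν x = 1) :
    ∑ f : Fin m → ι, ∏ i, ν (f i) = 1 := by
  rw [sum_prod_fin fun _ => ν]; simp [hν]

theorem sum_prod_weights_mul {ν : ι → ℝ} (hν : ∑ x, ν x = 1) (φ : ι → ℝ) (i : Fin m) :
    ∑ f : Fin m → ι, (∏ j, ν (f j)) * φ (f i) = ∑ x, ν x * φ x := by
  classical
  have h : ∀ f : Fin m → ι, (∏ j, ν (f j)) * φ (f i) =
      ∏ j, (ν (f j) * if j = i then φ (f j) else 1) := fun f => by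
    rw [Finset.prod_mul_distrib, Finset.prod_ite_eq' Finset.univ i fun j => φ (f j)]; simp
  simp_rw [h]
  rw [sum_prod_fin fun j x => ν x * if j = i then φ x else 1,
    Finset.prod_eq_single i]
  · simp
  · intro j _ hj; simp [hj, hν]
  · simp

-- The expected number of hits is at least `m / 2` and at most `m` times the probability of `q` hits
-- plus `q`; hence that probability is at least `1/2 - q/m ≥ 1/4`.
open Classical in
theorem quarter_le_sum_hits {ν : ι → ℝ} (hν0 : ∀ x, 0 ≤ ν x) (hν : ∑ x, ν x = 1) {q : ℕ}
    (hm : 0 < m) (hq : 4 * q ≤ m) (H : ι → Prop)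
    (hH : 1 / 2 ≤ ∑ x, ν x * if H x then 1 else 0) :
    1 / 4 ≤ ∑ f : Fin m → ι, (∏ i, ν (f i)) *
      if q ≤ (Finset.univ.filter fun i => H (f i)).card then (1 : ℝ) else 0 := by
  have h1 : (m : ℝ) * (1 / 2) ≤ ∑ f : Fin m → ι, (∏ i, ν (f i)) *
      ((Finset.univ.filter fun i => H (f i)).card : ℝ) := by
    have : ∀ f : Fin m → ι, (∏ i, ν (f i)) * ((Finset.univ.filter fun i => H (f i)).card : ℝ) =
        ∑ i, (∏ j, ν (f j)) * if H (f i) then 1 else 0 := fun f => by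
      rw [← Finset.mul_sum, Finset.sum_boole]
    simp_rw [this]
    rw [Finset.sum_comm]
    simp_rw [sum_prod_weights_mul hν fun x => if H x then 1 else 0]
    rw [Finset.sum_const, Finset.card_univ, Fintype.card_fin, nsmul_eq_mul]
    exact mul_le_mul_of_nonneg_left hH (Nat.cast_nonneg m)
  have h2 : ∑ f : Fin m → ι, (∏ i, ν (f i)) *
      ((Finset.univ.filter fun i => H (f i)).card : ℝ) ≤
      ∑ f : Fin m → ι, (m * ((∏ i, ν (f i)) *
      if q ≤ (Finset.univ.filter fun i => H (f i)).card then (1 : ℝ) else 0) +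
      q * ∏ i, ν (f i)) := by
    refine Finset.sum_le_sum fun f _ => ?_
    have hw : 0 ≤ ∏ i, ν (f i) := Finset.prod_nonneg fun i _ => hν0 _
    have hc : (Finset.univ.filter fun i => H (f i)).card ≤ m := by
      simpa using Finset.card_le_univ (Finset.univ.filter fun i => H (f i))
    have hc' : ((Finset.univ.filter fun i => H (f i)).card : ℝ) ≤ m := by exact_mod_cast hc
    split_ifs with h
    · have : (0 : ℝ) ≤ q := Nat.cast_nonneg q
      nlinarith
    · have : ((Finset.univ.filter fun i => H (f i)).card : ℝ) ≤ q := by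
        exact_mod_cast (not_le.1 h).le
      nlinarith
  rw [Finset.sum_add_distrib, ← Finset.mul_sum, ← Finset.mul_sum, sum_prod_weights hν] at h2
  have h3 : (q : ℝ) * 4 ≤ m := by exact_mod_cast (by omega : q * 4 ≤ m)
  have h4 : (0 : ℝ) < m := by exact_mod_cast hm
  have h5 := h1.trans h2
  by_contra! h
  nlinarith

/-- If every set of a family has weight at least one half and the family has few traces, then
some sequence of `m` points meets all sets of the family. -/
theorem exists_hitting {A : ι → κ → Prop} {ν : ι → ℝ} (hν0 : ∀ x, 0 ≤ ν x) (hν : ∑ x, ν x = 1)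
    {q N : ℕ} (hm : 0 < m) (hq : 4 * q ≤ m) (hN : 4 * N < 2 ^ q)
    (hA : ∀ y, 1 / 2 ≤ ∑ x, ν x * (open Classical in if A x y then 1 else 0))
    (htr : ∀ p : Fin m → ι × ι, ∃ Y : Finset κ, Y.card ≤ N ∧ ∀ y, ∃ y' ∈ Y, ∀ i,
      (A (p i).1 y ↔ A (p i).1 y') ∧ (A (p i).2 y ↔ A (p i).2 y')) :
    ∃ g : Fin m → ι, ∀ y, ∃ i, A (g i) y := by
  classical
  by_contra! hcon
  choose Y hY using hcon
  let W : (Fin m → ι × ι) → ℝ := fun p => ∏ i, (ν (p i).1 * ν (p i).2)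
  have hW0 : ∀ p, 0 ≤ W p := fun p => Finset.prod_nonneg fun i _ => mul_nonneg (hν0 _) (hν0 _)
  let b : (Fin m → ι × ι) → ℝ := fun p => if ∃ y, Separating A q p y then 1 else 0
  have hpair : ∀ F : (Fin m → ι × ι) → ℝ, ∑ p, F p =
      ∑ g : Fin m → ι, ∑ h : Fin m → ι, F fun i => (g i, h i) := fun F => by
    rw [← Fintype.sum_prod_type' (f := fun g h : Fin m → ι => F fun i => (g i, h i))]
    exact Fintype.sum_equiv (Equiv.arrowProdEquivProdArrow (Fin m) (fun _ => ι) (fun _ => ι)) _ _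
      fun p => rfl
  have hWsum : ∑ p, W p = 1 := by
    rw [hpair]
    simp only [W, Finset.prod_mul_distrib]
    simp_rw [← Finset.mul_sum, sum_prod_weights hν, mul_one]
    exact sum_prod_weights hν
  -- If every sample `g` misses some `Y g`, an independent second sample hits that same set at least
  -- `q` times with probability at least `1/4`.
  have hlow : 1 / 4 ≤ ∑ p, W p * b p := by
    rw [hpair]
    have h1 : ∀ g : Fin m → ι, (∏ i, ν (g i)) * (1 / 4) ≤
        ∑ h : Fin m → ι, W (fun i => (g i, h i)) * b fun i => (g i, h i) := by
      intro g
      refine (mul_le_mul_of_nonneg_left (quarter_le_sum_hits hν0 hν hm hq (fun x => A x (Y g))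
        (hA (Y g))) (Finset.prod_nonneg fun i _ => hν0 _)).trans ?_
      rw [Finset.mul_sum]
      refine Finset.sum_le_sum fun h _ => ?_
      simp only [W, Finset.prod_mul_distrib]
      rw [← mul_assoc]
      refine mul_le_mul_of_nonneg_left ?_ (mul_nonneg (Finset.prod_nonneg fun i _ => hν0 _)
        (Finset.prod_nonneg fun i _ => hν0 _))
      split_ifs with hc
      · have : ∃ y, Separating A q (fun i => (g i, h i)) y := by
          refine ⟨Y g, hY g, ?_⟩
          rw [show {i | A (h i) (Y g)} =
            ((Finset.univ.filter fun i => A (h i) (Y g) : Finset (Fin m)) : Set (Fin m)) by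
            ext; simp, Set.ncard_coe_finset]
          exact hc
        simp only [b, if_pos this]; exact le_rfl
      · simp only [b]; split_ifs <;> norm_num
    refine le_trans ?_ (Finset.sum_le_sum fun g _ => h1 g)
    rw [← Finset.sum_mul, sum_prod_weights hν, one_mul]
  -- The product weight is invariant under coordinate swaps, so the probability may be averaged over
  -- all `σ`; this bounds it by `N * 2 ^ (-q) < 1/4`.
  have hsym : ∀ σ : Fin m → Bool, ∑ p, W p * b p = ∑ p, W p * b (swapAt σ p) := by
    intro σ
    have hinv : Function.Involutive (swapAt (ι := ι) σ) := swapAt_swapAt σ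
    refine Fintype.sum_equiv (hinv.toPerm (swapAt σ)) _ _ fun p => ?_
    have h1 : W (hinv.toPerm (swapAt σ) p) = W p := by
      refine Finset.prod_congr rfl fun i _ => ?_
      simp only [Function.Involutive.coe_toPerm, swapAt]
      split_ifs
      · simp [mul_comm]
      · rfl
    rw [h1, Function.Involutive.coe_toPerm, swapAt_swapAt]
  have hup : (2 : ℝ) ^ m * ∑ p, W p * b p ≤ N * 2 ^ (m - q) := by
    have h1 : (2 : ℝ) ^ m * ∑ p, W p * b p = ∑ σ : Fin m → Bool, ∑ p, W p * b (swapAt σ p) := by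
      rw [← Finset.sum_congr rfl fun σ _ => hsym σ, Finset.sum_const, nsmul_eq_mul]
      simp
    rw [h1, Finset.sum_comm]
    have h2 : ∀ p, ∑ σ : Fin m → Bool, W p * b (swapAt σ p) ≤ W p * (N * 2 ^ (m - q)) := by
      intro p
      rw [← Finset.mul_sum]
      refine mul_le_mul_of_nonneg_left ?_ (hW0 p)
      have h3 := card_exists_separating_le A q N p (htr p)
      rw [show {σ : Fin m → Bool | ∃ y, Separating A q (swapAt σ p) y} =
        ((Finset.univ.filter fun σ => ∃ y, Separating A q (swapAt σ p) y :
          Finset (Fin m → Bool)) : Set (Fin m → Bool)) by ext; simp, Set.ncard_coe_finset] at h3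
      simp only [b]
      rw [Finset.sum_boole]
      exact_mod_cast h3
    refine (Finset.sum_le_sum fun p _ => h2 p).trans ?_
    rw [← Finset.sum_mul, hWsum, one_mul]
  have hqm : (2 : ℝ) ^ m = 2 ^ q * 2 ^ (m - q) := by rw [← pow_add]; congr 1; omega
  have h4 : (2 : ℝ) ^ m * (1 / 4) ≤ N * 2 ^ (m - q) :=
    (mul_le_mul_of_nonneg_left hlow (by positivity)).trans hup
  have h5 : (4 : ℝ) * N < 2 ^ q := by exact_mod_cast hN
  have h6 : (0 : ℝ) < 2 ^ (m - q) := by positivity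
  rw [hqm] at h4
  nlinarith

end Hitting

/-! ### Duality for bounded VC-dimension -/

section Duality

variable {V : Type*} [Fintype V]

/-- The number of traces of neighbourhoods on a sequence of pairs of vertices. -/
theorem exists_trace_representatives (G : SimpleGraph V) (a : Prop) (X Y : Finset V) {m : ℕ}
    (p : Fin m → X × X) :
    ∃ Z : Finset Y, Z.card ≤ ∑ j ∈ Finset.range (vcDim G + 1), (2 * m).choose j ∧
      ∀ y : Y, ∃ y' ∈ Z, ∀ i, ((G.Adj (p i).1 y ↔ a) ↔ (G.Adj (p i).1 y' ↔ a)) ∧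
        ((G.Adj (p i).2 y ↔ a) ↔ (G.Adj (p i).2 y' ↔ a)) := by
  classical
  set B : Finset V := Finset.univ.image (fun i => ((p i).1 : V)) ∪
    Finset.univ.image (fun i => ((p i).2 : V)) with hB
  have hBc : B.card ≤ 2 * m := by
    refine (Finset.card_union_le _ _).trans ?_
    have h1 := Finset.card_image_le (s := Finset.univ) (f := fun i => ((p i).1 : V))
    have h2 := Finset.card_image_le (s := Finset.univ) (f := fun i => ((p i).2 : V))
    rw [Finset.card_univ, Fintype.card_fin] at h1 h2
    omega
  let f : Y → Finset V := fun y => nbhd G y ∩ B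
  have hf : ∀ t ∈ Finset.univ.image f, ∃ y, f y = t := fun t ht => by
    obtain ⟨y, _, h⟩ := Finset.mem_image.1 ht
    exact ⟨y, h⟩
  choose g hg using hf
  refine ⟨(Finset.univ.image f).attach.image fun t => g t.1 t.2, ?_, ?_⟩
  · refine Finset.card_image_le.trans ?_
    rw [Finset.card_attach]
    refine le_trans (Finset.card_le_card ?_) ((card_traces_le G B).trans (sum_choose_mono hBc))
    intro t ht
    obtain ⟨y, _, rfl⟩ := Finset.mem_image.1 ht
    exact Finset.mem_image.2 ⟨y, Finset.mem_univ _, by convert rfl⟩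
  · intro y
    have hy : f y ∈ Finset.univ.image f := Finset.mem_image_of_mem _ (Finset.mem_univ y)
    refine ⟨g _ hy, Finset.mem_image.2 ⟨⟨_, hy⟩, Finset.mem_attach _ _, rfl⟩, ?_⟩
    have h := hg _ hy
    have key : ∀ x ∈ B, (G.Adj x y ↔ G.Adj x (g _ hy)) := fun x hx => by
      have := Finset.ext_iff.1 h x
      simp only [f, Finset.mem_inter, mem_nbhd, hx, and_true] at this
      rw [G.adj_comm x, G.adj_comm x]
      exact this.symm
    intro i
    have h1 : ((p i).1 : V) ∈ B := Finset.mem_union_left _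
      (Finset.mem_image.2 ⟨i, Finset.mem_univ _, rfl⟩)
    have h2 : ((p i).2 : V) ∈ B := Finset.mem_union_right _
      (Finset.mem_image.2 ⟨i, Finset.mem_univ _, rfl⟩)
    rw [key _ h1, key _ h2]
    exact ⟨Iff.rfl, Iff.rfl⟩

/-- Samples of size `40d` with hit threshold `10d`: the two samples together have at most `80d`
points, and the Sauer–Shelah count of traces on them is below `2 ^ (10d) / 4`. -/
theorem exists_dominating_of_weights (G : SimpleGraph V) (hd : 1 ≤ vcDim G) (a : Prop)
    (X Y : Finset V) {ν : X → ℝ} (hν0 : ∀ x, 0 ≤ ν x) (hν : ∑ x, ν x = 1)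
    (h : ∀ y : Y, 1 / 2 ≤ ∑ x : X, ν x * (open Classical in if (G.Adj x y ↔ a) then 1 else 0)) :
    ∃ T ⊆ X, T.card ≤ 40 * vcDim G ∧ ∀ y ∈ Y, ∃ s ∈ T, (G.Adj s y ↔ a) := by
  classical
  obtain ⟨g, hg⟩ := exists_hitting (m := 40 * vcDim G) (q := 10 * vcDim G)
    (A := fun (x : X) (y : Y) => (G.Adj x y ↔ a)) hν0 hν (by omega) (by omega)
    (four_mul_sum_choose_lt hd) (fun y => by convert h y) (fun p => by
      have := exists_trace_representatives G a X Y p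
      rwa [show 2 * (40 * vcDim G) = 80 * vcDim G by ring] at this)
  refine ⟨Finset.univ.image fun i => (g i : V), ?_, ?_, ?_⟩
  · intro x hx
    obtain ⟨i, _, rfl⟩ := Finset.mem_image.1 hx
    exact (g i).2
  · refine Finset.card_image_le.trans ?_
    simp
  · intro y hy
    obtain ⟨i, hi⟩ := hg ⟨y, hy⟩
    exact ⟨g i, Finset.mem_image.2 ⟨i, Finset.mem_univ _, rfl⟩, hi⟩

/-- The duality theorem for graphs of bounded VC-dimension. -/
theorem exists_dominating_or (G : SimpleGraph V) (hd : 1 ≤ vcDim G) (a : Prop) (X Y : Finset V) :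
    (∃ T ⊆ X, T.card ≤ 40 * vcDim G ∧ ∀ y ∈ Y, ∃ s ∈ T, (G.Adj s y ↔ a)) ∨
    (∃ T ⊆ Y, T.card ≤ 40 * vcDim G ∧ ∀ x ∈ X, ∃ s ∈ T, (G.Adj s x ↔ ¬ a)) := by
  classical
  rcases X.eq_empty_or_nonempty with rfl | hX
  · exact Or.inr ⟨∅, by simp, by simp, by simp⟩
  have : Nonempty X := hX.to_subtype
  rcases exists_weights_or (ι := X) (κ := Y)
    (fun x y => if (G.Adj x y ↔ a) then 1 else 0) (1 / 2) with ⟨ν, h0, h1, h⟩ | ⟨μ, h0, h1, h⟩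
  · exact Or.inl (exists_dominating_of_weights G hd a X Y h0 h1 fun y => by convert h y)
  -- The second strategy gives weight at most `1/2` to the pairs of adjacency `a`, hence at least
  -- `1/2` to those of adjacency `¬ a`.
  · refine Or.inr (exists_dominating_of_weights G hd (¬ a) Y X h0 h1 fun x => ?_)
    have h2 := h x
    have h3 : ∀ y : Y, (if (G.Adj y x ↔ ¬ a) then (1 : ℝ) else 0) =
        1 - if (G.Adj x y ↔ a) then 1 else 0 := fun y => by
      rw [G.adj_comm y x]
      by_cases ha : a <;> by_cases hxy : G.Adj x y <;> simp [ha, hxy]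
    have h4 : ∑ y : Y, μ y * (if (G.Adj y x ↔ ¬ a) then (1 : ℝ) else 0) =
        1 - ∑ y : Y, μ y * if (G.Adj x y ↔ a) then 1 else 0 := by
      simp_rw [h3, mul_sub, mul_one]
      rw [Finset.sum_sub_distrib, h1]
    have h5 : (1 : ℝ) / 2 ≤ ∑ y : Y, μ y * (if (G.Adj y x ↔ ¬ a) then (1 : ℝ) else 0) := by
      rw [h4]; linarith
    convert h5

end Duality

/-! ### Flips whose edges are short -/

/-- Among the pairs that have an endpoint in `D` and are at distance more than `17` in `H`, the
adjacency in `G` depends only on the atomic types over `S`. -/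
def FarDetermined {V : Type*} (G : SimpleGraph V) (S : Set V) (H : SimpleGraph V) (D : Set V) :
    Prop :=
  ∀ u₁ u₂ w₁ w₂, atomicTypes G S u₁ u₂ → atomicTypes G S w₁ w₂ →
    ¬ Near H 17 u₁ w₁ → ¬ Near H 17 u₂ w₂ → (u₁ ∈ D ∨ w₁ ∈ D) → (u₂ ∈ D ∨ w₂ ∈ D) →
    G.Adj u₁ w₁ → G.Adj u₂ w₂

section Flip

variable {V : Type*} {G H : SimpleGraph V} {S D : Set V}

theorem FarDetermined.mono {S' : Set V} (hS : S ⊆ S') (h : FarDetermined G S H D) :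
    FarDetermined G S' H D :=
  fun u₁ u₂ w₁ w₂ hu hw => h u₁ u₂ w₁ w₂ (atomicTypes_anti hS hu) (atomicTypes_anti hS hw)

/-- Flip exactly those pairs of types that contain an adjacent far pair touching `D`. By hypothesis
all far pairs touching `D` between these types are then edges of `G`, so they vanish. -/
theorem FarDetermined.exists_flip (h : FarDetermined G S H D) :
    ∃ G' : SimpleGraph V, IsFlip G (atomicTypes G S) G' ∧
      ∀ x y, (x ∈ D ∨ y ∈ D) → G'.Adj x y → Near H 17 x y := by
  let φ : V → V → Prop := fun x y => ∃ x' y', atomicTypes G S x x' ∧ atomicTypes G S y y' ∧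
    (x' ∈ D ∨ y' ∈ D) ∧ ¬ Near H 17 x' y' ∧ G.Adj x' y'
  have hφs : ∀ x y, φ x y → φ y x := by
    rintro x y ⟨x', y', h1, h2, h3, h4, h5⟩
    exact ⟨y', x', h2, h1, h3.symm, fun h => h4 h.symm, h5.symm⟩
  refine ⟨⟨fun x y => x ≠ y ∧ ¬ (G.Adj x y ↔ φ x y), ⟨?_⟩, ⟨fun x hx => hx.1 rfl⟩⟩, ?_, ?_⟩
  · rintro x y ⟨h1, h2⟩
    refine ⟨h1.symm, fun h3 => h2 ?_⟩
    rw [G.adj_comm, h3]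
    exact ⟨hφs _ _, hφs _ _⟩
  · intro X hX Y hY
    by_cases hc : ∃ x ∈ X, ∃ y ∈ Y, φ x y
    · right
      obtain ⟨x₀, hx₀, y₀, hy₀, x', y', h1, h2, h3⟩ := hc
      intro x hx y hy hxy
      have : φ x y := ⟨x', y', (atomicTypes G S).trans'
        ((Setoid.rel_iff_exists_classes _).2 ⟨X, hX, hx, hx₀⟩) h1, (atomicTypes G S).trans'
        ((Setoid.rel_iff_exists_classes _).2 ⟨Y, hY, hy, hy₀⟩) h2, h3⟩
      simp [hxy, this]
    · left
      push Not at hc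
      intro x hx y hy hxy
      have := hc x hx y hy
      simp [hxy, this]
  · rintro x y hD ⟨h1, h2⟩
    by_contra hfar
    refine h2 ⟨fun h3 => ⟨x, y, Setoid.refl' _ x, Setoid.refl' _ y, hD, hfar, h3⟩, ?_⟩
    rintro ⟨x', y', h3, h4, h5, h6, h7⟩
    exact h _ _ _ _ (atomicTypes_symm h3) (atomicTypes_symm h4) h6 hfar h5 hD h7

end Flip

/-! ### Representatives -/

/-- `A` has at most three elements in each part of `P i`, and distinct elements of `A` in the same
part are at distance more than two. -/
structure IsPreNet {V : Type*} {G : SimpleGraph V} {k ρ : ℕ} (D : Decomposition G k ρ) (i : ℕ)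
    (A : Finset V) : Prop where
  far : ∀ x ∈ A, ∀ y ∈ A, x ≠ y → D.P i x y → ¬ Near (D.R i) 2 x y
  card_le : ∀ B ⊆ A, (∀ x ∈ B, ∀ y ∈ B, D.P i x y) → B.card ≤ 3

/-- A pre-net in which every vertex is close to an element of its part, or its part contains three
elements that are far from each other. -/
structure IsNet {V : Type*} {G : SimpleGraph V} {k ρ : ℕ} (D : Decomposition G k ρ) (i : ℕ)
    (A : Finset V) : Prop extends IsPreNet D i A where
  rep : ∀ v, (∃ s ∈ A, D.P i v s ∧ Near (D.R i) 2 v s) ∨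
    ∃ s₁ ∈ A, ∃ s₂ ∈ A, ∃ s₃ ∈ A, D.P i v s₁ ∧ D.P i v s₂ ∧ D.P i v s₃ ∧
      ¬ Near (D.R i) 2 s₁ s₂ ∧ ¬ Near (D.R i) 2 s₁ s₃ ∧ ¬ Near (D.R i) 2 s₂ s₃

section Net

variable {V : Type*} {G : SimpleGraph V} {k ρ i j : ℕ} {D : Decomposition G k ρ}
  {A : Finset V} {S : Set V}

theorem IsPreNet.anti (h : IsPreNet D j A) (hij : i ≤ j) : IsPreNet D i A where
  far x hx y hy hxy hP hn :=
    h.far x hx y hy hxy (D.P_mono hij hP) (hn.mono (D.R_mono hij))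
  card_le B hB hP := h.card_le B hB fun x hx y hy => D.P_mono hij (hP x hx y hy)

/-- Take a maximal pre-net. A vertex violating `rep` would be far from all net elements of its part,
of which there are at most two, so it could be added. -/
theorem IsPreNet.exists_isNet [Fintype V] (h : IsPreNet D i A) : ∃ A', A ⊆ A' ∧ IsNet D i A' := by
  classical
  obtain ⟨A', hA', hmax⟩ := (Set.toFinite {B | IsPreNet D i B}).exists_le_maximal h
  refine ⟨A', hA', hmax.1, fun v => ?_⟩
  by_contra! hcon
  obtain ⟨h1, h2⟩ := hcon
  have hv : v ∉ A' := fun hv => h1 v hv (Setoid.refl' _ v) (Near.refl _ _ _)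
  have hpre : IsPreNet D i (insert v A') := by
    constructor
    · intro x hx y hy hxy hP
      rw [Finset.mem_insert] at hx hy
      rcases hx with rfl | hx <;> rcases hy with rfl | hy
      · exact absurd rfl hxy
      · exact h1 y hy hP
      · exact fun hn => h1 x hx ((D.P i).symm' hP) hn.symm
      · exact hmax.1.far x hx y hy hxy hP
    · intro B hB hP
      by_contra! hc
      by_cases hvB : v ∈ B
      · have h3 : 2 < (B.erase v).card := by rw [Finset.card_erase_of_mem hvB]; omega
        have hsub : ∀ x ∈ B.erase v, x ∈ A' ∧ D.P i v x := fun x hx => by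
          obtain ⟨hxv, hxB⟩ := Finset.mem_erase.1 hx
          exact ⟨(Finset.mem_insert.1 (hB hxB)).resolve_left hxv, hP v hvB x hxB⟩
        obtain ⟨a, b, c, ha, hb, hc, hab, hac, hbc⟩ := Finset.two_lt_card_iff.1 h3
        have hP' : ∀ x ∈ B.erase v, ∀ y ∈ B.erase v, D.P i x y := fun x hx y hy =>
          hP x (Finset.mem_of_mem_erase hx) y (Finset.mem_of_mem_erase hy)
        exact hmax.1.far b (hsub b hb).1 c (hsub c hc).1 hbc (hP' b hb c hc)
          (h2 a (hsub a ha).1 b (hsub b hb).1 c (hsub c hc).1 (hsub a ha).2 (hsub b hb).2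
            (hsub c hc).2 (hmax.1.far a (hsub a ha).1 b (hsub b hb).1 hab (hP' a ha b hb))
            (hmax.1.far a (hsub a ha).1 c (hsub c hc).1 hac (hP' a ha c hc)))
      · have : B ⊆ A' := fun x hx => (Finset.mem_insert.1 (hB hx)).resolve_left
          fun hxv => hvB (hxv ▸ hx)
        exact absurd (hmax.1.card_le B this hP) (by omega)
  exact hv (hmax.2 hpre (Finset.subset_insert v A') (Finset.mem_insert_self v A'))

/-- Built downwards from `D.L`: a net at `i + 1` is still a pre-net at `i`, where partition and
resolved pairs are smaller, and can be extended. -/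
theorem exists_nets [Fintype V] (D : Decomposition G k ρ) : ∃ A : ℕ → Finset V,
    (∀ i < D.L, A (i + 1) ⊆ A i) ∧ ∀ i ≤ D.L, IsNet D i (A i) := by
  have h0 : IsPreNet D D.L ∅ := ⟨by simp, fun B hB _ => by simp [Finset.subset_empty.1 hB]⟩
  choose f hf using fun (i : ℕ) (A : {A // IsPreNet D i A}) => A.2.exists_isNet
  let T : ∀ n : ℕ, {A // IsNet D (D.L - n) A} := fun n => Nat.rec
    ⟨f D.L ⟨∅, h0⟩, (hf D.L ⟨∅, h0⟩).2⟩
    (fun n A => ⟨f (D.L - (n + 1)) ⟨A.1, A.2.toIsPreNet.anti (by omega)⟩, (hf _ _).2⟩) n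
  have hT : ∀ n, (T n).1 ⊆ (T (n + 1)).1 := fun n =>
    (hf (D.L - (n + 1)) ⟨(T n).1, (T n).2.toIsPreNet.anti (by omega)⟩).1
  refine ⟨fun i => (T (D.L - i)).1, fun i hi => ?_, fun i hi => ?_⟩
  · have : D.L - i = (D.L - (i + 1)) + 1 := by omega
    dsimp only
    rw [this]
    exact hT _
  · have h1 : ∀ j, D.L - j = i → IsNet D i (T j).1 := fun j hj => hj ▸ (T j).2
    exact h1 _ (by omega)

/-- A representative within 2 of `u` inherits the distance. Otherwise, among three representatives
pairwise more than 2 apart, each of `w₁`, `w₂` is within 1 of at most one, so one is left over. -/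
theorem IsNet.exists_avoiding (h : IsNet D i A) {u w₁ w₂ : V} (h1 : ¬ Near (D.R i) 3 u w₁)
    (h2 : ¬ Near (D.R i) 3 u w₂) :
    ∃ s ∈ A, D.P i u s ∧ ¬ Near (D.R i) 1 s w₁ ∧ ¬ Near (D.R i) 1 s w₂ := by
  rcases h.rep u with ⟨s, hs, hP, hn⟩ | ⟨a, ha, b, hb, c, hc, hPa, hPb, hPc, hab, hac, hbc⟩
  · exact ⟨s, hs, hP, fun h => h1 (hn.trans h), fun h => h2 (hn.trans h)⟩
  · have key : ∀ {x y w : V}, ¬ Near (D.R i) 2 x y → Near (D.R i) 1 x w → ¬ Near (D.R i) 1 y w :=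
      fun hxy hx hy => hxy (hx.trans hy.symm)
    by_contra! hcon
    have ka := hcon a ha hPa
    have kb := hcon b hb hPb
    have kc := hcon c hc hPc
    by_cases ha1 : Near (D.R i) 1 a w₁
    · exact key hbc (kb (key hab ha1)) (kc (key hac ha1))
    · have ha2 := ka ha1
      have hb1 := not_imp_comm.1 kb (key hab ha2)
      have hc1 := not_imp_comm.1 kc (key hac ha2)
      exact key hbc hb1 hc1

theorem not_near_of_le {H : SimpleGraph V} {m n : ℕ} {u v : V} (h : ¬ Near H n u v)
    (hmn : m ≤ n) : ¬ Near H m u v :=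
  fun h' => h (h'.mono_right hmn)

theorem not_near_symm {H : SimpleGraph V} {n : ℕ} {u v : V} (h : ¬ Near H n u v) :
    ¬ Near H n v u :=
  fun h' => h h'.symm

/-- Over a set of representatives, the adjacency of a vertex to far away vertices depends only on
their atomic types. -/
theorem IsNet.adj_iff (h : IsNet D i A) (hAS : ↑A ⊆ S) {u w₁ w₂ : V}
    (hw : atomicTypes G S w₁ w₂) (h1 : ¬ Near (D.R i) 3 u w₁) (h2 : ¬ Near (D.R i) 3 u w₂) :
    G.Adj u w₁ ↔ G.Adj u w₂ := by
  obtain ⟨s, hs, hP, hs1, hs2⟩ := h.exists_avoiding h1 h2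
  rw [D.homog i u s w₁ w₁ hP (Setoid.refl' _ _) (not_near_of_le h1 (by norm_num)) hs1,
    D.homog i u s w₂ w₂ hP (Setoid.refl' _ _) (not_near_of_le h2 (by norm_num)) hs2]
  exact atomicTypes_adj hw (hAS hs)

theorem IsNet.farDetermined_singleton (h : IsNet D i A) (hAS : ↑A ⊆ S) (v : V) :
    FarDetermined G S (D.R i) {v} := by
  have hle : ∀ {x y}, ¬ Near (D.R i) 17 x y → ¬ Near (D.R i) 3 x y :=
    fun h => not_near_of_le h (by norm_num)
  rintro u₁ u₂ w₁ w₂ hu hw h1 h2 (rfl | rfl) (rfl | rfl) hadj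
  · exact (h.adj_iff hAS hw (hle h1) (hle h2)).1 hadj
  · exact ((h.adj_iff hAS ((atomicTypes G S).trans' hw hu) (hle h1)
      (hle (not_near_symm h2))).1 hadj).symm
  · exact (h.adj_iff hAS ((atomicTypes G S).trans' hu hw) (hle (not_near_symm h1))
      (hle h2)).1 hadj.symm
  · exact ((h.adj_iff hAS hu (hle (not_near_symm h1)) (hle (not_near_symm h2))).1 hadj.symm).symm

end Net

/-! ### Conflicts -/

/-- A violation of `FarDetermined G S H univ`. -/
structure Conflict {V : Type*} (G : SimpleGraph V) (S : Set V) (H : SimpleGraph V)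
    (u₁ u₂ w₁ w₂ : V) : Prop where
  type_u : atomicTypes G S u₁ u₂
  type_w : atomicTypes G S w₁ w₂
  far₁ : ¬ Near H 17 u₁ w₁
  far₂ : ¬ Near H 17 u₂ w₂
  adj : ¬ (G.Adj u₁ w₁ ↔ G.Adj u₂ w₂)

section Conflict

variable {V : Type*} {G H : SimpleGraph V} {S : Set V} {u₁ u₂ w₁ w₂ : V}

theorem Conflict.swap_index (h : Conflict G S H u₁ u₂ w₁ w₂) : Conflict G S H u₂ u₁ w₂ w₁ :=
  ⟨atomicTypes_symm h.type_u, atomicTypes_symm h.type_w, h.far₂, h.far₁,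
    fun h' => h.adj h'.symm⟩

theorem Conflict.swap_sides (h : Conflict G S H u₁ u₂ w₁ w₂) : Conflict G S H w₁ w₂ u₁ u₂ :=
  ⟨h.type_w, h.type_u, not_near_symm h.far₁, not_near_symm h.far₂,
    fun h' => h.adj (by rw [G.adj_comm u₁, G.adj_comm u₂]; exact h')⟩

theorem exists_conflict (h : ¬ FarDetermined G S H Set.univ) :
    ∃ u₁ u₂ w₁ w₂, Conflict G S H u₁ u₂ w₁ w₂ := by
  unfold FarDetermined at h
  push Not at h
  obtain ⟨u₁, u₂, w₁, w₂, hu, hw, h1, h2, _, _, h3, h4⟩ := h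
  exact ⟨u₁, u₂, w₁, w₂, hu, hw, h1, h2, fun h => h4 (h.1 h3)⟩

theorem Conflict.not_farDetermined (h : Conflict G S H u₁ u₂ w₁ w₂) :
    ¬ FarDetermined G S H Set.univ := fun hF =>
  h.adj ⟨hF _ _ _ _ h.type_u h.type_w h.far₁ h.far₂ (Or.inl trivial) (Or.inl trivial),
    hF _ _ _ _ (atomicTypes_symm h.type_u) (atomicTypes_symm h.type_w) h.far₂ h.far₁
      (Or.inl trivial) (Or.inl trivial)⟩

end Conflict

/-! ### Covered parts, units and located conflicts -/

section Units

variable {V : Type*} {G : SimpleGraph V} {k ρ i : ℕ} {D : Decomposition G k ρ}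
  {A : Finset V} {S : Set V} {u₁ u₂ w₁ w₂ u v w : V}

/-- If `u₁ w₂` were far, one endpoint at a time could be replaced along `u₁ w₁`, `u₁ w₂`, `u₂ w₂`
without changing adjacency. -/
theorem Conflict.near (h : Conflict G S (D.R i) u₁ u₂ w₁ w₂) (hA : IsNet D i A) (hAS : ↑A ⊆ S) :
    Near (D.R i) 3 u₁ w₂ := by
  by_contra hn
  apply h.adj
  rw [hA.adj_iff hAS h.type_w (not_near_of_le h.far₁ (by norm_num)) hn, G.adj_comm u₁,
    G.adj_comm u₂]
  exact hA.adj_iff hAS h.type_u (not_near_symm hn)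
    (not_near_of_le (not_near_symm h.far₂) (by norm_num))

/-- The part of `v` in `P j` is covered by the balls of radius `3` around `c` and `c'`. -/
def Covered (D : Decomposition G k ρ) (j : ℕ) (v c c' : V) : Prop :=
  ∀ x, D.P j v x → Near (D.R j) 3 c x ∨ Near (D.R j) 3 c' x

/-- If neither part is covered, there are net elements `s` in the part of `u₁` and `t` in that of
`w₂` avoiding the opposite vertices. Adjacency is then preserved along `u₁w₁`, `sw₁`, `sw₂`, `u₁t`,
`u₂t`, `u₂w₂`, alternating homogeneity and equality of types. -/
theorem Conflict.covered_or (h : Conflict G S (D.R i) u₁ u₂ w₁ w₂) (hA : IsNet D i A)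
    (hAS : ↑A ⊆ S) : Covered D i u₁ w₁ w₂ ∨ Covered D i w₂ u₁ u₂ := by
  by_contra! hcon
  obtain ⟨h1, h2⟩ := hcon
  unfold Covered at h1 h2
  push Not at h1 h2
  obtain ⟨x, hx, hx1, hx2⟩ := h1
  obtain ⟨y, hy, hy1, hy2⟩ := h2
  obtain ⟨s, hs, hsP, hs1, hs2⟩ := hA.exists_avoiding (not_near_symm hx1) (not_near_symm hx2)
  obtain ⟨t, ht, htP, ht1, ht2⟩ := hA.exists_avoiding (not_near_symm hy1) (not_near_symm hy2)
  have hus := (D.P i).trans' hx hsP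
  have hwt := (D.P i).trans' hy htP
  apply h.adj
  have f1 := not_near_of_le h.far₁ (by norm_num : 1 ≤ 17)
  have f2 := not_near_of_le h.far₂ (by norm_num : 1 ≤ 17)
  rw [D.homog i u₁ s w₁ w₁ hus (Setoid.refl' _ _) f1 hs1, atomicTypes_adj h.type_w (hAS hs),
    D.homog i s u₁ w₂ t (Setoid.symm' _ hus) hwt hs2 (not_near_symm ht1), G.adj_comm,
    atomicTypes_adj h.type_u (hAS ht), G.adj_comm]
  exact D.homog i u₂ u₂ t w₂ (Setoid.refl' _ _) (Setoid.symm' _ hwt) (not_near_symm ht2) f2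

/-- Vertices in the same part of all later partitions, that are not separated by a cover of such a
part with two balls of radius `3` that are far apart. -/
def units (D : Decomposition G k ρ) (i : ℕ) : Setoid V where
  r u v := ∀ j, i ≤ j → j ≤ D.L → D.P j u v ∧ ∀ c c', Covered D j u c c' →
    ¬ Near (D.R j) 14 c c' → (Near (D.R j) 3 c u ↔ Near (D.R j) 3 c v)
  iseqv :=
    { refl := fun u _ _ _ => ⟨Setoid.refl' _ u, fun _ _ _ _ => Iff.rfl⟩
      symm := fun h j hi hj => ⟨(D.P j).symm' (h j hi hj).1, fun c c' hc hn =>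
        ((h j hi hj).2 c c' (fun x hx => hc x ((D.P j).trans' ((D.P j).symm' (h j hi hj).1) hx))
          hn).symm⟩
      trans := fun h h' j hi hj => ⟨(D.P j).trans' (h j hi hj).1 (h' j hi hj).1,
        fun c c' hc hn => ((h j hi hj).2 c c' hc hn).trans ((h' j hi hj).2 c c'
          (fun x hx => hc x ((D.P j).trans' (h j hi hj).1 hx)) hn)⟩ }

theorem units_mono {j : ℕ} (hij : i ≤ j) (h : units D i u v) : units D j u v :=
  fun l hl => h l (hij.trans hl)

theorem units_part (hi : i ≤ D.L) (h : units D i u v) : D.P i u v := (h i le_rfl hi).1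

theorem units_near (hi : i ≤ D.L) (h : units D i u v) {c c' : V} (hc : Covered D i u c c')
    (hn : ¬ Near (D.R i) 14 c c') (hu : Near (D.R i) 3 c u) : Near (D.R i) 3 c v :=
  ((h i le_rfl hi).2 c c' hc hn).1 hu

/-- A part contains at most two units. -/
theorem units_or (huv : D.P i u v) (huw : D.P i u w) :
    units D i u v ∨ units D i u w ∨ units D i v w := by
  classical
  by_cases hex : ∃ j, i ≤ j ∧ ∃ c c', Covered D j u c c'
  -- At the least covered level two of the three vertices share a ball, so are within 6 there and at
  -- all later levels. A later cover separating them would have centres within `3 + 6 + 3 = 12`.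
  · set j := Nat.find hex with hj
    obtain ⟨hij, c, c', hcov⟩ := Nat.find_spec hex
    rw [← hj] at hij hcov
    have hbefore : ∀ l, i ≤ l → ∀ c c', Covered D l u c c' → j ≤ l := fun l hl c c' hc =>
      Nat.find_min' hex ⟨hl, c, c', hc⟩
    have key : ∀ x y : V, D.P i u x → D.P i u y → Near (D.R j) 6 x y → units D i x y := by
      intro x y hx hy hn l hl _
      have hxy := D.P_mono hl ((D.P i).trans' ((D.P i).symm' hx) hy)
      refine ⟨hxy, fun e e' he hfar => ?_⟩
      have hjl : j ≤ l := hbefore l hl e e' fun z hz =>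
        he z ((D.P l).trans' (D.P_mono hl ((D.P i).symm' hx)) hz)
      have hn' := hn.mono (D.R_mono hjl)
      constructor
      · intro h1
        by_contra h2
        exact hfar ((h1.trans hn').trans_le ((he y hxy).resolve_left h2).symm (by norm_num))
      · intro h1
        by_contra h2
        exact hfar ((h1.trans hn'.symm).trans_le
          ((he x (Setoid.refl' _ x)).resolve_left h2).symm (by norm_num))
    have hu' := hcov u (Setoid.refl' _ u)
    have hv' := hcov v (D.P_mono hij huv)
    have hw' := hcov w (D.P_mono hij huw)
    have ku := fun e (h1 : Near (D.R j) 3 e u) (h2 : Near (D.R j) 3 e v) =>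
      key u v (Setoid.refl' _ u) huv (h1.symm.trans h2)
    have kw := fun e (h1 : Near (D.R j) 3 e u) (h2 : Near (D.R j) 3 e w) =>
      key u w (Setoid.refl' _ u) huw (h1.symm.trans h2)
    have kv := fun e (h1 : Near (D.R j) 3 e v) (h2 : Near (D.R j) 3 e w) =>
      key v w huv huw (h1.symm.trans h2)
    rcases hu' with h1 | h1 <;> rcases hv' with h2 | h2 <;> rcases hw' with h3 | h3
    · exact Or.inl (ku _ h1 h2)
    · exact Or.inl (ku _ h1 h2)
    · exact Or.inr (Or.inl (kw _ h1 h3))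
    · exact Or.inr (Or.inr (kv _ h2 h3))
    · exact Or.inr (Or.inr (kv _ h2 h3))
    · exact Or.inr (Or.inl (kw _ h1 h3))
    · exact Or.inl (ku _ h1 h2)
    · exact Or.inl (ku _ h1 h2)
  · left
    intro l hl _
    exact ⟨D.P_mono hl huv, fun c c' hc _ => absurd ⟨l, hl, c, c', hc⟩ hex⟩

/-- If the part of `u₁` is covered, then the unit of `u₁` is close to `w₂`. -/
theorem Conflict.unit_near (h : Conflict G S (D.R i) u₁ u₂ w₁ w₂) (hA : IsNet D i A)
    (hAS : ↑A ⊆ S) (hi : i ≤ D.L) (hc : Covered D i u₁ w₁ w₂) :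
    ∀ x, units D i u₁ x → Near (D.R i) 3 w₂ x := by
  intro x hx
  have hn := h.near hA hAS
  -- The centres are more than `17 - 3 = 14` apart, since `u₁` is within 3 of `w₂` and more than 17
  -- from `w₁`; this is the threshold in `units`.
  refine units_near hi hx (fun y hy => (hc y hy).symm) (fun hw => h.far₁ ?_) hn.symm
  exact hn.trans_le hw (by norm_num)

/-- The labelled form of a conflict: the unit of `u₂` and an earlier unit are close to vertices of
the conflict. -/
structure LocatedConflict (D : Decomposition G k ρ) (S : Set V) (i : ℕ) (age : V → ℕ)
    (u₁ u₂ w₁ w₂ : V) : Prop extends Conflict G S (D.R i) u₁ u₂ w₁ w₂ where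
  near_late : ∀ x, units D i u₂ x → Near (D.R i) 3 w₁ x
  near_early : (age u₁ < age u₂ ∧ ∀ x, units D i u₁ x → Near (D.R i) 3 w₂ x) ∨
    (age w₂ < age u₂ ∧ ∀ x, units D i w₂ x → Near (D.R i) 3 u₁ x)

theorem Conflict.exists_located (h : Conflict G S (D.R i) u₁ u₂ w₁ w₂) (hA : IsNet D i A)
    (hAS : ↑A ⊆ S) (hi : i ≤ D.L) {age : V → ℕ}
    (hage : ∀ u v, age u = age v ↔ units D i u v) :
    ∃ u₁ u₂ w₁ w₂, LocatedConflict D S i age u₁ u₂ w₁ w₂ := by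
  have twin : ∀ {u₁ u₂ w₁ w₂}, Conflict G S (D.R i) u₁ u₂ w₁ w₂ → Covered D i u₁ w₁ w₂ →
      Covered D i u₂ w₂ w₁ → ∃ u₁ u₂ w₁ w₂, LocatedConflict D S i age u₁ u₂ w₁ w₂ := by
    intro u₁ u₂ w₁ w₂ h h1 h2
    have k1 := h.unit_near hA hAS hi h1
    have k2 := h.swap_index.unit_near hA hAS hi h2
    rcases lt_trichotomy (age u₁) (age u₂) with hlt | heq | hlt
    · exact ⟨u₁, u₂, w₁, w₂, h, k2, Or.inl ⟨hlt, k1⟩⟩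
    · exact absurd ((k2 u₁ ((hage _ _).1 heq.symm)).symm.mono_right (by norm_num)) h.far₁
    · exact ⟨u₂, u₁, w₂, w₁, h.swap_index, k1, Or.inl ⟨hlt, k2⟩⟩
  have cross : ∀ {u₁ u₂ w₁ w₂}, Conflict G S (D.R i) u₁ u₂ w₁ w₂ → Covered D i u₁ w₁ w₂ →
      Covered D i w₁ u₁ u₂ → ∃ u₁ u₂ w₁ w₂, LocatedConflict D S i age u₁ u₂ w₁ w₂ := by
    intro u₁ u₂ w₁ w₂ h h1 h2
    have k1 := h.unit_near hA hAS hi h1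
    have k2 := h.swap_sides.unit_near hA hAS hi h2
    rcases lt_trichotomy (age u₁) (age w₁) with hlt | heq | hlt
    · exact ⟨w₂, w₁, u₂, u₁, h.swap_index.swap_sides, k2, Or.inr ⟨hlt, k1⟩⟩
    · exact absurd ((k2 u₁ ((hage _ _).1 heq.symm)).symm.trans_le
        (h.swap_index.near hA hAS) (by norm_num)) h.far₁
    · exact ⟨u₂, u₁, w₂, w₁, h.swap_index, k1, Or.inr ⟨hlt, k2⟩⟩
  -- Applying the alternative to the conflict and its index swap covers two opposite parts on one
  -- side (twin) or one on each side (cross). Their units differ, and symmetry puts the later one at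
  -- `u₂`.
  rcases h.covered_or hA hAS with h1 | h1 <;> rcases h.swap_index.covered_or hA hAS with h2 | h2
  · exact twin h h1 h2
  · exact cross h h1 (fun x hx => (h2 x hx).symm)
  · exact cross h.swap_index h2 (fun x hx => (h1 x hx).symm)
  · exact twin h.swap_sides (fun x hx => (h2 x hx).symm) (fun x hx => (h1 x hx).symm)

end Units

/-! ### Tokens -/

open Classical in
/-- The number of elements of `ot` with property `p` plus the number of elements of `wt` whose
witness has property `p`. -/
noncomputable def mass {V : Type*} (ot wt : Finset V) (b : V → V) (p : V → Prop) : ℕ :=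
  (ot.filter p).card + (wt.filter fun s => p (b s)).card

section Mass

variable {V : Type*} {ot wt : Finset V} {b : V → V} {p q r : V → Prop}

theorem mass_mono (h : ∀ x, p x → q x) : mass ot wt b p ≤ mass ot wt b q := by
  classical
  unfold mass
  exact Nat.add_le_add (Finset.card_le_card (Finset.monotone_filter_right _ fun x _ => h x))
    (Finset.card_le_card (Finset.monotone_filter_right _ fun x _ => h (b x)))

theorem mass_add_le (hpq : ∀ x, p x → ¬ q x) (hp : ∀ x, p x → r x) (hq : ∀ x, q x → r x) :
    mass ot wt b p + mass ot wt b q ≤ mass ot wt b r := by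
  classical
  have key : ∀ (A : Finset V) (f : V → V), (A.filter fun s => p (f s)).card +
      (A.filter fun s => q (f s)).card ≤ (A.filter fun s => r (f s)).card := by
    intro A f
    rw [← Finset.card_union_of_disjoint]
    · refine Finset.card_le_card fun x hx => ?_
      rw [Finset.mem_union, Finset.mem_filter, Finset.mem_filter] at hx
      rw [Finset.mem_filter]
      rcases hx with hx | hx
      · exact ⟨hx.1, hp _ hx.2⟩
      · exact ⟨hx.1, hq _ hx.2⟩
    · rw [Finset.disjoint_left]
      intro x hx hx'
      exact hpq _ (Finset.mem_filter.1 hx).2 (Finset.mem_filter.1 hx').2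
  have h1 : (ot.filter p).card + (ot.filter q).card ≤ (ot.filter r).card := key ot fun x => x
  have h2 := key wt b
  unfold mass
  omega

theorem mass_eq_zero (h : ∀ x, ¬ p x) : mass ot wt b p = 0 := by
  classical
  unfold mass
  simp [h]

open Classical in
theorem mass_insert_le {s u : V} (hs : s ∉ wt) {c : ℕ} (hc : p u → 1 ≤ c) :
    mass ot (insert s wt) (Function.update b s u) p ≤ mass ot wt b p + c := by
  unfold mass
  have h : (wt.filter fun x => p (Function.update b s u x)) = wt.filter fun x => p (b x) := by
    refine Finset.filter_congr fun x hx => ?_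
    rw [Function.update_of_ne (ne_of_mem_of_not_mem hx hs)]
  rw [Finset.filter_insert, Function.update_self, h]
  split_ifs with hp
  · rw [Finset.card_insert_of_notMem fun h => hs (Finset.mem_filter.1 h).1]
    have := hc hp
    omega
  · omega

open Classical in
theorem mass_union_le {X Y : Finset V} (hXY : ∀ x ∈ X, p x → x ∈ Y) :
    mass (ot ∪ X) wt b p ≤ mass ot wt b p + Y.card := by
  unfold mass
  rw [Finset.filter_union]
  have h1 := Finset.card_union_le (ot.filter p) (X.filter p)
  have h2 : (X.filter p).card ≤ Y.card := Finset.card_le_card fun x hx =>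
    hXY x (Finset.mem_filter.1 hx).1 (Finset.mem_filter.1 hx).2
  omega

end Mass

/-- The data of the construction: the current set `S`, its witness tokens `wt` with witnesses `b`
and insertion times `ord`, its own tokens `ot`, and for each unit label `age` a reservoir `Rs`, the
set `K` of labels for which the reservoir has been prepared, and a window `W` of labels. -/
structure TokenState (V : Type*) where
  S : Finset V
  wt : Finset V
  ot : Finset V
  b : V → V
  ord : V → ℕ
  age : V → ℕ
  Rs : ℕ → Finset V
  K : ℕ → Finset (ℕ × Bool)
  W : ℕ → Finset ℕ
  N : ℕ

open Classical in
/-- The invariant of the construction at index `i`. -/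
structure Inv {V : Type*} {G : SimpleGraph V} {k ρ : ℕ} (D : Decomposition G k ρ)
    (A : ℕ → Finset V) (m i : ℕ) (σ : TokenState V) : Prop where
  net_sub : A i ⊆ σ.S
  wt_sub : σ.wt ⊆ σ.S
  sub : σ.S ⊆ A i ∪ σ.wt ∪ σ.ot
  age_iff : ∀ u v, σ.age u = σ.age v ↔ units D i u v
  ord_inj : ∀ s ∈ σ.wt, ∀ t ∈ σ.wt, σ.ord s = σ.ord t → s = t
  age_lt : ∀ v, σ.age v < σ.N
  K_empty : ∀ z, σ.N ≤ z → σ.K z = ∅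
  -- Each addition to the mass of a label uses a new vertex of its reservoir; the first summand is
  -- the credit with which a label starts.
  mass_le : ∀ a, mass σ.ot σ.wt σ.b (fun x => σ.age x = a) ≤
    4 * k * (2 * k * m) + (σ.S ∩ σ.Rs a).card
  Rs_card : ∀ z, (σ.Rs z).card ≤ 2 * k * m * (σ.K z).card
  K_sub : ∀ z, σ.K z ⊆ σ.W z ×ˢ Finset.univ
  -- Prepared labels are older than `z`, so whenever `z` survives a descent they are inherited
  -- labels too, never fresh ones.
  K_lt : ∀ z, ∀ κ ∈ σ.K z, κ.1 < z
  W_card : ∀ z, (σ.W z).card ≤ 2 * k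
  -- The window is frozen at the first preparation and stays valid: as `i` decreases balls shrink,
  -- and labels are only passed to subunits.
  W_mem : ∀ u v, (σ.K (σ.age u)).Nonempty → σ.age v < σ.age u → Near (D.R (i + 1)) 23 u v →
    σ.age v ∈ σ.W (σ.age u)
  -- For a genuine conflict the second alternative fails, as `w₁`, `w₂` have equal types over `S`;
  -- the first then supplies the next witness token.
  prepared : ∀ u₁ u₂ w₁ w₂, (σ.age u₁, false) ∈ σ.K (σ.age u₂) ∨ (σ.age w₂, true) ∈ σ.K (σ.age u₂) →
    Near (D.R i) 3 u₂ w₁ → Near (D.R i) 3 u₁ w₂ → ¬ (G.Adj u₁ w₁ ↔ G.Adj u₂ w₂) →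
    (∃ s ∈ σ.Rs (σ.age u₂), ¬ (G.Adj s u₁ ↔ G.Adj s u₂) ∧ ¬ Near (D.R i) 3 u₁ s) ∨
    ∃ s ∈ σ.S, ¬ (G.Adj s w₁ ↔ G.Adj s w₂)
  two_tokens : ∀ s ∈ σ.wt, ∀ t ∈ σ.wt, σ.ord s < σ.ord t → D.P i s t →
    (G.Adj s (σ.b t) ↔ G.Adj t (σ.b t)) → ¬ Near (D.R i) 2 s t
  three_tokens : ∀ s ∈ σ.wt, ∀ t ∈ σ.wt, ∀ u ∈ σ.wt, σ.ord s < σ.ord t → σ.ord t < σ.ord u →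
    D.P i s t → D.P i t u → (G.Adj s (σ.b t) ↔ G.Adj t (σ.b t)) →
    (G.Adj s (σ.b u) ↔ G.Adj u (σ.b u)) → ¬ (G.Adj t (σ.b u) ↔ G.Adj u (σ.b u))

section Inv

variable {V : Type*} {G : SimpleGraph V} {k ρ i m d : ℕ} {D : Decomposition G k ρ}
  {A : ℕ → Finset V} {σ : TokenState V}

/-- `K a` lies in a window of `2k` labels times two sides, so the reservoir has at most `4k * (2km)`
vertices, the same as the starting credit. -/
theorem Inv.mass_le_two (h : Inv D A m i σ) (a : ℕ) :
    mass σ.ot σ.wt σ.b (fun x => σ.age x = a) ≤ 2 * (4 * k * (2 * k * m)) := by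
  classical
  have h1 := h.mass_le a
  have h2 : (σ.S ∩ σ.Rs a).card ≤ 4 * k * (2 * k * m) := by
    refine (Finset.card_le_card Finset.inter_subset_right).trans ((h.Rs_card a).trans ?_)
    have h3 : (σ.K a).card ≤ 2 * k * 2 := by
      refine (Finset.card_le_card (h.K_sub a)).trans ?_
      rw [Finset.card_product]
      simpa using h.W_card a
    calc 2 * k * m * (σ.K a).card ≤ 2 * k * m * (2 * k * 2) := Nat.mul_le_mul_left _ h3
      _ = _ := by ring
  omega

open Classical in
/-- A ball meets at most `2 * k` units. -/
theorem card_ages_le [Fintype V] {age : V → ℕ} (hage : ∀ u v, age u = age v ↔ units D i u v)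
    (hi : i < D.L) {t : ℕ} (ht : t ≤ ρ) (v : V) :
    ((Finset.univ.filter fun x => Near (D.R (i + 1)) t v x).image age).card ≤ 2 * k := by
  set X := Finset.univ.filter fun x => Near (D.R (i + 1)) t v x with hX
  obtain ⟨Y, hYX, hinj, himg⟩ : ∃ Y ⊆ X, Set.InjOn age Y ∧ Y.image age = X.image age := by
    choose f hf using fun a : X.image age => Finset.mem_image.1 a.2
    refine ⟨Finset.univ.image f, ?_, ?_, ?_⟩
    · intro x hx
      obtain ⟨a, _, rfl⟩ := Finset.mem_image.1 hx
      exact (hf a).1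
    · intro x hx y hy hxy
      obtain ⟨a, _, rfl⟩ := Finset.mem_image.1 hx
      obtain ⟨b, _, rfl⟩ := Finset.mem_image.1 hy
      rw [(hf a).2, (hf b).2] at hxy
      rw [Subtype.ext hxy]
    · ext a
      constructor
      · intro ha
        obtain ⟨x, hx, rfl⟩ := Finset.mem_image.1 ha
        obtain ⟨a, _, rfl⟩ := Finset.mem_image.1 hx
        exact Finset.mem_image_of_mem _ (hf a).1
      · intro ha
        exact Finset.mem_image.2 ⟨f ⟨a, ha⟩, Finset.mem_image_of_mem _ (Finset.mem_univ _),
          (hf ⟨a, ha⟩).2⟩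
  rw [← himg, Finset.card_image_of_injOn hinj, mul_comm]
  obtain ⟨T, hT, hcov⟩ := D.width i hi v
  refine card_le_of_cover (Q := D.P i) hT (fun x hx => hcov x
    ((Finset.mem_filter.1 (hYX hx)).2.mono_right ht)) fun t _ A' hA' hP => ?_
  by_contra! hc
  obtain ⟨a, b, c, ha, hb, hc, hab, hac, hbc⟩ := Finset.two_lt_card_iff.1 hc
  have hne : ∀ x ∈ A', ∀ y ∈ A', x ≠ y → ¬ units D i x y := fun x hx y hy hxy hu =>
    hxy (hinj (hA' hx) (hA' hy) ((hage _ _).2 hu))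
  rcases units_or ((D.P i).trans' ((D.P i).symm' (hP a ha)) (hP b hb))
    ((D.P i).trans' ((D.P i).symm' (hP a ha)) (hP c hc)) with h | h | h
  · exact hne a ha b hb hab h
  · exact hne a ha c hc hac h
  · exact hne b hb c hc hbc h

open Classical in
/-- The number of elements of `S` in a ball. -/
theorem Inv.card_ball_le [Fintype V] (h : Inv D A m i σ) (hA : IsPreNet D i (A i)) (hi : i < D.L)
    {t : ℕ} (ht : t + 1 ≤ ρ) (v : V) :
    (σ.S.filter fun x => Near (D.R (i + 1)) t v x).card ≤
      k * 3 + k * 2 + 2 * k * (2 * (4 * k * (2 * k * m))) := by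
  obtain ⟨T, hT, hcov⟩ := D.width i hi v
  set X := (A i).filter fun x => Near (D.R (i + 1)) t v x with hX
  set Y := σ.wt.filter fun x => Near (D.R (i + 1)) t v x ∧ ¬ Near (D.R (i + 1)) (t + 1) v (σ.b x)
    with hY
  set Z₁ := σ.ot.filter fun x => Near (D.R (i + 1)) t v x with hZ₁
  set Z₂ := σ.wt.filter fun x => Near (D.R (i + 1)) (t + 1) v (σ.b x) with hZ₂
  have hsub : (σ.S.filter fun x => Near (D.R (i + 1)) t v x) ⊆ X ∪ Y ∪ (Z₁ ∪ Z₂) := by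
    intro x hx
    obtain ⟨hxS, hn⟩ := Finset.mem_filter.1 hx
    have := h.sub hxS
    simp only [Finset.mem_union] at this
    simp only [Finset.mem_union, hX, hY, hZ₁, hZ₂, Finset.mem_filter]
    tauto
  have hXc : X.card ≤ k * 3 := by
    refine card_le_of_cover (Q := D.P i) hT (fun x hx => hcov x
      ((Finset.mem_filter.1 hx).2.mono_right (by omega))) fun t _ A' hA' hP => ?_
    exact hA.card_le A' (hA'.trans (Finset.filter_subset _ _)) fun x hx y hy =>
      (D.P i).trans' ((D.P i).symm' (hP x hx)) (hP y hy)
  -- A witness outside the `(t+1)`-ball is not `R i`-near any of these tokens, so tokens of one part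
  -- agree on it; three of them would contradict `three_tokens`.
  have hYc : Y.card ≤ k * 2 := by
    refine card_le_of_cover (Q := D.P i) hT (fun x hx => hcov x
      ((Finset.mem_filter.1 hx).2.1.mono_right (by omega))) fun t _ A' hA' hP => ?_
    by_contra! hc
    have hmem : ∀ x ∈ A', x ∈ σ.wt ∧ Near (D.R (i + 1)) _ v x ∧ _ := fun x hx =>
      Finset.mem_filter.1 (hA' hx)
    have key : ∀ x ∈ A', ∀ y ∈ A', ∀ z ∈ A', σ.ord x < σ.ord y → σ.ord y < σ.ord z → False := by
      intro x hx y hy z hz hxy hyz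
      have hPP : ∀ x ∈ A', ∀ y ∈ A', D.P i x y := fun x hx y hy =>
        (D.P i).trans' ((D.P i).symm' (hP x hx)) (hP y hy)
      have hadj : ∀ x ∈ A', ∀ y ∈ A', ∀ z ∈ A',
          (G.Adj x (σ.b z) ↔ G.Adj y (σ.b z)) := by
        intro x hx y hy z hz
        have hfar : ∀ x ∈ A', ¬ Near (D.R i) 1 x (σ.b z) := fun x hx hn =>
          (hmem z hz).2.2 ((hmem x hx).2.1.trans (hn.mono (D.R_mono (Nat.le_succ i))))
        exact D.homog i x y _ _ (hPP x hx y hy) (Setoid.refl' _ _) (hfar x hx) (hfar y hy)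
      exact h.three_tokens x (hmem x hx).1 y (hmem y hy).1 z (hmem z hz).1 hxy hyz
        (hPP x hx y hy) (hPP y hy z hz) (hadj x hx y hy y hy) (hadj x hx z hz z hz)
        (hadj y hy z hz z hz)
    obtain ⟨a, b, c, ha, hb, hc, hab, hac, hbc⟩ := Finset.two_lt_card_iff.1 hc
    have hne : ∀ x ∈ A', ∀ y ∈ A', x ≠ y → σ.ord x ≠ σ.ord y := fun x hx y hy hxy he =>
      hxy (h.ord_inj x (hmem x hx).1 y (hmem y hy).1 he)
    rcases lt_or_gt_of_ne (hne a ha b hb hab) with h1 | h1 <;>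
      rcases lt_or_gt_of_ne (hne a ha c hc hac) with h2 | h2 <;>
      rcases lt_or_gt_of_ne (hne b hb c hc hbc) with h3 | h3
    · exact key a ha b hb c hc h1 h3
    · exact key a ha c hc b hb h2 h3
    · omega
    · exact key c hc a ha b hb h2 h1
    · exact key b hb a ha c hc h1 h2
    · omega
    · exact key b hb c hc a ha h3 h2
    · exact key c hc b hb a ha h3 h1
  -- The remaining tokens are charged to the at most `2k` units meeting the `(t+1)`-ball.
  have hZc : (Z₁ ∪ Z₂).card ≤ 2 * k * (2 * (4 * k * (2 * k * m))) := by
    set I := (Finset.univ.filter fun x => Near (D.R (i + 1)) (t + 1) v x).image σ.age with hI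
    have hIc : I.card ≤ 2 * k := card_ages_le h.age_iff hi ht v
    have hsub : Z₁ ∪ Z₂ ⊆ I.biUnion fun a =>
        (σ.ot.filter fun x => σ.age x = a) ∪ (σ.wt.filter fun x => σ.age (σ.b x) = a) := by
      intro x hx
      rcases Finset.mem_union.1 hx with hx | hx
      · obtain ⟨hx1, hx2⟩ := Finset.mem_filter.1 hx
        exact Finset.mem_biUnion.2 ⟨σ.age x, Finset.mem_image_of_mem _ (Finset.mem_filter.2
          ⟨Finset.mem_univ _, hx2.mono_right (by omega)⟩),
          Finset.mem_union_left _ (Finset.mem_filter.2 ⟨hx1, rfl⟩)⟩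
      · obtain ⟨hx1, hx2⟩ := Finset.mem_filter.1 hx
        exact Finset.mem_biUnion.2 ⟨σ.age (σ.b x), Finset.mem_image_of_mem _ (Finset.mem_filter.2
          ⟨Finset.mem_univ _, hx2⟩),
          Finset.mem_union_right _ (Finset.mem_filter.2 ⟨hx1, rfl⟩)⟩
    refine (Finset.card_le_card hsub).trans ((Finset.card_biUnion_le_card_mul _ _
      (2 * (4 * k * (2 * k * m))) fun a _ => ?_).trans (Nat.mul_le_mul_right _ hIc))
    refine (Finset.card_union_le _ _).trans (le_of_eq_of_le ?_ (h.mass_le_two a))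
    unfold mass
    congr!
  refine (Finset.card_le_card hsub).trans ((Finset.card_union_le _ _).trans ?_)
  have := Finset.card_union_le X Y
  omega

end Inv

/-! ### Resolving conflicts at a fixed index -/

section Moves

variable {V : Type*} [Fintype V] {G : SimpleGraph V} {k ρ i m : ℕ} {D : Decomposition G k ρ}
  {A : ℕ → Finset V} {σ : TokenState V} {u₁ u₂ w₁ w₂ : V}

open Classical in
/-- A set of vertices that witnesses, from inside or from outside of a unit, every possible
adjacency between the unit and the parts close to it. -/
theorem exists_reservoir (hd : 1 ≤ vcDim G) (hi : i < D.L) (hρ : 6 ≤ ρ) (Z : Finset V) (w : V)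
    (hZ : ∀ z ∈ Z, Near (D.R i) 3 w z) :
    ∃ F : Finset V, F.card ≤ 2 * k * (40 * vcDim G) ∧ ∀ x, (∃ z ∈ Z, Near (D.R i) 3 z x) →
      ∀ a : Prop, (∃ T ⊆ F, (∀ s ∈ T, D.P i x s ∧ ∃ z ∈ Z, Near (D.R i) 3 z s) ∧
          ∀ z ∈ Z, ∃ s ∈ T, (G.Adj s z ↔ a)) ∨
        ∃ s ∈ F ∩ Z, (G.Adj s x ↔ ¬ a) := by
  obtain ⟨T₀, hT₀, hcov⟩ := D.width i hi w
  -- One duality instance for each of the at most `k` parts met and each of the two adjacency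
  -- values, whence the size `2k * 40d`.
  have hdual := fun (e : V) (a : Bool) => exists_dominating_or G hd (a = true)
    (Finset.univ.filter fun x => D.P i e x ∧ ∃ z ∈ Z, Near (D.R i) 3 z x) Z
  have hdual' : ∀ (e : V) (a : Bool), ∃ T : Finset V, T.card ≤ 40 * vcDim G ∧
      ((T ⊆ (Finset.univ.filter fun x => D.P i e x ∧ ∃ z ∈ Z, Near (D.R i) 3 z x) ∧
        ∀ y ∈ Z, ∃ s ∈ T, (G.Adj s y ↔ a = true)) ∨
      (T ⊆ Z ∧ ∀ x ∈ (Finset.univ.filter fun x => D.P i e x ∧ ∃ z ∈ Z, Near (D.R i) 3 z x),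
        ∃ s ∈ T, (G.Adj s x ↔ ¬ a = true))) := by
    intro e a
    rcases hdual e a with ⟨T, h1, h2, h3⟩ | ⟨T, h1, h2, h3⟩
    · exact ⟨T, h2, Or.inl ⟨h1, h3⟩⟩
    · exact ⟨T, h2, Or.inr ⟨h1, h3⟩⟩
  choose T hTc hT using hdual'
  refine ⟨(T₀ ×ˢ Finset.univ).biUnion fun p => T p.1 p.2, ?_, ?_⟩
  · refine (Finset.card_biUnion_le_card_mul _ _ _ fun p _ => hTc p.1 p.2).trans ?_
    refine Nat.mul_le_mul_right _ ?_
    rw [Finset.card_product, Finset.card_univ, Fintype.card_bool, mul_comm]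
    exact Nat.mul_le_mul_left _ hT₀
  · rintro x ⟨z, hz, hzx⟩ a
    obtain ⟨e, he, hex⟩ := hcov x
      ((((hZ z hz).trans hzx).mono (D.R_mono (Nat.le_succ i))).mono_right (by omega))
    have hsub : T e (decide a) ⊆ (T₀ ×ˢ Finset.univ).biUnion fun p => T p.1 p.2 := fun s hs =>
      Finset.mem_biUnion.2 ⟨(e, decide a), Finset.mem_product.2 ⟨he, Finset.mem_univ _⟩, hs⟩
    rcases hT e (decide a) with ⟨h1, h2⟩ | ⟨h1, h2⟩
    · left
      refine ⟨_, hsub, fun s hs => ?_, fun z hz => ?_⟩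
      · have := (Finset.mem_filter.1 (h1 hs)).2
        exact ⟨(D.P i).trans' ((D.P i).symm' hex) this.1, this.2⟩
      · simpa using h2 z hz
    · right
      obtain ⟨s, hs, h3⟩ := h2 x (Finset.mem_filter.2 ⟨Finset.mem_univ _, hex, z, hz, hzx⟩)
      exact ⟨s, Finset.mem_inter.2 ⟨hsub hs, h1 hs⟩, by simpa using h3⟩

omit [Fintype V] in
/-- In a conflict that is not far for the next graph of resolved pairs, the early label lies in the
window of the late one. -/
theorem LocatedConflict.near_succ (h : LocatedConflict D σ.S i σ.age u₁ u₂ w₁ w₂)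
    (hnet : IsNet D i (A i)) (hinv : Inv D A m i σ)
    (hfar : FarDetermined G σ.S (D.R (i + 1)) Set.univ) :
    Near (D.R (i + 1)) 23 u₂ u₁ ∧ Near (D.R (i + 1)) 23 u₂ w₂ := by
  have hAS : (↑(A i) : Set V) ⊆ σ.S := by exact_mod_cast hinv.net_sub
  have hle : D.R i ≤ D.R (i + 1) := D.R_mono (Nat.le_succ i)
  have n1 := (h.toConflict.near hnet hAS).mono hle
  have n2 := (h.swap_index.near hnet hAS).mono hle
  -- The conflict does not persist at `i + 1`, so one of its far pairs has come within 17; with the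
  -- two short links the distances are at most `17 + 3 + 3 = 23`.
  by_cases f1 : Near (D.R (i + 1)) 17 u₁ w₁
  · exact ⟨(n2.trans f1.symm).mono_right (by norm_num),
      ((n2.trans f1.symm).trans n1).mono_right (by norm_num)⟩
  · by_cases f2 : Near (D.R (i + 1)) 17 u₂ w₂
    · exact ⟨(f2.trans n1.symm).mono_right (by norm_num), f2.mono_right (by norm_num)⟩
    · exact absurd hfar (Conflict.not_farDetermined
        (⟨h.type_u, h.type_w, f1, f2, h.adj⟩ : Conflict G σ.S (D.R (i + 1)) u₁ u₂ w₁ w₂))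

omit [Fintype V] in
/-- Adding a witness token to resolve a located conflict for which the reservoir is prepared. -/
theorem Inv.exists_witness (hinv : Inv D A m i σ) (hnet : IsNet D i (A i))
    (h : LocatedConflict D σ.S i σ.age u₁ u₂ w₁ w₂)
    (hK : (σ.age u₁, false) ∈ σ.K (σ.age u₂) ∨ (σ.age w₂, true) ∈ σ.K (σ.age u₂)) :
    ∃ σ' : TokenState V, Inv D A m i σ' ∧ σ.S ⊂ σ'.S := by
  classical
  have hAS : (↑(A i) : Set V) ⊆ σ.S := by exact_mod_cast hinv.net_sub
  obtain ⟨s, hsR, hsadj, hsfar⟩ := (hinv.prepared u₁ u₂ w₁ w₂ hK (h.swap_index.near hnet hAS)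
    (h.toConflict.near hnet hAS) h.adj).resolve_right (by
      rintro ⟨s, hs, hadj⟩
      exact hadj (atomicTypes_adj h.type_w hs))
  have hsS : s ∉ σ.S := fun hs => hsadj (atomicTypes_adj h.type_u hs)
  have hswt : s ∉ σ.wt := fun hs => hsS (hinv.wt_sub hs)
  have hne : ∀ {x}, x ∈ σ.wt → x ≠ s := fun hx hxs => hswt (hxs ▸ hx)
  have hord : ∀ {x}, x ∈ σ.wt → σ.ord x < σ.wt.sup σ.ord + 1 := fun hx =>
    Nat.lt_succ_of_le (Finset.le_sup (f := σ.ord) hx)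
  -- Old tokens do not separate `u₁` from `u₂`, whereas `s` does; agreeing with `s` at `u₂` means
  -- disagreeing at `u₁`. By `hcl`, homogeneity then forces nearness to `u₁`, from which `s` is far.
  have hold : ∀ t ∈ σ.wt, (G.Adj t u₂ ↔ G.Adj s u₂) → ¬ (G.Adj t u₁ ↔ G.Adj s u₁) :=
    fun t ht h1 h2 => hsadj (h2.symm.trans
      ((atomicTypes_adj h.type_u (by exact_mod_cast hinv.wt_sub ht)).trans h1))
  have hcl : ∀ t, D.P i t s → ¬ (G.Adj t u₁ ↔ G.Adj s u₁) → Near (D.R i) 1 t u₁ :=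
    fun t htP hta => by
      by_contra hn
      exact hta (D.homog i t s u₁ u₁ htP (Setoid.refl' _ _) hn
        (not_near_symm (not_near_of_le hsfar (by norm_num))))
  refine ⟨⟨insert s σ.S, insert s σ.wt, σ.ot, Function.update σ.b s u₂,
    Function.update σ.ord s (σ.wt.sup σ.ord + 1), σ.age, σ.Rs, σ.K, σ.W, σ.N⟩, ?_,
    Finset.ssubset_insert hsS⟩
  constructor
  · exact hinv.net_sub.trans (Finset.subset_insert _ _)
  · exact Finset.insert_subset_insert _ hinv.wt_sub
  · intro x hx
    rcases Finset.mem_insert.1 hx with rfl | hx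
    · simp
    · have := hinv.sub hx
      simp only [Finset.mem_union, Finset.mem_insert] at this ⊢
      tauto
  · exact hinv.age_iff
  · intro x hx y hy hxy
    dsimp only at hx hy hxy
    rcases Finset.mem_insert.1 hx with rfl | hx' <;> rcases Finset.mem_insert.1 hy with rfl | hy'
    · rfl
    · rw [Function.update_self, Function.update_of_ne (hne hy')] at hxy
      exact absurd (hord hy') (by omega)
    · rw [Function.update_self, Function.update_of_ne (hne hx')] at hxy
      exact absurd (hord hx') (by omega)
    · rw [Function.update_of_ne (hne hx'), Function.update_of_ne (hne hy')] at hxy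
      exact hinv.ord_inj x hx' y hy' hxy
  · exact hinv.age_lt
  · exact hinv.K_empty
  · intro a
    have h1 := hinv.mass_le a
    dsimp only
    by_cases hc : σ.age u₂ = a
    · refine (mass_insert_le hswt (c := 1) fun _ => le_rfl).trans ?_
      rw [← hc, Finset.insert_inter_of_mem hsR, Finset.card_insert_of_notMem
        fun hs => hsS (Finset.mem_inter.1 hs).1, hc]
      omega
    · refine (mass_insert_le hswt (c := 0) fun h => absurd h hc).trans (h1.trans ?_)
      exact Nat.add_le_add_left (Finset.card_le_card
        (Finset.inter_subset_inter_right (Finset.subset_insert _ _))) _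
  · exact hinv.Rs_card
  · exact hinv.K_sub
  · exact hinv.K_lt
  · exact hinv.W_card
  · exact hinv.W_mem
  · intro a₁ a₂ c₁ c₂ hk h1 h2 h3
    rcases hinv.prepared a₁ a₂ c₁ c₂ hk h1 h2 h3 with h4 | ⟨t, ht, h4⟩
    · exact Or.inl h4
    · exact Or.inr ⟨t, Finset.mem_insert_of_mem ht, h4⟩
  · intro x hx y hy hxy hP hadj
    dsimp only at hx hy hxy hadj
    rcases Finset.mem_insert.1 hx with rfl | hx' <;> rcases Finset.mem_insert.1 hy with rfl | hy'
    · exact absurd hxy (lt_irrefl _)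
    · rw [Function.update_self, Function.update_of_ne (hne hy')] at hxy
      exact absurd (hord hy') (by omega)
    · rw [Function.update_self] at hadj
      intro hn
      have := hcl x hP (hold x hx' hadj)
      exact hsfar ((this.symm.trans hn).mono_right (by norm_num))
    · rw [Function.update_of_ne (hne hx'), Function.update_of_ne (hne hy')] at hxy
      rw [Function.update_of_ne (hne hy')] at hadj
      exact hinv.two_tokens x hx' y hy' hxy hP hadj
  · intro x hx y hy z hz hxy hyz hPxy hPyz hadj h1 h2
    dsimp only at hx hy hz hxy hyz hadj h1 h2
    have hy' : y ∈ σ.wt := by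
      refine (Finset.mem_insert.1 hy).resolve_left ?_
      rintro rfl
      rcases Finset.mem_insert.1 hz with rfl | hz'
      · exact absurd hyz (lt_irrefl _)
      · rw [Function.update_self, Function.update_of_ne (hne hz')] at hyz
        exact absurd (hord hz') (by omega)
    have hx' : x ∈ σ.wt := by
      refine (Finset.mem_insert.1 hx).resolve_left ?_
      rintro rfl
      rw [Function.update_self, Function.update_of_ne (hne hy')] at hxy
      exact absurd (hord hy') (by omega)
    rw [Function.update_of_ne (hne hx'), Function.update_of_ne (hne hy')] at hxy
    rw [Function.update_of_ne (hne hy')] at hadj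
    rcases Finset.mem_insert.1 hz with rfl | hz'
    · rw [Function.update_self] at h1 h2
      -- Both older tokens are within 1 of `u₁`, hence within 2 of each other, against `two_tokens`.
      have n1 := hcl x ((D.P i).trans' hPxy hPyz) (hold x hx' h1)
      have n2 := hcl y hPyz (hold y hy' h2)
      exact hinv.two_tokens x hx' y hy' hxy hPxy hadj (n1.trans n2.symm)
    · rw [Function.update_of_ne (hne hz')] at h1 h2
      rw [Function.update_of_ne (hne hz'), Function.update_of_ne (hne hy')] at hyz
      exact hinv.three_tokens x hx' y hy' z hz' hxy hyz hPxy hPyz hadj h1 h2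

set_option maxHeartbeats 400000 in
/-- Preparing the reservoir for a located conflict. -/
theorem Inv.exists_prepare (hd : 1 ≤ vcDim G) (hi : i < D.L) (hρ : 26 ≤ ρ)
    (hinv : Inv D A (40 * vcDim G) i σ) (hnet : IsNet D i (A i))
    (hfar : FarDetermined G σ.S (D.R (i + 1)) Set.univ)
    (h : LocatedConflict D σ.S i σ.age u₁ u₂ w₁ w₂)
    (hK : ¬ ((σ.age u₁, false) ∈ σ.K (σ.age u₂) ∨ (σ.age w₂, true) ∈ σ.K (σ.age u₂))) :
    ∃ σ' : TokenState V, Inv D A (40 * vcDim G) i σ' ∧ σ.S ⊆ σ'.S ∧ σ'.age = σ.age ∧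
      ((σ'.age u₁, false) ∈ σ'.K (σ'.age u₂) ∨ (σ'.age w₂, true) ∈ σ'.K (σ'.age u₂)) := by
  classical
  have hAS : (↑(A i) : Set V) ⊆ σ.S := by exact_mod_cast hinv.net_sub
  have hle : D.R i ≤ D.R (i + 1) := D.R_mono (Nat.le_succ i)
  set z := σ.age u₂ with hz
  set Z : Finset V := Finset.univ.filter fun x => units D i u₂ x with hZ
  have hZmem : ∀ x, x ∈ Z ↔ σ.age x = z := fun x => by
    rw [hZ, Finset.mem_filter, hz, eq_comm, hinv.age_iff]; simp
  have hZnear : ∀ x ∈ Z, Near (D.R i) 3 w₁ x := fun x hx =>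
    h.near_late x (Finset.mem_filter.1 hx).2
  have hZP : ∀ x ∈ Z, ∀ y ∈ Z, D.P i x y := fun x hx y hy =>
    units_part hi.le ((hinv.age_iff x y).1 (((hZmem x).1 hx).trans ((hZmem y).1 hy).symm))
  obtain ⟨F, hFc, hF⟩ := exists_reservoir hd hi (by omega) Z w₁ hZnear
  -- `κ` records the early unit and whether it sits at `u₁` or `w₂`. Either way, closeness of the
  -- forbidden pairs would link `u₁` to `w₁` in at most 15 steps, below the 17 of the conflict.
  obtain ⟨κ, hκ, hκlt, hκprep⟩ : ∃ κ : ℕ × Bool,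
      (κ = (σ.age u₁, false) ∨ κ = (σ.age w₂, true)) ∧ κ.1 < z ∧
      ∀ a₁ a₂ c₁ c₂, κ = (σ.age a₁, false) ∨ κ = (σ.age c₂, true) → σ.age a₂ = z →
        Near (D.R i) 3 a₂ c₁ → Near (D.R i) 3 a₁ c₂ →
        (∀ x y, y ∈ Z → Near (D.R i) 3 y x → ¬ Near (D.R i) 3 a₁ x) ∧
        ∀ x ∈ Z, ¬ Near (D.R i) 1 x c₂ := by
    rcases h.near_early with ⟨hlt, hne⟩ | ⟨hlt, hne⟩
    · refine ⟨(σ.age u₁, false), Or.inl rfl, hlt, ?_⟩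
      intro a₁ a₂ c₁ c₂ hk h1 h2 h3
      have hk : σ.age u₁ = σ.age a₁ := by simpa using hk
      have n1 := hne a₁ ((hinv.age_iff _ _).1 hk)
      have n0 := h.toConflict.near hnet hAS
      refine ⟨fun x y hy hyx hax => h.far₁ ?_, fun x hx hxc => h.far₁ ?_⟩
      · exact ((((n0.trans n1).trans hax).trans hyx.symm).trans (hZnear y hy).symm).mono_right
          (by norm_num)
      · exact ((((n0.trans n1).trans h3).trans hxc.symm).trans (hZnear x hx).symm).mono_right
          (by norm_num)
    · refine ⟨(σ.age w₂, true), Or.inr rfl, hlt, ?_⟩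
      intro a₁ a₂ c₁ c₂ hk h1 h2 h3
      have hk : σ.age w₂ = σ.age c₂ := by simpa using hk
      have n1 := hne c₂ ((hinv.age_iff _ _).1 hk)
      refine ⟨fun x y hy hyx hax => h.far₁ ?_, fun x hx hxc => h.far₁ ?_⟩
      · exact ((((n1.trans h3.symm).trans hax).trans hyx.symm).trans (hZnear y hy).symm).mono_right
          (by norm_num)
      · exact ((n1.trans hxc.symm).trans (hZnear x hx).symm).mono_right (by norm_num)
  have hκK : κ ∉ σ.K z := by
    rcases hκ with rfl | rfl
    · exact fun hk => hK (Or.inl hk)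
    · exact fun hk => hK (Or.inr hk)
  -- Radius 26 is the 23 of `near_succ` plus 3 from `w₁` to the late unit.
  set Wz : Finset ℕ := if (σ.K z).Nonempty then σ.W z else
    (Finset.univ.filter fun x => Near (D.R (i + 1)) 26 w₁ x).image σ.age with hWz
  have hWmem : ∀ u v, σ.age u = z → σ.age v < z → Near (D.R (i + 1)) 23 u v → σ.age v ∈ Wz := by
    intro u v hu hv hn
    rw [hWz]
    split_ifs with hne
    · have := hinv.W_mem u v (by rwa [hu]) (by rwa [hu]) hn
      rwa [hu] at this
    · exact Finset.mem_image_of_mem _ (Finset.mem_filter.2 ⟨Finset.mem_univ _,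
        ((hZnear u ((hZmem u).2 hu)).mono hle).trans_le hn (by norm_num)⟩)
  have hκW : κ.1 ∈ Wz := by
    have hns := h.near_succ hnet hinv hfar
    rcases hκ with rfl | rfl
    · exact hWmem u₂ u₁ rfl hκlt hns.1
    · exact hWmem u₂ w₂ rfl hκlt hns.2
  refine ⟨⟨σ.S ∪ (F ∩ Z), σ.wt, σ.ot ∪ ((F ∩ Z) \ σ.S), σ.b, σ.ord, σ.age,
    Function.update σ.Rs z (σ.Rs z ∪ F), Function.update σ.K z (insert κ (σ.K z)),
    Function.update σ.W z Wz, σ.N⟩, ?_, Finset.subset_union_left, rfl, ?_⟩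
  swap
  · dsimp only
    rw [← hz, Function.update_self]
    rcases hκ with rfl | rfl
    · exact Or.inl (Finset.mem_insert_self _ _)
    · exact Or.inr (Finset.mem_insert_self _ _)
  constructor
  · exact hinv.net_sub.trans Finset.subset_union_left
  · exact hinv.wt_sub.trans Finset.subset_union_left
  · intro x hx
    by_cases hxS : x ∈ σ.S
    · have := hinv.sub hxS
      simp only [Finset.mem_union] at this ⊢
      tauto
    · have := (Finset.mem_union.1 hx).resolve_left hxS
      exact Finset.mem_union_right _ (Finset.mem_union_right _ (Finset.mem_sdiff.2 ⟨this, hxS⟩))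
  · exact hinv.age_iff
  · exact hinv.ord_inj
  · exact hinv.age_lt
  · intro y hy
    have : y ≠ z := by
      rintro rfl
      exact absurd (hinv.age_lt u₂) (not_lt.2 hy)
    dsimp only
    rw [Function.update_of_ne this]
    exact hinv.K_empty y hy
  · intro a
    dsimp only
    by_cases ha : a = z
    · subst ha
      refine (mass_union_le (Y := (F ∩ Z) \ σ.S) fun x hx _ => hx).trans
        ((Nat.add_le_add_right (hinv.mass_le _) _).trans ?_)
      rw [Function.update_self, add_assoc, ← Finset.card_union_of_disjoint]
      · refine Nat.add_le_add_left (Finset.card_le_card fun x hx => ?_) _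
        rcases Finset.mem_union.1 hx with hx | hx
        · obtain ⟨h1, h2⟩ := Finset.mem_inter.1 hx
          exact Finset.mem_inter.2 ⟨Finset.mem_union_left _ h1, Finset.mem_union_left _ h2⟩
        · obtain ⟨h1, _⟩ := Finset.mem_sdiff.1 hx
          exact Finset.mem_inter.2 ⟨Finset.mem_union_right _ h1,
            Finset.mem_union_right _ (Finset.mem_inter.1 h1).1⟩
      · rw [Finset.disjoint_left]
        intro x hx hx'
        exact (Finset.mem_sdiff.1 hx').2 (Finset.mem_inter.1 hx).1
    · rw [Function.update_of_ne ha]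
      refine (mass_union_le (Y := ∅) fun x hx hxa => absurd ?_ ha).trans
        ((Nat.add_le_add_right (hinv.mass_le _) _).trans ?_)
      · rw [← hxa]
        exact (hZmem x).1 (Finset.mem_inter.1 (Finset.mem_sdiff.1 hx).1).2
      · rw [Finset.card_empty, add_zero]
        exact Nat.add_le_add_left (Finset.card_le_card
          (Finset.inter_subset_inter_right Finset.subset_union_left)) _
  · intro a
    dsimp only
    by_cases ha : a = z
    · subst ha
      rw [Function.update_self, Function.update_self, Finset.card_insert_of_notMem hκK, mul_add,
        mul_one]
      exact (Finset.card_union_le _ _).trans (Nat.add_le_add (hinv.Rs_card _) hFc)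
    · rw [Function.update_of_ne ha, Function.update_of_ne ha]
      exact hinv.Rs_card a
  · intro a
    dsimp only
    by_cases ha : a = z
    · subst ha
      rw [Function.update_self, Function.update_self]
      intro x hx
      rw [Finset.mem_product]
      refine ⟨?_, Finset.mem_univ _⟩
      rcases Finset.mem_insert.1 hx with rfl | hx
      · exact hκW
      · rw [hWz, if_pos ⟨x, hx⟩]
        exact (Finset.mem_product.1 (hinv.K_sub _ hx)).1
    · rw [Function.update_of_ne ha, Function.update_of_ne ha]
      exact hinv.K_sub a
  · intro a
    dsimp only
    by_cases ha : a = z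
    · subst ha
      rw [Function.update_self]
      intro x hx
      rcases Finset.mem_insert.1 hx with rfl | hx
      · exact hκlt
      · exact hinv.K_lt _ x hx
    · rw [Function.update_of_ne ha]
      exact hinv.K_lt a
  · intro a
    dsimp only
    by_cases ha : a = z
    · subst ha
      rw [Function.update_self, hWz]
      split_ifs
      · exact hinv.W_card _
      · exact card_ages_le hinv.age_iff hi hρ w₁
    · rw [Function.update_of_ne ha]
      exact hinv.W_card a
  · intro u v hne hlt hn
    dsimp only at hne hlt ⊢
    by_cases ha : σ.age u = z
    · rw [ha, Function.update_self]
      exact hWmem u v ha (by rwa [ha] at hlt) hn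
    · rw [Function.update_of_ne ha] at hne ⊢
      exact hinv.W_mem u v hne hlt hn
  · intro a₁ a₂ c₁ c₂ hk h1 h2 h3
    dsimp only at hk ⊢
    have hlift : (∃ s ∈ σ.Rs (σ.age a₂), ¬ (G.Adj s a₁ ↔ G.Adj s a₂) ∧ ¬ Near (D.R i) 3 a₁ s) ∨
        (∃ s ∈ σ.S, ¬ (G.Adj s c₁ ↔ G.Adj s c₂)) →
        (∃ s ∈ Function.update σ.Rs z (σ.Rs z ∪ F) (σ.age a₂),
          ¬ (G.Adj s a₁ ↔ G.Adj s a₂) ∧ ¬ Near (D.R i) 3 a₁ s) ∨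
        ∃ s ∈ σ.S ∪ F ∩ Z, ¬ (G.Adj s c₁ ↔ G.Adj s c₂) := by
      rintro (⟨s, hs, hs'⟩ | ⟨s, hs, hs'⟩)
      · refine Or.inl ⟨s, ?_, hs'⟩
        by_cases ha : σ.age a₂ = z
        · rw [ha] at hs ⊢
          rw [Function.update_self]
          exact Finset.mem_union_left _ hs
        · rwa [Function.update_of_ne ha]
      · exact Or.inr ⟨s, Finset.mem_union_left _ hs, hs'⟩
    by_cases ha : σ.age a₂ = z
    swap
    · rw [Function.update_of_ne ha] at hk
      exact hlift (hinv.prepared a₁ a₂ c₁ c₂ hk h1 h2 h3)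
    rw [ha, Function.update_self] at hk
    by_cases hold : (σ.age a₁, false) ∈ σ.K z ∨ (σ.age c₂, true) ∈ σ.K z
    · exact hlift (hinv.prepared a₁ a₂ c₁ c₂ (by rwa [ha]) h1 h2 h3)
    have hκ' : κ = (σ.age a₁, false) ∨ κ = (σ.age c₂, true) := by
      rcases hk with hk | hk
      · exact Or.inl ((Finset.mem_insert.1 hk).resolve_right fun h => hold (Or.inl h)).symm
      · exact Or.inr ((Finset.mem_insert.1 hk).resolve_right fun h => hold (Or.inr h)).symm
    obtain ⟨p1, p2⟩ := hκprep a₁ a₂ c₁ c₂ hκ' ha h1 h2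
    have ha₂ : a₂ ∈ Z := (hZmem a₂).2 ha
    -- Used with the adjacency value of `a₂ c₂`. Outside the unit, `s` has this value at `a₂` but,
    -- by homogeneity with `c₁`, the opposite one at `a₁`. Inside the unit, `s` has it at `c₂` but
    -- not at `c₁`.
    rcases hF c₁ ⟨a₂, ha₂, h1⟩ (G.Adj a₂ c₂) with ⟨T, hTF, hT, hTZ⟩ | ⟨s, hs, hsc⟩
    · left
      obtain ⟨s, hs, hsa⟩ := hTZ a₂ ha₂
      obtain ⟨hsP, y, hy, hys⟩ := hT s hs
      refine ⟨s, ?_, ?_, p1 s y hy hys⟩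
      · rw [ha, Function.update_self]
        exact Finset.mem_union_right _ (hTF hs)
      · have h4 : G.Adj a₁ c₁ ↔ G.Adj a₁ s := D.homog i a₁ a₁ c₁ s (Setoid.refl' _ _) hsP
          (not_near_of_le (p1 c₁ a₂ ha₂ h1) (by norm_num))
          (not_near_of_le (p1 s y hy hys) (by norm_num))
        rw [G.adj_comm s a₁, hsa, ← h4]
        exact h3
    · right
      have hsZ := (Finset.mem_inter.1 hs).2
      refine ⟨s, Finset.mem_union_right _ hs, ?_⟩
      have h4 : G.Adj s c₂ ↔ G.Adj a₂ c₂ := D.homog i s a₂ c₂ c₂ (hZP s hsZ a₂ ha₂)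
        (Setoid.refl' _ _) (p2 s hsZ) (p2 a₂ ha₂)
      rw [hsc, h4]
      exact not_iff_self
  · exact hinv.two_tokens
  · exact hinv.three_tokens

/-- One step of the construction. -/
theorem Inv.exists_move (hd : 1 ≤ vcDim G) (hi : i < D.L) (hρ : 26 ≤ ρ)
    (hinv : Inv D A (40 * vcDim G) i σ) (hnet : IsNet D i (A i))
    (hfar : FarDetermined G σ.S (D.R (i + 1)) Set.univ)
    (hnot : ¬ FarDetermined G σ.S (D.R i) Set.univ) :
    ∃ σ' : TokenState V, Inv D A (40 * vcDim G) i σ' ∧ σ.S ⊂ σ'.S := by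
  have hAS : (↑(A i) : Set V) ⊆ σ.S := by exact_mod_cast hinv.net_sub
  obtain ⟨_, _, _, _, hc⟩ := exists_conflict hnot
  obtain ⟨u₁, u₂, w₁, w₂, h⟩ := hc.exists_located hnet hAS hi.le hinv.age_iff
  by_cases hK : (σ.age u₁, false) ∈ σ.K (σ.age u₂) ∨ (σ.age w₂, true) ∈ σ.K (σ.age u₂)
  · exact hinv.exists_witness hnet h hK
  · obtain ⟨σ', hinv', hsub, hage, hK'⟩ := hinv.exists_prepare hd hi hρ hnet hfar h hK
    -- If preparation adds nothing to `S`, the conflict is still present and a witness token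
    -- enlarges `S`.
    rcases hsub.eq_or_ssubset with heq | hss
    · have h' : LocatedConflict D σ'.S i σ'.age u₁ u₂ w₁ w₂ := by rw [← heq, hage]; exact h
      obtain ⟨σ'', h1, h2⟩ := hinv'.exists_witness hnet h' hK'
      exact ⟨σ'', h1, by rwa [heq]⟩
    · exact ⟨σ', hinv', hss⟩

theorem Inv.exists_farDetermined (hd : 1 ≤ vcDim G) (hi : i < D.L) (hρ : 26 ≤ ρ)
    (hinv : Inv D A (40 * vcDim G) i σ) (hnet : IsNet D i (A i))
    (hfar : FarDetermined G σ.S (D.R (i + 1)) Set.univ) :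
    ∃ σ' : TokenState V, Inv D A (40 * vcDim G) i σ' ∧ σ.S ⊆ σ'.S ∧
      FarDetermined G σ'.S (D.R i) Set.univ := by
  induction hn : Fintype.card V - σ.S.card using Nat.strong_induction_on generalizing σ with
  | _ n ih =>
    by_cases hF : FarDetermined G σ.S (D.R i) Set.univ
    · exact ⟨σ, hinv, subset_rfl, hF⟩
    · obtain ⟨σ', h1, h2⟩ := hinv.exists_move hd hi hρ hnet hfar hF
      have hlt := Finset.card_lt_card h2
      have hle := Finset.card_le_univ σ'.S
      obtain ⟨σ'', h3, h4, h5⟩ := ih (Fintype.card V - σ'.S.card) (by omega) h1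
        (hfar.mono (by exact_mod_cast h2.subset)) rfl
      exact ⟨σ'', h3, h2.subset.trans h4, h5⟩

end Moves

/-! ### Passing to a finer partition and building the chain -/

section Descend

variable {V : Type*} [Fintype V] {G : SimpleGraph V} {k ρ i m : ℕ} {D : Decomposition G k ρ}
  {A : ℕ → Finset V} {σ : TokenState V}

theorem exists_label (Q : Setoid V) : ∃ f : V → ℕ, ∀ u v, f u = f v ↔ Q u v := by
  obtain ⟨n, ⟨e⟩⟩ := Finite.exists_equiv_fin (Quotient Q)
  refine ⟨fun v => e ⟦v⟧, fun u v => ?_⟩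
  rw [Fin.val_inj, e.apply_eq_iff_eq, Quotient.eq]

/-- Passing from index `i + 1` to index `i`: every unit hands its label down to one of its parts. -/
theorem Inv.exists_descend (hinv : Inv D A m (i + 1) σ) (hA : A (i + 1) ⊆ A i) :
    ∃ σ' : TokenState V, Inv D A m i σ' ∧ σ.S ⊆ σ'.S := by
  classical
  have hle : i ≤ i + 1 := Nat.le_succ i
  obtain ⟨lab, hlab⟩ := exists_label (units D i)
  let μ : V → ℕ := fun v => mass σ.ot σ.wt σ.b (units D i v)
  have hheir : ∀ a : ℕ, ∃ h : Option V, ∀ v, σ.age v = a → ∃ w, h = some w ∧ σ.age w = a ∧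
      μ v ≤ μ w := by
    intro a
    rcases (Finset.univ.filter fun v => σ.age v = a).eq_empty_or_nonempty with he | hne
    · refine ⟨none, fun v hv => absurd hv ?_⟩
      exact Finset.filter_eq_empty_iff.1 he (Finset.mem_univ v)
    · obtain ⟨w, hw, hmax⟩ := Finset.exists_max_image _ μ hne
      exact ⟨some w, fun v hv => ⟨w, rfl, (Finset.mem_filter.1 hw).2,
        hmax v (Finset.mem_filter.2 ⟨Finset.mem_univ v, hv⟩)⟩⟩
  choose heir hheir using hheir
  -- The heaviest subunit inherits the label; the others get labels from `σ.N` on, whose `K` is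
  -- empty.
  let old : V → Prop := fun v => ∃ w, heir (σ.age v) = some w ∧ units D i w v
  let age' : V → ℕ := fun v => if old v then σ.age v else σ.N + lab v
  have hage_old : ∀ v, age' v < σ.N → old v ∧ age' v = σ.age v := by
    intro v hv
    by_cases h : old v
    · exact ⟨h, if_pos h⟩
    · simp only [age', if_neg h] at hv; omega
  have hold_lt : ∀ v, old v → age' v < σ.N := fun v hv => by
    simp only [age', if_pos hv]
    exact hinv.age_lt v
  have hage' : ∀ u v, age' u = age' v ↔ units D i u v := by
    intro u v
    constructor
    · intro h
      by_cases hu : old u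
      · have h1 := hold_lt u hu
        obtain ⟨hv, h2⟩ := hage_old v (h ▸ h1)
        obtain ⟨_, h3⟩ := hage_old u h1
        obtain ⟨w, hw, hwu⟩ := hu
        obtain ⟨w', hw', hwv⟩ := hv
        rw [← h3, h, h2, hw'] at hw
        cases hw
        exact (units D i).trans' ((units D i).symm' hwu) hwv
      · by_cases hv : old v
        · exact absurd (hage_old u (h ▸ hold_lt v hv)).1 hu
        · simp only [age', if_neg hu, if_neg hv] at h
          exact (hlab u v).1 (by omega)
    · intro h
      have h1 : σ.age u = σ.age v := (hinv.age_iff u v).2 (units_mono hle h)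
      have h2 : old u ↔ old v := by
        constructor
        · rintro ⟨w, hw, hwu⟩; exact ⟨w, h1 ▸ hw, (units D i).trans' hwu h⟩
        · rintro ⟨w, hw, hwu⟩; exact ⟨w, h1 ▸ hw, (units D i).trans' hwu ((units D i).symm' h)⟩
      simp only [age', h1, h2, (hlab u v).2 h]
  refine ⟨⟨σ.S ∪ A i, σ.wt, σ.ot, σ.b, σ.ord, age', σ.Rs, σ.K, σ.W,
    σ.N + Finset.univ.sup age' + 1⟩, ?_, Finset.subset_union_left⟩
  have hK : ∀ u, (σ.K (age' u)).Nonempty → age' u < σ.N := fun u hu => by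
    by_contra hc
    rw [hinv.K_empty _ (not_lt.1 hc)] at hu
    exact Finset.not_nonempty_empty hu
  constructor
  · exact Finset.subset_union_right
  · exact hinv.wt_sub.trans Finset.subset_union_left
  · intro x hx
    rcases Finset.mem_union.1 hx with hx | hx
    · have := hinv.sub hx
      simp only [Finset.mem_union] at this ⊢
      rcases this with (h | h) | h
      · exact Or.inl (Or.inl (hA h))
      · exact Or.inl (Or.inr h)
      · exact Or.inr h
    · exact Finset.mem_union_left _ (Finset.mem_union_left _ hx)
  · exact hage'
  · exact hinv.ord_inj
  · intro v
    have := Finset.le_sup (f := age') (Finset.mem_univ v)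
    dsimp only
    omega
  · intro z hz
    exact hinv.K_empty z (by dsimp only at hz; omega)
  · intro a
    dsimp only
    have hS : (σ.S ∩ σ.Rs a).card ≤ ((σ.S ∪ A i) ∩ σ.Rs a).card :=
      Finset.card_le_card (Finset.inter_subset_inter_right Finset.subset_union_left)
    by_cases ha : a < σ.N
    · refine (mass_mono fun x hx => ?_).trans ((hinv.mass_le a).trans (Nat.add_le_add_left hS _))
      rw [← hx]
      exact (hage_old x (by rw [hx]; exact ha)).2.symm
    · by_cases hex : ∃ v, age' v = a
      swap
      · rw [mass_eq_zero fun x hx => hex ⟨x, hx⟩]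
        exact Nat.zero_le _
      obtain ⟨v, hv⟩ := hex
      have hv_old : ¬ old v := fun h => ha (hv ▸ hold_lt v h)
      obtain ⟨w, hw, hwa, hmax⟩ := hheir (σ.age v) v rfl
      have hvw : ¬ units D i w v := fun h => hv_old ⟨w, hw, h⟩
      have h1 : mass σ.ot σ.wt σ.b (fun x => age' x = a) ≤ μ v :=
        mass_mono fun x hx => (hage' v x).1 (hv.trans hx.symm)
      have hunit : ∀ y x, σ.age y = σ.age v → units D i y x → σ.age x = σ.age v :=
        fun y x hy hx => by rw [← hy]; exact ((hinv.age_iff y x).2 (units_mono hle hx)).symm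
      -- A fresh subunit is disjoint from an heir at least as heavy, so it has at most half of the
      -- mass bound, which is the starting credit.
      have h2 : μ v + μ w ≤ mass σ.ot σ.wt σ.b (fun x => σ.age x = σ.age v) :=
        mass_add_le (fun x hx hx' => hvw ((units D i).trans' hx' ((units D i).symm' hx)))
          (fun x hx => hunit v x rfl hx) (fun x hx => hunit w x hwa hx)
      have h3 := hinv.mass_le_two (σ.age v)
      omega
  · exact hinv.Rs_card
  · exact hinv.K_sub
  · exact hinv.K_lt
  · exact hinv.W_card
  · intro u v hne hlt hn
    dsimp only at hne hlt ⊢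
    have h1 := hK u hne
    have h2 := hlt.trans h1
    rw [(hage_old v h2).2] at hlt ⊢
    rw [(hage_old u h1).2] at hne hlt ⊢
    exact hinv.W_mem u v hne hlt (hn.mono (D.R_mono (by omega)))
  · intro u₁ u₂ w₁ w₂ hk h1 h2 h3
    dsimp only at hk ⊢
    have h4 : age' u₂ < σ.N := hK u₂ (by
      rcases hk with hk | hk <;> exact ⟨_, hk⟩)
    have hkey : ∀ (v : V) (τ : Bool), (age' v, τ) ∈ σ.K (age' u₂) →
        (σ.age v, τ) ∈ σ.K (σ.age u₂) := by
      intro v τ hv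
      have hlt : age' v < σ.N := (hinv.K_lt _ _ hv).trans h4
      rwa [(hage_old u₂ h4).2, (hage_old v hlt).2] at hv
    have hR : D.R i ≤ D.R (i + 1) := D.R_mono hle
    rcases hinv.prepared u₁ u₂ w₁ w₂ (hk.imp (hkey u₁ false) (hkey w₂ true)) (h1.mono hR)
      (h2.mono hR) h3 with ⟨s, hs, hs1, hs2⟩ | ⟨s, hs, hs1⟩
    · left
      rw [(hage_old u₂ h4).2]
      exact ⟨s, hs, hs1, fun h => hs2 (h.mono hR)⟩
    · exact Or.inr ⟨s, Finset.mem_union_left _ hs, hs1⟩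
  · intro s hs t ht hst hP hadj hn
    exact hinv.two_tokens s hs t ht hst (D.P_mono hle hP) hadj (hn.mono (D.R_mono hle))
  · intro s hs t ht u hu hst htu hP hP' 
    exact hinv.three_tokens s hs t ht u hu hst htu (D.P_mono hle hP) (D.P_mono hle hP')

theorem exists_inv_last {A : ℕ → Finset V} :
    ∃ σ : TokenState V, Inv D A m D.L σ ∧ σ.S = A D.L ∧
      FarDetermined G σ.S (D.R D.L) Set.univ := by
  classical
  obtain ⟨age, hage⟩ := exists_label (units D D.L)
  refine ⟨⟨A D.L, ∅, ∅, id, fun _ => 0, age, fun _ => ∅, fun _ => ∅, fun _ => ∅,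
    Finset.univ.sup age + 1⟩, ?_, rfl, ?_⟩
  · constructor
    · exact subset_rfl
    · exact Finset.empty_subset _
    · exact fun x hx => Finset.mem_union_left _ (Finset.mem_union_left _ hx)
    · exact hage
    · simp
    · exact fun v => Nat.lt_succ_of_le (Finset.le_sup (f := age) (Finset.mem_univ v))
    · simp
    · intro a
      simp [mass]
    · simp
    · simp
    · simp
    · simp
    · simp
    · simp
    · simp
    · simp
  · intro u₁ u₂ w₁ w₂ _ _ h1 h2 _ _ hadj
    exact (D.homog D.L _ _ _ _ (D.P_last u₁ u₂) (D.P_last w₁ w₂)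
      (not_near_of_le h1 (by norm_num)) (not_near_of_le h2 (by norm_num))).1 hadj

/-- The sets `S i` constructed from a decomposition. -/
structure IsChain (D : Decomposition G k ρ) (S : ℕ → Finset V) : Prop where
  anti : ∀ i < D.L, S (i + 1) ⊆ S i
  zero : S 0 = Finset.univ
  last : (S D.L).card ≤ 3

theorem IsNet.eq_univ {B : Finset V} (h : IsNet D 0 B) : B = Finset.univ := by
  refine Finset.eq_univ_of_forall fun v => ?_
  rcases h.rep v with ⟨s, hs, hP, _⟩ | ⟨s₁, _, s₂, _, s₃, _, h1, h2, _, h3, _⟩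
  · rwa [D.P_zero _ _ hP]
  · rw [← D.P_zero _ _ h1, ← D.P_zero _ _ h2] at h3
    exact absurd (Near.refl _ _ _) h3

theorem exists_chain_near (hd : 1 ≤ vcDim G) (hρ : 26 ≤ ρ) (D : Decomposition G k ρ) :
    ∃ S : ℕ → Finset V, IsChain D S ∧
      (∀ i < D.L, FarDetermined G (S (i + 1)) (D.R (i + 1)) Set.univ) ∧
      ∀ i < D.L, ∀ t, t + 1 ≤ ρ → ∀ v, (open Classical in
        (S i).filter fun x => Near (D.R (i + 1)) t v x).card ≤
        k * 3 + k * 2 + 2 * k * (2 * (4 * k * (2 * k * (40 * vcDim G)))) := by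
  classical
  obtain ⟨A, hA, hnet⟩ := exists_nets D
  let Q : ℕ → TokenState V → Prop := fun i σ => Inv D A (40 * vcDim G) i σ ∧
    FarDetermined G σ.S (D.R i) Set.univ
  obtain ⟨σ₀, h1, h2, h3⟩ := exists_inv_last (D := D) (A := A) (m := 40 * vcDim G)
  have hstep : ∀ n, ∀ x : {σ // Q (D.L - n) σ}, ∃ y : {σ // Q (D.L - (n + 1)) σ},
      x.1.S ⊆ y.1.S := by
    rintro n ⟨σ, hσ1, hσ2⟩
    by_cases hn : n < D.L
    · have hi : D.L - n = D.L - (n + 1) + 1 := by omega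
      rw [hi] at hσ1 hσ2
      obtain ⟨σ', h1, h2⟩ := hσ1.exists_descend (hA _ (by omega))
      obtain ⟨σ'', h3, h4, h5⟩ := h1.exists_farDetermined hd (by omega) (by omega)
        (hnet _ (by omega)) (hσ2.mono (by exact_mod_cast h2))
      exact ⟨⟨σ'', h3, h5⟩, h2.trans h4⟩
    · have hi : D.L - n = D.L - (n + 1) := by omega
      rw [hi] at hσ1 hσ2
      exact ⟨⟨σ, hσ1, hσ2⟩, subset_rfl⟩
  choose next hnext using hstep
  let T : ∀ n : ℕ, {σ // Q (D.L - n) σ} := fun n => Nat.rec ⟨σ₀, h1, h3⟩ next n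
  have hT : ∀ n, (T n).1.S ⊆ (T (n + 1)).1.S := fun n => hnext n (T n)
  have hQ : ∀ i ≤ D.L, Q i (T (D.L - i)).1 := fun i hi => by
    have h1 : ∀ j, D.L - j = i → Q i (T j).1 := fun j hj => hj ▸ (T j).2
    exact h1 _ (by omega)
  refine ⟨fun i => (T (D.L - i)).1.S, ⟨fun i hi => ?_, ?_, ?_⟩, fun i hi => (hQ (i + 1) hi).2,
    fun i hi t ht v => ?_⟩
  · have : D.L - i = (D.L - (i + 1)) + 1 := by omega
    rw [this]
    exact hT _
  · have h4 := (hQ 0 (Nat.zero_le _)).1.net_sub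
    rw [(hnet 0 (Nat.zero_le _)).eq_univ] at h4
    exact Finset.univ_subset_iff.1 h4
  · rw [Nat.sub_self]
    change σ₀.S.card ≤ 3
    rw [h2]
    exact (hnet D.L le_rfl).card_le _ subset_rfl fun x _ y _ => D.P_last x y
  · exact (hQ i hi.le).1.card_ball_le (hnet i hi.le).toIsPreNet hi ht v

/-- The nets alone suffice when only the edges at one vertex `v` need to be short. -/
theorem exists_chain_singleton (D : Decomposition G k ρ) :
    ∃ S : ℕ → Finset V, IsChain D S ∧
      (∀ i < D.L, ∀ v, FarDetermined G (S (i + 1)) (D.R (i + 1)) {v}) ∧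
      ∀ i < D.L, ∀ t ≤ ρ, ∀ v, (open Classical in
        (S i).filter fun x => Near (D.R (i + 1)) t v x).card ≤ k * 3 := by
  classical
  obtain ⟨A, hA, hnet⟩ := exists_nets D
  refine ⟨A, ⟨hA, (hnet 0 (Nat.zero_le _)).eq_univ, ?_⟩,
    fun i hi v => (hnet (i + 1) hi).farDetermined_singleton subset_rfl v, fun i hi t ht v => ?_⟩
  · exact (hnet D.L le_rfl).card_le _ subset_rfl fun x _ y _ => D.P_last x y
  · obtain ⟨T, hT, hcov⟩ := D.width i hi v
    refine card_le_of_cover (Q := D.P i) hT (fun x hx => hcov x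
      ((Finset.mem_filter.1 hx).2.mono_right ht)) fun t _ A' hA' hP => ?_
    exact (hnet i hi.le).card_le A' (hA'.trans (Finset.filter_subset _ _)) fun x hx y hy =>
      (D.P i).trans' ((D.P i).symm' (hP x hx)) (hP y hy)

end Descend

/-! ### Counting atomic types -/

section Count

variable {V : Type*} [Fintype V] {G : SimpleGraph V} {k M : ℕ}

theorem ncard_image_le_ncard_image {α β γ : Type*} {E : Set α} {f : α → β} {g : α → γ}
    (hE : (f '' E).Finite) (h : ∀ x ∈ E, ∀ y ∈ E, f x = f y → g x = g y) :
    (g '' E).ncard ≤ (f '' E).ncard := by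
  rcases E.eq_empty_or_nonempty with rfl | ⟨a, -⟩
  · simp
  have : Nonempty α := ⟨a⟩
  choose! φ hφ using fun (c : β) (hc : c ∈ f '' E) => hc
  have : g '' E ⊆ (fun c => g (φ c)) '' (f '' E) := by
    rintro _ ⟨x, hx, rfl⟩
    have hc : f x ∈ f '' E := ⟨x, hx, rfl⟩
    exact ⟨f x, hc, h _ (hφ _ hc).1 _ hx (hφ _ hc).2⟩
  exact (Set.ncard_le_ncard this (hE.image _)).trans (Set.ncard_image_le hE)

omit [Fintype V] in
theorem quotientSet_eq_image (B : Set V) (Q : Setoid V) :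
    quotientSet B Q = (fun x => {y | Q y x}) '' B := by
  ext X
  constructor
  · rintro ⟨⟨y, rfl⟩, x, hx, hxB⟩
    refine ⟨x, hxB, ?_⟩
    ext z
    exact ⟨fun hz => Q.trans' hz hx, fun hz => Q.trans' hz (Q.symm' hx)⟩
  · rintro ⟨x, hx, rfl⟩
    exact ⟨Setoid.mem_classes Q x, x, Q.refl' x, hx⟩

theorem ncard_quotientSet_mono {B B' : Set V} (h : B ⊆ B') (Q : Setoid V) :
    (quotientSet B Q).ncard ≤ (quotientSet B' Q).ncard :=
  Set.ncard_le_ncard (fun _ hX => ⟨hX.1, hX.2.mono (Set.inter_subset_inter_right _ h)⟩)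
    (Set.toFinite _)

theorem ncard_quotientSet_le_one {B : Set V} {Q : Setoid V} (h : ∀ x ∈ B, ∀ y ∈ B, Q x y) :
    (quotientSet B Q).ncard ≤ 1 := by
  rw [quotientSet_eq_image, Set.ncard_le_one_iff]
  rintro _ _ ⟨x, hx, rfl⟩ ⟨y, hy, rfl⟩
  ext z
  exact ⟨fun hz => Q.trans' hz (h x hx y hy), fun hz => Q.trans' hz (h y hy x hx)⟩

/-- The number of atomic types over `S` that meet `B`, if on each of `k` pieces of `B` they are
determined by the neighbourhoods in a subset `Y` of `S`. -/
theorem ncard_quotientSet_le {S B : Set V} {Y T : Finset V} {Q : V → V → Prop}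
    (hBY : ∀ x ∈ B, x ∈ S → x ∈ Y) (hY : Y.card ≤ M) (hT : T.card ≤ k)
    (hcov : ∀ x ∈ B, ∃ t ∈ T, Q t x)
    (hQ : ∀ t ∈ T, ∀ x ∈ B, ∀ x' ∈ B, Q t x → Q t x' → ∀ s ∈ S, s ∉ Y →
      (G.Adj s x ↔ G.Adj s x')) :
    (quotientSet B (atomicTypes G S)).ncard ≤ M + k * nbhdComplexity G M := by
  classical
  rw [quotientSet_eq_image]
  set F : V → Set V := fun x => {y | atomicTypes G S y x} with hF
  have hsub : F '' B ⊆ F '' ↑Y ∪ ⋃ t ∈ T, F '' {x | x ∈ B ∧ x ∉ S ∧ Q t x} := by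
    rintro _ ⟨x, hx, rfl⟩
    by_cases hxS : x ∈ S
    · exact Or.inl ⟨x, hBY x hx hxS, rfl⟩
    · obtain ⟨t, ht, h⟩ := hcov x hx
      exact Or.inr (Set.mem_biUnion ht ⟨x, ⟨hx, hxS, h⟩, rfl⟩)
  refine (Set.ncard_le_ncard hsub (Set.toFinite _)).trans ((Set.ncard_union_le _ _).trans ?_)
  refine Nat.add_le_add ?_ ?_
  · exact (Set.ncard_image_le (Finset.finite_toSet Y)).trans ((Set.ncard_coe_finset Y).trans_le hY)
  · refine (Finset.set_ncard_biUnion_le T _).trans ((Finset.sum_le_card_nsmul _ _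
      (nbhdComplexity G M) fun t ht => ?_).trans (Nat.mul_le_mul_right _ hT))
    refine (ncard_image_le_ncard_image (f := fun v => nbhd G v ∩ Y) (Set.toFinite _) ?_).trans ?_
    · rintro x ⟨hxB, hxS, hxQ⟩ y ⟨hyB, hyS, hyQ⟩ hxy
      have hxy' : atomicTypes G S x y := by
        refine atomicTypes_iff.2 (Or.inr ⟨hxS, hyS, fun s hs => ?_⟩)
        by_cases hsY : s ∈ Y
        · have := Finset.ext_iff.1 hxy s
          simp only [Finset.mem_inter, mem_nbhd, hsY, and_true] at this
          rw [G.adj_comm s, G.adj_comm s]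
          exact this
        · exact hQ t ht x hxB y hyB hxQ hyQ s hs hsY
      ext z
      exact ⟨fun hz => (atomicTypes G S).trans' hz hxy',
        fun hz => (atomicTypes G S).trans' hz (atomicTypes_symm hxy')⟩
    · refine le_trans (Set.ncard_le_ncard (t := ((Finset.univ.image fun v => nbhd G v ∩ Y :
        Finset (Finset V)) : Set (Finset V))) ?_ (Finset.finite_toSet _)) ?_
      · rintro _ ⟨x, _, rfl⟩
        simp
      · rw [Set.ncard_coe_finset]
        convert card_traces_le_nbhdComplexity G hY

end Count

/-! ### From the chain to an order -/

section Order

variable {V : Type*} [Fintype V] {G : SimpleGraph V} {k ρ : ℕ} {D : Decomposition G k ρ}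
  {S : ℕ → Finset V}

/-- An order whose lower sets are sandwiched between consecutive sets of a chain. -/
theorem IsChain.exists_order (h : IsChain D S) : ∃ _ : LinearOrder V, ∀ U : Set V, IsLowerSet U →
    U ⊆ S D.L ∨ ∃ i < D.L, (↑(S (i + 1)) : Set V) ⊆ U ∧ U ⊆ S i := by
  classical
  let idx : V → ℕ := fun v => Nat.findGreatest (fun i => v ∈ S i) D.L
  have hle : ∀ v, idx v ≤ D.L := fun v => Nat.findGreatest_le _
  have hmem : ∀ v, v ∈ S (idx v) := fun v =>
    Nat.findGreatest_spec (P := fun i => v ∈ S i) (Nat.zero_le _)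
      (by rw [h.zero]; exact Finset.mem_univ v)
  have hmax : ∀ v i, i ≤ D.L → v ∈ S i → i ≤ idx v := fun v i hi hv =>
    Nat.le_findGreatest hi hv
  have hanti : ∀ j ≤ D.L, ∀ i ≤ j, S j ⊆ S i := by
    intro j
    induction j with
    | zero => intro _ i hi; rw [Nat.le_zero.1 hi]
    | succ j ih =>
      intro hj i hi
      rcases Nat.lt_or_eq_of_le hi with hlt | rfl
      · exact (h.anti j hj).trans (ih (by omega) i (by omega))
      · exact subset_rfl
  let f : V → ℕ ×ₗ ℕ := fun v => toLex (D.L - idx v, (Fintype.equivFin V v : ℕ))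
  have hf : Function.Injective f := fun u v huv => by
    have h1 : ((Fintype.equivFin V u : ℕ)) = Fintype.equivFin V v :=
      congrArg Prod.snd (toLex.injective huv)
    exact (Fintype.equivFin V).injective (Fin.ext h1)
  refine ⟨LinearOrder.lift' f hf, fun U hU => ?_⟩
  by_cases hUL : U ⊆ S D.L
  · exact Or.inl hUL
  right
  obtain ⟨u₀, hu₀, hu₀L⟩ := Set.not_subset.1 hUL
  -- The order puts larger `idx` earlier. A member of `U` of least `idx` therefore places `U`
  -- between `S (idx u + 1)` and `S (idx u)`.
  obtain ⟨u, hu, hmin⟩ := (Set.toFinite U).exists_minimalFor idx U ⟨u₀, hu₀⟩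
  have hmin' : ∀ x ∈ U, idx u ≤ idx x := fun x hx => by
    rcases le_total (idx u) (idx x) with h1 | h1
    · exact h1
    · exact hmin hx h1
  have hlt : idx u < D.L := by
    refine lt_of_le_of_lt (hmin' u₀ hu₀) (lt_of_le_of_ne (hle u₀) fun he => hu₀L ?_)
    rw [← he]
    exact hmem u₀
  refine ⟨idx u, hlt, fun x hx => ?_, fun x hx => ?_⟩
  · have h1 : idx u + 1 ≤ idx x := hmax x _ hlt hx
    refine hU (a := u) (b := x) ?_ hu
    change f x ≤ f u
    refine le_of_lt (Prod.Lex.toLex_lt_toLex.2 (Or.inl ?_))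
    dsimp only
    have := hle x
    omega
  · exact hanti _ (hle x) _ (hmin' x hx) (hmem x)

end Order

/-! ### Assembling the flip bounds -/

section Main

variable {V : Type*} [Fintype V] {G : SimpleGraph V} {k M r : ℕ}

/-- An element of `S` outside the `(t+1)`-ball is not `R i`-near any vertex of `B`, so it does not
distinguish vertices of `B` in one part of `P i`. -/
theorem ncard_ball_le {i ρ : ℕ} (D : Decomposition G k ρ) (hi : i < D.L) {S' : Finset V} {S : Set V}
    (hS : S ⊆ S') {t : ℕ} (ht : t + 1 ≤ ρ) {v : V} {B : Set V}
    (hB : ∀ x ∈ B, Near (D.R (i + 1)) t v x)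
    (hM : (open Classical in S'.filter fun x => Near (D.R (i + 1)) (t + 1) v x).card ≤ M) :
    (quotientSet B (atomicTypes G S)).ncard ≤ M + k * nbhdComplexity G M := by
  classical
  obtain ⟨T, hT, hcov⟩ := D.width i hi v
  refine ncard_quotientSet_le (Q := D.P i)
    (fun x hx hxS => Finset.mem_filter.2 ⟨hS hxS, (hB x hx).mono_right (Nat.le_succ t)⟩) hM hT
    (fun x hx => hcov x ((hB x hx).mono_right (by omega))) ?_
  intro e _ x hx x' hx' hex hex' s hs hsY
  have hfar : ∀ y ∈ B, ¬ Near (D.R i) 1 s y := fun y hy hn => hsY (Finset.mem_filter.2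
    ⟨hS hs, (hB y hy).trans (hn.symm.mono (D.R_mono (Nat.le_succ i)))⟩)
  exact D.homog i s s x x' (Setoid.refl' _ s) ((D.P i).trans' ((D.P i).symm' hex) hex')
    (hfar x hx) (hfar x' hx')

omit [Fintype V] in
theorem isFlip_self (Q : Setoid V) : IsFlip G Q G := fun _ _ _ _ =>
  Or.inl fun _ _ _ _ _ => Iff.rfl

theorem ncard_quotientSet_le_of_card {B S : Set V} {S' : Finset V} (hS : S ⊆ S')
    (hS' : S'.card ≤ M) (hk : 1 ≤ k) :
    (quotientSet B (atomicTypes G S)).ncard ≤ M + k * nbhdComplexity G M := by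
  rcases B.eq_empty_or_nonempty with rfl | ⟨v, -⟩
  · rw [quotientSet_eq_image]; simp
  · exact ncard_quotientSet_le (Q := fun _ _ => True) (T := {v}) (fun x _ hx => hS hx) hS'
      (by simpa using hk) (fun _ _ => ⟨v, by simp⟩) fun _ _ _ _ _ _ _ _ s hs hsY =>
      absurd (hS hs) hsY

/-- The first part of the theorem for graphs with at least one edge. -/
theorem exists_order_flip (hd : 1 ≤ vcDim G) (hk : 1 ≤ k) (hmw : mw (17 * r + 3) G ≤ k) :
    ∃ _ : LinearOrder V, ∀ S : Set V, IsLowerSet S → ∀ v : V, ∃ G' : SimpleGraph V,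
      IsFlip G (atomicTypes G S) G' ∧ (quotientSet (ball G' r v) (atomicTypes G S)).ncard ≤
        1300 * (vcDim G * k ^ 3) + k * nbhdComplexity G (1300 * (vcDim G * k ^ 3)) := by
  obtain ⟨D⟩ := nonempty_decomposition G hmw
  have hkk : k ≤ vcDim G * k ^ 3 := by
    calc k = 1 * k ^ 1 := by ring
      _ ≤ vcDim G * k ^ 3 := Nat.mul_le_mul hd (Nat.pow_le_pow_right hk (by norm_num))
  obtain ⟨S, hchain, hS⟩ : ∃ S : ℕ → Finset V, IsChain D S ∧ ∀ i < D.L, ∀ U : Set V,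
      (↑(S (i + 1)) : Set V) ⊆ U → U ⊆ S i → ∀ v : V, ∃ G' : SimpleGraph V,
      IsFlip G (atomicTypes G U) G' ∧ (quotientSet (ball G' r v) (atomicTypes G U)).ncard ≤
        1300 * (vcDim G * k ^ 3) + k * nbhdComplexity G (1300 * (vcDim G * k ^ 3)) := by
    -- The token construction needs radius 26, available only for `r ≥ 2`; a ball of radius at most
    -- 1 involves only edges at its centre.
    by_cases hr : r ≤ 1
    · obtain ⟨S, hchain, hF, hc⟩ := exists_chain_singleton D
      refine ⟨S, hchain, fun i hi U h1 h2 v => ?_⟩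
      obtain ⟨G', hG', hadj⟩ := ((hF i hi v).mono h1).exists_flip
      refine ⟨G', hG', ncard_ball_le D hi h2 (t := 17 * r) (by omega) (fun x hx => ?_)
        ((hc i hi _ (by omega) v).trans (by omega))⟩
      have hx : Near G' r v x := hx
      interval_cases r
      · rw [near_zero hx]; exact Near.refl _ _ _
      · rcases hx.succ_cases with rfl | ⟨w, hw, hwx⟩
        · exact Near.refl _ _ _
        · rw [← near_zero hw] at hwx
          exact hadj v x (Or.inl rfl) hwx
    · obtain ⟨S, hchain, hF, hc⟩ := exists_chain_near hd (by omega) D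
      refine ⟨S, hchain, fun i hi U h1 h2 v => ?_⟩
      obtain ⟨G', hG', hadj⟩ := ((hF i hi).mono h1).exists_flip
      refine ⟨G', hG', ncard_ball_le D hi h2 (t := 17 * r) (by omega) (fun x hx => ?_)
        ((hc i hi _ (by omega) v).trans ?_)⟩
      · exact Near.of_adj_near (fun u v => hadj u v (Or.inl trivial)) hx
      · have : 2 * k * (2 * (4 * k * (2 * k * (40 * vcDim G)))) = 1280 * (vcDim G * k ^ 3) := by
          ring
        omega
  obtain ⟨o, ho⟩ := hchain.exists_order
  refine ⟨o, fun U hU v => ?_⟩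
  rcases ho U hU with hUL | ⟨i, hi, h1, h2⟩
  · exact ⟨G, isFlip_self _, ncard_quotientSet_le_of_card hUL (hchain.last.trans (by omega)) hk⟩
  · exact hS i hi U h1 h2 v

theorem adj_false_of_vcDim_eq_zero (h : vcDim G = 0) (u v : V) : ¬ G.Adj u v := by
  classical
  intro huv
  have hsh : (Finset.univ.image (nbhd G)).Shatters {v} := by
    intro t ht
    rcases Finset.subset_singleton_iff.1 ht with rfl | rfl
    · refine ⟨nbhd G v, Finset.mem_image_of_mem _ (Finset.mem_univ v), ?_⟩
      rw [Finset.singleton_inter_of_notMem]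
      simp [mem_nbhd]
    · refine ⟨nbhd G u, Finset.mem_image_of_mem _ (Finset.mem_univ u), ?_⟩
      rw [Finset.singleton_inter_of_mem]
      exact mem_nbhd.2 huv
  have := hsh.card_le_vcDim
  rw [Finset.card_singleton] at this
  have h' : (Finset.univ.image (nbhd G)).vcDim = 0 := h
  omega

theorem ncard_ball_le_one_of_vcDim_eq_zero (h : vcDim G = 0) (v : V) (Q : Setoid V) :
    (quotientSet (ball G r v) Q).ncard ≤ 1 := by
  have hball : ∀ x ∈ ball G r v, v = x := by
    intro x hx
    have hx : Near G r v x := hx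
    cases r with
    | zero => exact near_zero hx
    | succ r =>
      rcases hx.succ_cases with h1 | ⟨w, _, hw⟩
      · exact h1
      · exact absurd hw (adj_false_of_vcDim_eq_zero h w x)
  exact ncard_quotientSet_le_one fun x hx y hy => by
    rw [← hball x hx, ← hball y hy]

theorem bound_le_pow {d k : ℕ} (hdk : 2 ≤ d * k) {p : ℕ}
    (hp : p ≤ (1300 * (d * k ^ 3) + 1) ^ d) :
    1300 * (d * k ^ 3) + k * p ≤ (d * k) ^ (1300 * d) := by
  have hd : 1 ≤ d := Nat.one_le_iff_ne_zero.2 fun h => by rw [h] at hdk; omega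
  have hk : 1 ≤ k := Nat.one_le_iff_ne_zero.2 fun h => by rw [h] at hdk; omega
  set n := d * k with hn
  have h0 : d * k ^ 3 ≤ n ^ 3 := by
    rw [hn, mul_pow]
    exact Nat.mul_le_mul_right _ (Nat.le_self_pow (by norm_num) d)
  have h1 : 1 ≤ n ^ 3 := Nat.one_le_pow _ _ (by omega)
  -- `1301 ≤ 2 ^ 11`, and `2 ≤ n` absorbs the constant into `n ^ 11`.
  have h2 : 1300 * (d * k ^ 3) + 1 ≤ n ^ 14 := by
    calc 1300 * (d * k ^ 3) + 1 ≤ 2 ^ 11 * n ^ 3 := by omega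
      _ ≤ n ^ 11 * n ^ 3 := Nat.mul_le_mul_right _ (Nat.pow_le_pow_left hdk 11)
      _ = n ^ 14 := by rw [← pow_add]
  have hkn : k ≤ n := Nat.le_mul_of_pos_left k hd
  have h3 : p ≤ n ^ (14 * d) := hp.trans ((Nat.pow_le_pow_left h2 d).trans (by rw [← pow_mul]))
  have h4 : n ^ 14 ≤ n ^ (14 * d + 1) := Nat.pow_le_pow_right (by omega) (by omega)
  calc 1300 * (d * k ^ 3) + k * p ≤ n ^ (14 * d + 1) + n * n ^ (14 * d) :=
        Nat.add_le_add (by omega) (Nat.mul_le_mul hkn h3)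
    _ = 2 * n ^ (14 * d + 1) := by ring
    _ ≤ n * n ^ (14 * d + 1) := Nat.mul_le_mul_right _ hdk
    _ = n ^ (14 * d + 2) := by ring
    _ ≤ n ^ (1300 * d) := Nat.pow_le_pow_right (by omega) (by omega)

theorem dmw_le_of_order {c : ℕ} (h : ∃ _ : LinearOrder V, ∀ S : Set V, IsLowerSet S → ∀ v : V,
    (quotientSet (flipBall G (atomicTypes G S) r v) (atomicTypes G S)).ncard ≤ c) :
    dmw r G ≤ c := by
  obtain ⟨o, ho⟩ := h
  refine (Nat.sInf_le (Set.mem_range_self o)).trans ?_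
  exact Finset.sup_le fun u _ => Finset.sup_le fun v _ =>
    ho {w | o.lt w u} (fun _ _ hba ha => lt_of_le_of_lt hba ha) v

omit [Fintype V] in
theorem near_of_mem_flipBall {Q : Setoid V} {G' : SimpleGraph V} (hG' : IsFlip G Q G') {x v : V}
    (hx : x ∈ flipBall G Q r v) : Near G' r v x := by
  have hx : flipDist G Q x v ≤ r := hx
  exact Near.symm (le_trans (le_iSup₂_of_le G' hG' le_rfl) hx)

/-- A bound on the definable merge-width from flips that may depend on the centre. -/
theorem dmw_le_of_flips {c : ℕ} (h : ∃ _ : LinearOrder V, ∀ S : Set V, IsLowerSet S → ∀ v : V,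
    ∃ G' : SimpleGraph V, IsFlip G (atomicTypes G S) G' ∧
      (quotientSet (ball G' r v) (atomicTypes G S)).ncard ≤ c) : dmw r G ≤ c := by
  obtain ⟨o, ho⟩ := h
  refine dmw_le_of_order ⟨o, fun S hS v => ?_⟩
  obtain ⟨G', hG', hc⟩ := ho S hS v
  exact (ncard_quotientSet_mono (fun x hx => near_of_mem_flipBall hG' hx) _).trans hc

theorem exists_linearOrder (V : Type*) [Finite V] : Nonempty (LinearOrder V) := by
  obtain ⟨n, ⟨e⟩⟩ := Finite.exists_equiv_fin V
  exact ⟨LinearOrder.lift' e e.injective⟩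

theorem vcDim_eq_zero_of_mw_eq_zero {ρ : ℕ} (h : mw ρ G = 0) : vcDim G = 0 := by
  classical
  obtain ⟨D⟩ := nonempty_decomposition G h.le
  by_contra hne
  have hex : ∃ u v, G.Adj u v := by
    by_contra! hno
    refine hne (Nat.le_zero.1 (Finset.sup_le fun s hs => ?_))
    obtain ⟨t, ht, hst⟩ := (Finset.mem_shatterer.1 hs) (Finset.Subset.refl s)
    obtain ⟨v, _, rfl⟩ := Finset.mem_image.1 ht
    rw [Nat.le_zero, Finset.card_eq_zero, Finset.eq_empty_iff_forall_notMem]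
    intro x hx
    rw [← hst] at hx
    exact hno v x (mem_nbhd.1 (Finset.mem_inter.1 hx).2)
  obtain ⟨u, v, huv⟩ := hex
  rcases Nat.eq_zero_or_pos D.L with hL | hL
  · have h1 := D.P_last u v
    rw [hL] at h1
    exact huv.ne (D.P_zero _ _ h1)
  · obtain ⟨T, hT, hcov⟩ := D.width 0 hL u
    obtain ⟨t, ht, _⟩ := hcov u (Near.refl _ _ _)
    rw [Finset.card_eq_zero.1 (Nat.le_zero.1 hT)] at ht
    exact Finset.notMem_empty t ht

end Main

/-! ### Confining flip-metric balls with two flips -/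

section TwoFlips

variable {V : Type*} {G : SimpleGraph V} {r : ℕ}

theorem Near.rel {H : SimpleGraph V} {E : V → V → Prop} (hrefl : ∀ v, E v v)
    (htrans : ∀ u v w, E u v → E v w → E u w) (hadj : ∀ u v, H.Adj u v → E u v) {n : ℕ} {u v : V}
    (h : Near H n u v) : E u v := by
  induction n generalizing v with
  | zero => rw [near_zero h]; exact hrefl v
  | succ n ih =>
    rcases h.succ_cases with rfl | ⟨w, h1, h2⟩
    · exact hrefl u
    · exact htrans _ _ _ (ih h1) (hadj _ _ h2)

theorem isFlip_of {Q : Setoid V} {H : SimpleGraph V}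
    (h : ∀ a a' b b', Q a a' → Q b b' → a ≠ b → a' ≠ b' → (H.Adj a b ↔ G.Adj a b) →
      (H.Adj a' b' ↔ G.Adj a' b')) : IsFlip G Q H := by
  intro X hX Y hY
  by_cases hex : ∃ a ∈ X, ∃ b ∈ Y, a ≠ b ∧ (H.Adj a b ↔ G.Adj a b)
  · left
    obtain ⟨a, ha, b, hb, hab, he⟩ := hex
    exact fun x hx y hy hxy => h a x b y ((Setoid.rel_iff_exists_classes _).2 ⟨X, hX, ha, hx⟩)
      ((Setoid.rel_iff_exists_classes _).2 ⟨Y, hY, hb, hy⟩) hab hxy he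
  · right
    push Not at hex
    intro x hx y hy hxy
    have := hex x hx y hy hxy
    tauto

/-- If all pairs of parts are homogeneous, except possibly for one, where the first part splits
into two halves without edges between them, then balls of the flip metric lie inside parts. -/
theorem rel_of_mem_flipBall {Q : Setoid V} {z y : V} (hzy : ¬ Q z y)
    (hom : ∀ a a' b b', Q a a' → Q b b' → ¬ Q a b → ¬ (Q z a ∧ Q y b) → ¬ (Q z b ∧ Q y a) →
      G.Adj a b → G.Adj a' b')
    (h1 : ∀ u v, Q z u → Q y v → (G.Adj u v ↔ G.Adj u y))
    (h2 : ∀ a b, Q z a → Q z b → G.Adj a y → ¬ G.Adj b y → ¬ G.Adj a b)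
    {x v : V} (hx : x ∈ flipBall G Q r v) : Q v x := by
  have hs : ∀ {a b}, Q a b → Q b a := Q.symm'
  have ht : ∀ {a b c}, Q a b → Q b c → Q a c := Q.trans'
  have hno : ∀ {a}, Q z a → Q y a → False := fun h h' => hzy (ht h (hs h'))
  let E : V → V → Prop := fun a b => (Q z a ∧ Q y b) ∨ (Q z b ∧ Q y a)
  have hEs : ∀ {a b}, E a b → E b a := fun h => h.symm
  have hEQ : ∀ {a a' b b'}, Q a a' → Q b b' → E a b → E a' b' := by
    rintro a a' b b' ha hb (⟨h, h'⟩ | ⟨h, h'⟩)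
    · exact Or.inl ⟨ht h ha, ht h' hb⟩
    · exact Or.inr ⟨ht h hb, ht h' ha⟩
  have hQQ : ∀ {a a' b b'}, Q a a' → Q b b' → Q a b → Q a' b' := fun ha hb h =>
    ht (ht (hs ha) h) hb
  have hEnQ : ∀ {a b}, E a b → ¬ Q a b := by
    rintro a b (⟨h, h'⟩ | ⟨h, h'⟩) hab
    · exact hno h (ht h' (hs hab))
    · exact hno h (ht h' hab)
  -- Both flips erase all edges between distinct parts other than the exceptional pair; `G₂` also
  -- complements that pair. The part of `y` is thus linked to only one half of the part of `z`, a
  -- different half in each.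
  let G₁ : SimpleGraph V := ⟨fun a b => G.Adj a b ∧ (Q a b ∨ E a b),
    ⟨fun a b h => ⟨h.1.symm, h.2.imp hs hEs⟩⟩, ⟨fun a h => G.loopless.irrefl a h.1⟩⟩
  let G₂ : SimpleGraph V := ⟨fun a b => (G.Adj a b ∧ Q a b) ∨ (¬ G.Adj a b ∧ E a b),
    ⟨fun a b h => h.imp (fun h => ⟨h.1.symm, hs h.2⟩) fun h => ⟨fun h' => h.1 h'.symm, hEs h.2⟩⟩,
    ⟨fun a h => h.elim (fun h => G.loopless.irrefl a h.1) fun h => hEnQ h.2 (Q.refl' a)⟩⟩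
  have hom' : ∀ {a a' b b'}, Q a a' → Q b b' → ¬ Q a b → ¬ E a b →
      (G.Adj a b ↔ G.Adj a' b') := by
    intro a a' b b' ha hb hab hE
    have hE1 := not_or.1 hE
    have hE2 := not_or.1 fun h => hE (hEQ (hs ha) (hs hb) h)
    exact ⟨hom a a' b b' ha hb hab hE1.1 hE1.2, hom a' a b' b (hs ha) (hs hb)
      (fun h => hab (hQQ (hs ha) (hs hb) h)) hE2.1 hE2.2⟩
  have f₁ : IsFlip G Q G₁ := by
    refine isFlip_of fun a a' b b' ha hb _ _ h => ?_
    change (G.Adj a b ∧ (Q a b ∨ E a b) ↔ G.Adj a b) at h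
    change (G.Adj a' b' ∧ (Q a' b' ∨ E a' b') ↔ G.Adj a' b')
    by_cases hab : Q a b ∨ E a b
    · exact and_iff_left (hab.imp (hQQ ha hb) (hEQ ha hb))
    · have h3 := hom' ha hb (not_or.1 hab).1 (not_or.1 hab).2
      have h4 : ¬ G.Adj a b := fun h5 => hab (h.2 h5).2
      rw [h3] at h4
      exact ⟨fun h => h.1, fun h => absurd h h4⟩
  have f₂ : IsFlip G Q G₂ := by
    refine isFlip_of fun a a' b b' ha hb _ _ h => ?_
    change ((G.Adj a b ∧ Q a b) ∨ (¬ G.Adj a b ∧ E a b) ↔ G.Adj a b) at h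
    change ((G.Adj a' b' ∧ Q a' b') ∨ (¬ G.Adj a' b' ∧ E a' b') ↔ G.Adj a' b')
    by_cases hab : Q a b
    · have h3 := hQQ ha hb hab
      have h4 : ¬ E a' b' := fun h => hEnQ h h3
      tauto
    · by_cases hE : E a b
      · exfalso
        tauto
      · have h3 := hom' ha hb hab hE
        have h4 : ¬ G.Adj a b := fun h5 => by tauto
        have h5 : ¬ E a' b' := fun h => hE (hEQ (hs ha) (hs hb) h)
        rw [h3] at h4
        tauto
  have key : ∀ (H : SimpleGraph V) (C : V → Prop),
      (∀ a b, H.Adj a b → (Q a b ∧ (C a ↔ C b)) ∨ ((C a ∨ Q y a) ∧ (C b ∨ Q y b))) →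
      Near H r v x → (Q v x ∧ (C v ↔ C x)) ∨ ((C v ∨ Q y v) ∧ (C x ∨ Q y x)) := by
    intro H C hadj hn
    refine hn.rel (E := fun v x => (Q v x ∧ (C v ↔ C x)) ∨ ((C v ∨ Q y v) ∧ (C x ∨ Q y x)))
      (fun v => Or.inl ⟨Q.refl' v, Iff.rfl⟩) ?_ hadj
    rintro a b c (⟨h3, h4⟩ | ⟨h3, h4⟩) (⟨h5, h6⟩ | ⟨h5, h6⟩)
    · exact Or.inl ⟨ht h3 h5, h4.trans h6⟩
    · exact Or.inr ⟨h5.imp h4.2 fun h => ht h (hs h3), h6⟩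
    · exact Or.inr ⟨h3, h4.imp h6.1 fun h => ht h h5⟩
    · exact Or.inr ⟨h3, h6⟩
  have hsplit : ∀ {a b}, G.Adj a b → Q a b → ((Q z a ∧ G.Adj a y) ↔ (Q z b ∧ G.Adj b y)) ∧
      ((Q z a ∧ ¬ G.Adj a y) ↔ (Q z b ∧ ¬ G.Adj b y)) := by
    intro a b hab hQ
    have hz : Q z a ↔ Q z b := ⟨fun h => ht h hQ, fun h => ht h (hs hQ)⟩
    by_cases hza : Q z a
    · have hzb := hz.1 hza
      have h3 : G.Adj a y ↔ G.Adj b y := by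
        constructor
        · intro h; by_contra h'; exact h2 a b hza hzb h h' hab
        · intro h; by_contra h'; exact h2 b a hzb hza h h' hab.symm
      tauto
    · tauto
  have k₁ := key G₁ (fun a => Q z a ∧ G.Adj a y) (by
    rintro a b ⟨hab, hQ | ⟨h3, h4⟩ | ⟨h3, h4⟩⟩
    · exact Or.inl ⟨hQ, (hsplit hab hQ).1⟩
    · exact Or.inr ⟨Or.inl ⟨h3, (h1 a b h3 h4).1 hab⟩, Or.inr h4⟩
    · exact Or.inr ⟨Or.inr h4, Or.inl ⟨h3, (h1 b a h3 h4).1 hab.symm⟩⟩)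
    (near_of_mem_flipBall f₁ hx)
  have k₂ := key G₂ (fun a => Q z a ∧ ¬ G.Adj a y) (by
    rintro a b (⟨hab, hQ⟩ | ⟨hab, ⟨h3, h4⟩ | ⟨h3, h4⟩⟩)
    · exact Or.inl ⟨hQ, (hsplit hab hQ).2⟩
    · exact Or.inr ⟨Or.inl ⟨h3, fun h => hab ((h1 a b h3 h4).2 h)⟩, Or.inr h4⟩
    · exact Or.inr ⟨Or.inr h4, Or.inl ⟨h3, fun h => hab ((h1 b a h3 h4).2 h).symm⟩⟩)
    (near_of_mem_flipBall f₂ hx)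
  rcases k₁ with ⟨h, _⟩ | ⟨hv, hx'⟩
  · exact h
  rcases k₂ with ⟨h, _⟩ | ⟨hv₂, hx₂⟩
  · exact h
  -- A vertex reached outside its starting part in both flips lies in the part of `y`, as the two
  -- halves are disjoint; the same holds for the centre.
  have both : ∀ {a}, ((Q z a ∧ G.Adj a y) ∨ Q y a) → ((Q z a ∧ ¬ G.Adj a y) ∨ Q y a) → Q y a := by
    rintro a (⟨h3, h4⟩ | h3) (⟨h5, h6⟩ | h5)
    · exact absurd h4 h6
    · exact h5
    · exact h3
    · exact h3
  exact ht (hs (both hv hv₂)) (both hx' hx₂)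

/-- If all pairs of distinct parts are homogeneous, then balls of the flip metric lie inside
parts. -/
theorem rel_of_mem_flipBall_of_homogeneous {Q : Setoid V}
    (hom : ∀ a a' b b', Q a a' → Q b b' → ¬ Q a b → G.Adj a b → G.Adj a' b')
    {x v : V} (hx : x ∈ flipBall G Q r v) : Q v x := by
  by_contra hvx
  refine hvx (rel_of_mem_flipBall hvx (fun a a' b b' ha hb hab _ _ => hom a a' b b' ha hb hab)
    (fun a b ha hb => ?_) (fun a b ha hb h h' _ => h' ?_) hx)
  · have hab : ¬ Q a b := fun h => hvx (Q.trans' ha (Q.trans' h (Q.symm' hb)))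
    exact ⟨hom a a b x (Q.refl' a) (Q.symm' hb) hab, hom a a x b (Q.refl' a) hb
      fun h => hvx (Q.trans' ha h)⟩
  · exact hom a b x x (Q.trans' (Q.symm' ha) hb) (Q.refl' x) (fun h => hvx (Q.trans' ha h)) h

end TwoFlips

/-! ### The extremal case of width and VC-dimension one -/

section WidthOne

variable {V : Type*} [Fintype V] {G : SimpleGraph V} {r : ℕ}

/-- In a graph of VC-dimension one, no edge has both a common neighbour and a common
non-neighbour. -/
theorem false_of_vcDim_le_one (h : vcDim G ≤ 1) {a b u w : V} (hab : G.Adj a b) (hua : G.Adj u a)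
    (hub : G.Adj u b) (hwa : ¬ G.Adj w a) (hwb : ¬ G.Adj w b) : False := by
  classical
  have hsh : (Finset.univ.image (nbhd G)).Shatters {a, b} := by
    intro t ht
    have key : ∀ c, (G.Adj c a ↔ a ∈ t) → (G.Adj c b ↔ b ∈ t) →
        ∃ s ∈ Finset.univ.image (nbhd G), {a, b} ∩ s = t := by
      intro c h1 h2
      refine ⟨nbhd G c, Finset.mem_image_of_mem _ (Finset.mem_univ c), ?_⟩
      ext x
      rw [Finset.mem_inter, mem_nbhd, Finset.mem_insert, Finset.mem_singleton]
      constructor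
      · rintro ⟨rfl | rfl, h3⟩
        · exact h1.1 h3
        · exact h2.1 h3
      · intro hx
        rcases Finset.mem_insert.1 (ht hx) with rfl | hxb
        · exact ⟨Or.inl rfl, h1.2 hx⟩
        · rw [Finset.mem_singleton.1 hxb] at hx ⊢
          exact ⟨Or.inr rfl, h2.2 hx⟩
    -- The four traces on `{a, b}` come from the common neighbour, the two endpoints and the common
    -- non-neighbour.
    by_cases ha : a ∈ t <;> by_cases hb : b ∈ t
    · exact key u (by simp [hua, ha]) (by simp [hub, hb])
    · exact key b (by simp [hab.symm, ha]) (by simp [hb])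
    · exact key a (by simp [ha]) (by simp [hab, hb])
    · exact key w (by simp [hwa, ha]) (by simp [hwb, hb])
  have h1 := hsh.card_le_vcDim
  rw [Finset.card_pair hab.ne] at h1
  have h2 : (Finset.univ.image (nbhd G)).vcDim ≤ 1 := h
  omega

/-- Complete multipartite graphs. -/
theorem dmw_le_one_of_multipartite
    (h : ∀ a b c, ¬ G.Adj a b → ¬ G.Adj b c → ¬ G.Adj a c) : dmw r G ≤ 1 := by
  obtain ⟨o⟩ := exists_linearOrder V
  refine dmw_le_of_order ⟨o, fun S _ v => ?_⟩
  -- Non-adjacent vertices are twins, so distinct types outside `S` are completely joined.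
  have hom : ∀ a a' b b', atomicTypes G S a a' → atomicTypes G S b b' → ¬ atomicTypes G S a b →
      ¬ G.Adj a b → ¬ G.Adj a' b' := by
    intro a a' b b' ha hb hab hn
    by_cases haS : a ∈ S
    · have : a = a' := by
        by_contra hne
        exact (atomicTypes_notMem ha hne).1 haS
      rw [← this, ← atomicTypes_adj hb haS]
      exact hn
    by_cases hbS : b ∈ S
    · have : b = b' := by
        by_contra hne
        exact (atomicTypes_notMem hb hne).1 hbS
      rw [← this, G.adj_comm, ← atomicTypes_adj ha hbS, G.adj_comm]
      exact hn
    · refine absurd (atomicTypes_iff.2 (Or.inr ⟨haS, hbS, fun s _ => ?_⟩)) hab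
      constructor
      · intro h1; by_contra h2; exact h s b a h2 (fun h3 => hn h3.symm) h1
      · intro h1; by_contra h2; exact h s a b h2 hn h1
  have hin : ∀ x ∈ flipBall G (atomicTypes G S) r v, atomicTypes G S v x := fun x hx =>
    rel_of_mem_flipBall_of_homogeneous (fun a a' b b' ha hb hab h3 => by
      by_contra h4
      exact hom a' a b' b (atomicTypes_symm ha) (atomicTypes_symm hb) (fun h5 => hab
        ((atomicTypes G S).trans' ((atomicTypes G S).trans' ha h5) (atomicTypes_symm hb))) h4 h3) hx
  exact ncard_quotientSet_le_one fun x hx y hy =>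
    (atomicTypes G S).trans' (atomicTypes_symm (hin x hx)) (hin y hy)

/-- Disjoint unions of complete bipartite graphs. -/
theorem dmw_le_one_of_bipartite
    (h : ∀ a b c d, G.Adj a b → G.Adj b c → G.Adj c d → G.Adj a d) : dmw r G ≤ 1 := by
  let comp : Setoid V :=
    { r := fun u v => u = v ∨ G.Adj u v ∨ ∃ w, G.Adj u w ∧ G.Adj w v
      iseqv :=
        { refl := fun _ => Or.inl rfl
          symm := by
            rintro u v (rfl | h1 | ⟨w, h1, h2⟩)
            · exact Or.inl rfl
            · exact Or.inr (Or.inl h1.symm)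
            · exact Or.inr (Or.inr ⟨w, h2.symm, h1.symm⟩)
          trans := by
            rintro u v w (rfl | h1 | ⟨x, h1, h2⟩) (rfl | h3 | ⟨y, h3, h4⟩)
            · exact Or.inl rfl
            · exact Or.inr (Or.inl h3)
            · exact Or.inr (Or.inr ⟨y, h3, h4⟩)
            · exact Or.inr (Or.inl h1)
            · exact Or.inr (Or.inr ⟨v, h1, h3⟩)
            · exact Or.inr (Or.inl (h _ _ _ _ h1 h3 h4))
            · exact Or.inr (Or.inr ⟨x, h1, h2⟩)
            · exact Or.inr (Or.inl (h _ _ _ _ h1 h2 h3))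
            · exact Or.inr (Or.inr ⟨y, h _ _ _ _ h1 h2 h3, h4⟩) } }
  obtain ⟨c, hc⟩ := exists_label comp
  let f : V → ℕ ×ₗ ℕ := fun v => toLex (c v, (Fintype.equivFin V v : ℕ))
  have hf : Function.Injective f := fun u v huv => by
    have h1 : ((Fintype.equivFin V u : ℕ)) = Fintype.equivFin V v :=
      congrArg Prod.snd (toLex.injective huv)
    exact (Fintype.equivFin V).injective (Fin.ext h1)
  refine dmw_le_of_order ⟨LinearOrder.lift' f hf, fun S hS v => ?_⟩
  -- Components are consecutive in the order, so a prefix splits at most one of them; only there can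
  -- a pair of types be mixed.
  have hlow : ∀ s ∈ S, ∀ x ∉ S, c s ≤ c x := by
    intro s hs x hx
    by_contra! hlt
    refine hx (hS (a := s) (b := x) ?_ hs)
    change f x ≤ f s
    exact le_of_lt (Prod.Lex.toLex_lt_toLex.2 (Or.inl hlt))
  set Q := atomicTypes G S with hQ
  -- pairs on which the adjacency is not determined by the types
  let Half : V → V → Prop := fun x y => x ∉ S ∧ y ∉ S ∧ G.Adj x y ∧ (∀ s ∈ S, ¬ G.Adj s x) ∧
    ∃ s ∈ S, G.Adj s y
  have hbad : ∀ a a' b b', Q a a' → Q b b' → ¬ Q a b → G.Adj a b → ¬ G.Adj a' b' →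
      Half a b ∨ Half b a := by
    intro a a' b b' ha hb hab h1 h2
    have haS : a ∉ S := fun haS => by
      have : a = a' := by
        by_contra hne
        exact (atomicTypes_notMem ha hne).1 haS
      rw [← this, ← atomicTypes_adj hb haS] at h2
      exact h2 h1
    have hbS : b ∉ S := fun hbS => by
      have : b = b' := by
        by_contra hne
        exact (atomicTypes_notMem hb hne).1 hbS
      rw [← this, G.adj_comm, ← atomicTypes_adj ha hbS, G.adj_comm] at h2
      exact h2 h1
    by_cases hea : ∃ s ∈ S, G.Adj s a <;> by_cases heb : ∃ s ∈ S, G.Adj s b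
    · obtain ⟨s, hs, hsa⟩ := hea
      obtain ⟨t, ht, htb⟩ := heb
      have hsa' := (atomicTypes_adj ha hs).1 hsa
      have htb' := (atomicTypes_adj hb ht).1 htb
      exact absurd (h _ _ _ _ (h _ _ _ _ hsa'.symm hsa h1) htb.symm htb') h2
    · push Not at heb
      exact Or.inr ⟨hbS, haS, h1.symm, heb, hea⟩
    · push Not at hea
      exact Or.inl ⟨haS, hbS, h1, hea, heb⟩
    · push Not at hea heb
      exact absurd (atomicTypes_iff.2 (Or.inr ⟨haS, hbS, fun s hs =>
        iff_of_false (hea s hs) (heb s hs)⟩)) hab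
  have hin : ∀ x ∈ flipBall G Q r v, Q v x := by
    intro x hx
    by_cases hex : ∃ z y, Half z y
    swap
    · push Not at hex
      refine rel_of_mem_flipBall_of_homogeneous (fun a a' b b' ha hb hab h1 => ?_) hx
      by_contra h2
      rcases hbad a a' b b' ha hb hab h1 h2 with h3 | h3
      · exact hex _ _ h3
      · exact hex _ _ h3
    obtain ⟨z, y, hzS, hyS, hzy, hz, t, htS, hty⟩ := hex
    have hz' : ∀ a, Q z a → ∀ s ∈ S, ¬ G.Adj s a := fun a ha s hs =>
      fun h1 => hz s hs ((atomicTypes_adj ha hs).2 h1)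
    have huniq : ∀ a b, Half a b → Q z a ∧ Q y b := by
      rintro a b ⟨haS, hbS, hab, ha, s, hsS, hsb⟩
      have hcz : c z = c t := (hc z t).2 (Or.inr (Or.inr ⟨y, hzy, hty.symm⟩))
      have hca : c a = c s := (hc a s).2 (Or.inr (Or.inr ⟨b, hab, hsb.symm⟩))
      have h1 := hlow s hsS z hzS
      have h2 := hlow t htS a haS
      have h3 : comp t s := (hc t s).1 (by omega)
      have hyb : ∀ u, G.Adj u y ↔ G.Adj u b := by
        have hsy : G.Adj s y := by
          rcases h3 with rfl | h3 | ⟨w, h3, h4⟩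
          · exact hty
          · exact absurd (h _ _ _ _ h3.symm hty hzy.symm) (hz s hsS)
          · exact h _ _ _ _ h4.symm h3.symm hty
        exact fun u => ⟨fun h4 => h _ _ _ _ h4 hsy.symm hsb, fun h4 => h _ _ _ _ h4 hsb.symm hsy⟩
      exact ⟨atomicTypes_iff.2 (Or.inr ⟨hzS, haS, fun s hs => iff_of_false (hz s hs) (ha s hs)⟩),
        atomicTypes_iff.2 (Or.inr ⟨hyS, hbS, fun s _ => hyb s⟩)⟩
    refine rel_of_mem_flipBall (z := z) (y := y) ?_ ?_ ?_ ?_ hx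
    · exact fun h1 => hz' y h1 t htS hty
    · intro a a' b b' ha hb hab h1 h2 h3
      by_contra h4
      rcases hbad a a' b b' ha hb hab h3 h4 with h5 | h5
      · exact h1 (huniq _ _ h5)
      · exact h2 (huniq _ _ h5)
    · intro u w _ hw
      have htw := (atomicTypes_adj hw htS).1 hty
      exact ⟨fun h1 => h _ _ _ _ h1 htw.symm hty, fun h1 => h _ _ _ _ h1 hty.symm htw⟩
    · intro a b _ hb h1 _ h3
      exact hz' b hb t htS (h _ _ _ _ hty h1.symm h3)
  exact ncard_quotientSet_le_one fun x hx y hy =>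
    Q.trans' (Q.symm' (hin x hx)) (hin y hy)

/-- With width 1, edges of `R (i + 1)` stay inside parts of `P i`, so cross pairs are homogeneous.
At the top nontrivial level they are all edges, and VC-dimension 1 makes non-adjacency transitive,
or all non-edges, and it excludes triangles; then paths on three edges close up. -/
theorem dmw_le_one {ρ : ℕ} (hρ : 1 ≤ ρ) (hd : vcDim G ≤ 1) (hmw : mw ρ G ≤ 1) : dmw r G ≤ 1 := by
  classical
  obtain ⟨D⟩ := nonempty_decomposition G hmw
  have hR : ∀ i < D.L, ∀ x y, ¬ D.P i x y → ¬ Near (D.R (i + 1)) 1 x y := by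
    intro i hi x y hP hn
    obtain ⟨T, hT, hcov⟩ := D.width i hi x
    obtain ⟨a, ha, h1⟩ := hcov x (Near.refl _ _ _)
    obtain ⟨b, hb, h2⟩ := hcov y (hn.mono_right hρ)
    rw [Finset.card_le_one.1 hT a ha b hb] at h1
    exact hP ((D.P i).trans' ((D.P i).symm' h1) h2)
  have hhom : ∀ i < D.L, ∀ x y x' y', D.P (i + 1) x x' → D.P (i + 1) y y' → ¬ D.P i x y →
      ¬ D.P i x' y' → (G.Adj x y ↔ G.Adj x' y') := fun i hi x y x' y' hx hy h1 h2 =>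
    D.homog (i + 1) x x' y y' hx hy (hR i hi _ _ h1) (hR i hi _ _ h2)
  by_cases hsub : ∀ u v : V, u = v
  · exact dmw_le_one_of_multipartite fun a b c _ _ h => h.ne (hsub a c)
  push Not at hsub
  obtain ⟨p, q, hpq⟩ := hsub
  -- the last index at which the partition is not trivial
  obtain ⟨i, hi, hall, x₀, y₀, hxy₀⟩ : ∃ i < D.L, (∀ u v, D.P (i + 1) u v) ∧
      ∃ x y, ¬ D.P i x y := by
    have hex : ∃ t, ∀ u v, D.P t u v := ⟨D.L, D.P_last⟩
    have h0 : Nat.find hex ≠ 0 := fun h0 => hpq (D.P_zero _ _ (by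
      have := Nat.find_spec hex p q
      rwa [h0] at this))
    obtain ⟨i, hi⟩ := Nat.exists_eq_succ_of_ne_zero h0
    refine ⟨i, ?_, ?_, ?_⟩
    · have : Nat.find hex ≤ D.L := Nat.find_min' hex D.P_last
      omega
    · have := Nat.find_spec hex
      rwa [hi] at this
    · have := Nat.find_min hex (m := i) (by omega)
      push Not at this
      exact this
  have hout : ∀ a, ∃ w, ¬ D.P i a w := by
    intro a
    by_contra! hcon
    exact hxy₀ ((D.P i).trans' ((D.P i).symm' (hcon x₀)) (hcon y₀))
  have hcross : ∀ a b, ¬ D.P i a b → (G.Adj a b ↔ G.Adj x₀ y₀) := fun a b hab =>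
    hhom i hi _ _ _ _ (hall _ _) (hall _ _) hab hxy₀
  by_cases hadj : G.Adj x₀ y₀
  · refine dmw_le_one_of_multipartite fun a b c hab hbc hac => ?_
    have h1 : D.P i a b := by
      by_contra h1
      exact hab ((hcross a b h1).2 hadj)
    have h2 : D.P i b c := by
      by_contra h2
      exact hbc ((hcross b c h2).2 hadj)
    obtain ⟨w, hw⟩ := hout a
    have hw' : ¬ D.P i c w := fun h3 => hw ((D.P i).trans' ((D.P i).trans' h1 h2) h3)
    exact false_of_vcDim_le_one hd hac ((hcross a w hw).2 hadj).symm ((hcross c w hw').2 hadj).symm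
      (fun h => hab h.symm) hbc
  · have htri : ∀ a b c, G.Adj a b → G.Adj b c → ¬ G.Adj a c := by
      intro a b c hab hbc hac
      have h1 : D.P i a b := by
        by_contra h1
        exact hadj ((hcross a b h1).1 hab)
      obtain ⟨w, hw⟩ := hout a
      have hw' : ¬ D.P i b w := fun h3 => hw ((D.P i).trans' h1 h3)
      exact false_of_vcDim_le_one hd hab hac.symm hbc.symm
        (fun h => hadj ((hcross a w hw).1 h.symm)) (fun h => hadj ((hcross b w hw').1 h.symm))
    refine dmw_le_one_of_bipartite fun a b c d hab hbc hcd => ?_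
    have hex : ∃ t, D.P t a b ∧ D.P t b c ∧ D.P t c d :=
      ⟨D.L, D.P_last _ _, D.P_last _ _, D.P_last _ _⟩
    have h0 : Nat.find hex ≠ 0 := fun h0 => hab.ne (D.P_zero _ _ (by
      have := (Nat.find_spec hex).1
      rwa [h0] at this))
    obtain ⟨j, hj⟩ := Nat.exists_eq_succ_of_ne_zero h0
    have hjL : j < D.L := by
      have : Nat.find hex ≤ D.L :=
        Nat.find_min' hex ⟨D.P_last _ _, D.P_last _ _, D.P_last _ _⟩
      omega
    obtain ⟨e1, e2, e3⟩ : D.P (j + 1) a b ∧ D.P (j + 1) b c ∧ D.P (j + 1) c d := by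
      have := Nat.find_spec hex
      rwa [hj] at this
    have hmin : ¬ (D.P j a b ∧ D.P j b c ∧ D.P j c d) := Nat.find_min hex (by omega)
    have hs : ∀ {t a b}, D.P t a b → D.P t b a := fun h => (D.P _).symm' h
    have ht : ∀ {t a b c}, D.P t a b → D.P t b c → D.P t a c := fun h h' => (D.P _).trans' h h'
    have hac : D.P (j + 1) a c := ht e1 e2
    have had : D.P (j + 1) a d := ht hac e3
    have r := fun (v : V) => (D.P (j + 1)).refl' v
    -- one of the three edges joins different parts
    obtain ⟨x, y, hx, hxy, hy⟩ : ∃ x y, D.P (j + 1) a x ∧ G.Adj x y ∧ D.P (j + 1) a y ∧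
        ¬ D.P j x y := by
      by_contra! hcon
      exact hmin ⟨hcon a b (r a) hab e1, hcon b c e1 hbc hac, hcon c d hac hcd had⟩
    have hjoin : ∀ u v, D.P (j + 1) a u → D.P (j + 1) a v → ¬ D.P j u v → G.Adj u v :=
      fun u v hu hv huv => (hhom j hjL x y u v (ht (hs hx) hu) (ht (hs hy.1) hv) hy.2 huv).1 hxy
    -- no edge joins vertices of the same part
    have hind : ∀ u v, D.P (j + 1) a u → D.P (j + 1) a v → D.P j u v → ¬ G.Adj u v := by
      intro u v hu hv huv huv'
      obtain ⟨w, hw, hw'⟩ : ∃ w, D.P (j + 1) a w ∧ ¬ D.P j u w := by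
        by_cases hux : D.P j u x
        · exact ⟨y, hy.1, fun h => hy.2 (ht (hs hux) h)⟩
        · exact ⟨x, hx, hux⟩
      exact htri u v w huv' (hjoin v w hv hw fun h => hw' (ht huv h)) (hjoin u w hu hw hw')
    have n1 : ¬ D.P j a b := fun h => hind a b (r a) e1 h hab
    have n2 : ¬ D.P j b c := fun h => hind b c e1 hac h hbc
    have n3 : ¬ D.P j c d := fun h => hind c d hac had h hcd
    have p1 : D.P j a c := by
      -- Different parts are joined, so otherwise `a`, `b`, `c` would form a triangle.
      by_contra h
      exact htri a b c hab hbc (hjoin a c (r a) hac h)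
    exact hjoin a d (r a) had fun h => n3 (ht (hs p1) h)

end WidthOne

end MergeWidth

/-- One absolute constant `C` serves all three `O`-bounds. Prefixes of the order are its lower sets.
The last inequality uses `0 ^ 0 = 1`. -/
theorem theorem6p1 :
    ∃ C : ℕ, ∀ (V : Type*) [Fintype V] [Nonempty V] (G : SimpleGraph V) (d r : ℕ),
      MergeWidth.vcDim G = d →
      (∀ k : ℕ, 1 ≤ k → MergeWidth.mw (17 * r + 3) G ≤ k →
        ∃ M : ℕ, M ≤ C * (d * k ^ 3) ∧
          (∃ _ : LinearOrder V, ∀ S : Set V, IsLowerSet S → ∀ v : V,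
            ∃ G' : SimpleGraph V,
              MergeWidth.IsFlip G (MergeWidth.atomicTypes G S) G' ∧
              (MergeWidth.quotientSet (MergeWidth.ball G' r v)
                  (MergeWidth.atomicTypes G S)).ncard ≤
                M + k * MergeWidth.nbhdComplexity G M) ∧
          (2 ≤ d * k → M + k * MergeWidth.nbhdComplexity G M ≤ (d * k) ^ (C * d))) ∧
      MergeWidth.dmw r G ≤ d ^ (C * d) * MergeWidth.mw (17 * r + 3) G ^ (C * d) := by
  refine ⟨1300, fun V _ _ G d r hd => ?_⟩
  subst hd
  have hbound : ∀ k, 2 ≤ MergeWidth.vcDim G * k →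
      1300 * (MergeWidth.vcDim G * k ^ 3) +
        k * MergeWidth.nbhdComplexity G (1300 * (MergeWidth.vcDim G * k ^ 3)) ≤
      (MergeWidth.vcDim G * k) ^ (1300 * MergeWidth.vcDim G) := fun k hk =>
    MergeWidth.bound_le_pow hk (MergeWidth.nbhdComplexity_le_pow G _)
  have hflat : MergeWidth.vcDim G = 0 → ∃ _ : LinearOrder V, ∀ S : Set V, IsLowerSet S → ∀ v : V,
      ∃ G' : SimpleGraph V, MergeWidth.IsFlip G (MergeWidth.atomicTypes G S) G' ∧
        (MergeWidth.quotientSet (MergeWidth.ball G' r v) (MergeWidth.atomicTypes G S)).ncard ≤ 1 :=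
    fun h0 => by
      obtain ⟨o⟩ := MergeWidth.exists_linearOrder V
      exact ⟨o, fun S _ v => ⟨G, MergeWidth.isFlip_self _,
        MergeWidth.ncard_ball_le_one_of_vcDim_eq_zero h0 v _⟩⟩
  constructor
  · intro k hk hmw
    refine ⟨1300 * (MergeWidth.vcDim G * k ^ 3), le_rfl, ?_, hbound k⟩
    rcases Nat.eq_zero_or_pos (MergeWidth.vcDim G) with h0 | hpos
    · obtain ⟨o, ho⟩ := hflat h0
      refine ⟨o, fun S hS v => ?_⟩
      obtain ⟨G', hG', hc⟩ := ho S hS v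
      refine ⟨G', hG', hc.trans ?_⟩
      have := Nat.mul_le_mul hk
        (MergeWidth.one_le_nbhdComplexity G (1300 * (MergeWidth.vcDim G * k ^ 3)))
      omega
    · exact MergeWidth.exists_order_flip hpos hk hmw
  · rw [← mul_pow]
    rcases Nat.eq_zero_or_pos (MergeWidth.vcDim G) with h0 | hpos
    · rw [h0, mul_zero, pow_zero]
      exact MergeWidth.dmw_le_of_flips (hflat h0)
    · rcases Nat.eq_zero_or_pos (MergeWidth.mw (17 * r + 3) G) with h1 | hpos'
      · exact absurd (MergeWidth.vcDim_eq_zero_of_mw_eq_zero h1) (by omega)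
      · rcases Nat.lt_or_ge (MergeWidth.vcDim G * MergeWidth.mw (17 * r + 3) G) 2 with hlt | hge
        -- The general estimate needs `2 ≤ d * k`; in this remaining case the right-hand side is
        -- exactly 1.
        · have h2 : MergeWidth.vcDim G * MergeWidth.mw (17 * r + 3) G = 1 := by
            have := Nat.mul_pos hpos hpos'
            omega
          have h3 := Nat.eq_one_of_mul_eq_one_right h2
          have h4 := Nat.eq_one_of_mul_eq_one_left h2
          rw [h2, one_pow]
          exact MergeWidth.dmw_le_one (by omega) h3.le h4.le
        · exact (MergeWidth.dmw_le_of_flips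
            (MergeWidth.exists_order_flip hpos hpos' le_rfl)).trans (hbound _ hge)
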